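/- Let $m\in\mathbb C$ with $\operatorname{Re} m>-1$, and work in the Hilbert space $L^2[0,\infty[$. For $\alpha\in\mathbb C$ let $$L_\alpha=-\partial_x^2+\Big(-\frac14+\alpha\Big)\frac1{x^2}.$$ Let $L_\alpha^{\min}$ be the closure of $L_\alpha$ on $C_c^\infty(]0,\infty[)$, and let $L_\alpha^{\max}$ be $L_\alpha$ (in the sense of distributions on $]0,\infty[$) on the domain of all $f\in L^2[0,\infty[$ with $L_\alpha f\in L^2[0,\infty[$. Let $H_m$ be the restriction of $L_{m^2}^{\max}$ to $$\operatorname{Dom}L_{m^2}^{\min}+\mathbb C\,x^{\frac12+m}\xi,$$ where $\xi$ is any smooth compactly supported cutoff equal to $1$ around $0$. Let $X^2$ be the operator of multiplication by $x^2$, with domain all $f\in L^2[0,\infty[$ such that $x^2f\in L^2[0,\infty[$. Let $$A=\frac1{2\mathrm i}(x\partial_x+\partial_x x),$$ with derivatives in the sense of distributions on $]0,\infty[$ and with domain all $f\in L^2[0,\infty[$ such that $Af\in L^2[0,\infty[$. Let $$J_m(z)=\sum_{j=0}^\infty\frac{(-1)^j}{j!\,\Gamma(m+j+1)}\Big(\frac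 z2\Big)^{2j+m},\qquad z>0,$$ be the Bessel function. **Theorem.** The operator $A$ is self-adjoint and is the generator of the dilations $(U_\tau f)(x)=e^{\tau/2}f(e^\tau x)$, $\tau\in\mathbb R$: for $f,g\in L^2[0,\infty[$ one has $f\in\operatorname{Dom}A$ and $Af=g$ if and only if $\tau\mapsto U_\tau f\in L^2[0,\infty[$ is differentiable at $\tau=0$ with derivative $\mathrm i g$. The Hankel transformation $$(\mathcal F_mf)(k)=\int_0^\infty J_m(kx)\sqrt{kx}\,f(x)\,dx$$ is a well-defined bounded invertible operator on $L^2[0,\infty[$; here the integral is the $L^2$-limit, as $R\to\infty$, of the absolutely convergent integrals $\int_0^R$. It is an involution, $\mathcal F_m^2=1$. It diagonalizes $H_m$: $$\mathcal F_mH_m\mathcal F_m^{-1}=X^2.$$ It satisfies $$\mathcal F_mA=-A\mathcal F_m.$$ The last two identities are equalities of unbounded operators, including their domains. -/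

import Mathlib

open MeasureTheory Filter Topology
open scoped ContDiff ENNReal

noncomputable section

namespace HalfLine

/-- Lebesgue measure on the half-line `]0,∞[`. -/
abbrev μ : Measure ℝ := volume.restrict (Set.Ioi (0 : ℝ))

/-- The Hilbert space `L²[0,∞[` of complex square integrable functions on the half-line. -/
abbrev L2 : Type := Lp ℂ 2 μ

/-! ### Test functions -/

/-- `φ ∈ C_c^∞(]0,∞[)`, viewed as a function on `ℝ` vanishing outside its support. -/
structure IsTest (φ : ℝ → ℂ) : Prop where
  contDiff : ContDiff ℝ ∞ φ
  compact : HasCompactSupport φ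
  supp : tsupport φ ⊆ Set.Ioi 0

theorem IsTest.add {φ ψ : ℝ → ℂ} (hφ : IsTest φ) (hψ : IsTest ψ) : IsTest (φ + ψ) :=
  ⟨hφ.contDiff.add hψ.contDiff, hφ.compact.add hψ.compact,
    (tsupport_add φ ψ).trans (Set.union_subset hφ.supp hψ.supp)⟩

theorem IsTest.smul {φ : ℝ → ℂ} (hφ : IsTest φ) (c : ℂ) : IsTest (c • φ) :=
  ⟨contDiff_const.smul hφ.contDiff, hφ.compact.mono (Function.support_const_smul_subset c φ),
    (closure_mono (Function.support_const_smul_subset c φ)).trans hφ.supp⟩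

theorem IsTest.zero : IsTest 0 :=
  ⟨contDiff_const, HasCompactSupport.zero, by simp⟩

theorem IsTest.deriv {φ : ℝ → ℂ} (hφ : IsTest φ) : IsTest (deriv φ) :=
  ⟨hφ.contDiff.iterate_deriv 1, hφ.compact.deriv,
    tsupport_deriv_subset.trans hφ.supp⟩

/-- The product of a test function with a function that is smooth on `]0,∞[`. -/
theorem IsTest.mul_left {φ w : ℝ → ℂ} (hφ : IsTest φ) (hw : ∀ x : ℝ, 0 < x → ContDiffAt ℝ ∞ w x) :
    IsTest (fun x => w x * φ x) := by
  refine ⟨contDiff_iff_contDiffAt.2 fun x => ?_, hφ.compact.mul_left, ?_⟩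
  · by_cases hx : x ∈ tsupport φ
    · exact (hw x (hφ.supp hx)).mul hφ.contDiff.contDiffAt
    · have h0 : (fun y => w y * φ y) =ᶠ[𝓝 x] fun _ => 0 := by
        filter_upwards [notMem_tsupport_iff_eventuallyEq.1 hx] with y hy
        simp [hy]
      exact contDiffAt_const.congr_of_eventuallyEq h0
  · exact (closure_mono (Function.support_mul_subset_right w φ)).trans hφ.supp

theorem IsTest.memLp {φ : ℝ → ℂ} (hφ : IsTest φ) : MemLp φ 2 μ :=
  (hφ.contDiff.continuous.memLp_of_hasCompactSupport (μ := volume) hφ.compact).restrict _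

theorem IsTest.integrable_mul {φ : ℝ → ℂ} (hφ : IsTest φ) (f : L2) :
    Integrable (fun x => f x * φ x) μ :=
  (Lp.memLp f).integrable_mul hφ.memLp

/-! ### Weakly defined operators -/

/-- The graph of the maximal realization of a differential operator on `L²[0,∞[`, where `T` is the
formal transpose of the differential expression: `(f, g)` belongs to it if and only if `f` is
mapped to `g` in the sense of distributions on `]0,∞[`. -/
def weakGraph (T : (ℝ → ℂ) → ℝ → ℂ) (hT : ∀ φ, IsTest φ → IsTest (T φ)) : Submodule ℂ (L2 × L2) where
  carrier := {p | ∀ φ, IsTest φ → ∫ x, p.1 x * T φ x ∂μ = ∫ x, p.2 x * φ x ∂μ}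
  zero_mem' := by
    intro φ _
    have h0 : ((0 : L2) : ℝ → ℂ) =ᵐ[μ] 0 := Lp.coeFn_zero ..
    have h1 : ∀ u : ℝ → ℂ, ∫ x, (0 : L2) x * u x ∂μ = 0 := fun u =>
      integral_eq_zero_of_ae (by filter_upwards [h0] with x hx; rw [hx]; simp)
    exact (h1 _).trans (h1 _).symm
  add_mem' := by
    intro p q hp hq φ hφ
    have h1 := Lp.coeFn_add p.1 q.1
    have h2 := Lp.coeFn_add p.2 q.2
    rw [integral_congr_ae (g := fun x => p.1 x * T φ x + q.1 x * T φ x),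
      integral_congr_ae (f := fun x => (p + q).2 x * φ x)
        (g := fun x => p.2 x * φ x + q.2 x * φ x),
      integral_add ((hT φ hφ).integrable_mul _) ((hT φ hφ).integrable_mul _),
      integral_add (hφ.integrable_mul _) (hφ.integrable_mul _), hp φ hφ, hq φ hφ]
    · filter_upwards [h2] with x hx
      rw [Prod.snd_add, hx, Pi.add_apply, add_mul]
    · filter_upwards [h1] with x hx
      rw [Prod.fst_add, hx, Pi.add_apply, add_mul]
  smul_mem' := by
    intro c p hp φ hφ
    have h1 := Lp.coeFn_smul c p.1
    have h2 := Lp.coeFn_smul c p.2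
    rw [integral_congr_ae (g := fun x => c * (p.1 x * T φ x)),
      integral_congr_ae (f := fun x => (c • p).2 x * φ x) (g := fun x => c * (p.2 x * φ x)),
      integral_const_mul, integral_const_mul, hp φ hφ]
    · filter_upwards [h2] with x hx
      rw [Prod.smul_snd, hx, Pi.smul_apply, smul_eq_mul, mul_assoc]
    · filter_upwards [h1] with x hx
      rw [Prod.smul_fst, hx, Pi.smul_apply, smul_eq_mul, mul_assoc]

theorem eq_zero_of_integral_test {g : L2} (h : ∀ φ, IsTest φ → ∫ x, g x * φ x ∂μ = 0) : g = 0 := by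
  have hloc : LocallyIntegrableOn (g : ℝ → ℂ) (Set.Ioi 0) volume := by
    apply locallyIntegrableOn_of_locallyIntegrable_restrict
    exact (Lp.memLp g).locallyIntegrable (by norm_num)
  have key := isOpen_Ioi.ae_eq_zero_of_integral_contDiff_smul_eq_zero hloc (by
    intro ψ h1 h2 h3
    have ht : IsTest (fun x => (ψ x : ℂ)) :=
      ⟨Complex.ofRealCLM.contDiff.comp h1, h2.comp_left (g := ((↑) : ℝ → ℂ)) (by simp),
        (closure_mono fun x hx => by simpa using hx).trans h3⟩
    have h4 := h _ ht
    rw [setIntegral_eq_integral_of_forall_compl_eq_zero] at h4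
    · rw [← h4]
      congr 1
      ext x
      simp [mul_comm]
    · intro x hx
      have : ψ x = 0 := image_eq_zero_of_notMem_tsupport fun hx' => hx (h3 hx')
      simp [this])
  apply Lp.ext
  have h0 : ((0 : L2) : ℝ → ℂ) =ᵐ[μ] 0 := Lp.coeFn_zero ..
  filter_upwards [(ae_restrict_iff' measurableSet_Ioi).2 key, h0] with x h1 h2
  rw [h1, h2]; rfl

/-- A weak graph is the graph of an operator. -/
theorem weakGraph_functional (T : (ℝ → ℂ) → ℝ → ℂ) (hT : ∀ φ, IsTest φ → IsTest (T φ)) :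
    ∀ p ∈ weakGraph T hT, p.1 = 0 → p.2 = 0 := by
  intro p hp h0
  apply eq_zero_of_integral_test
  intro φ hφ
  rw [← hp φ hφ, h0]
  have h1 : ((0 : L2) : ℝ → ℂ) =ᵐ[μ] 0 := Lp.coeFn_zero ..
  exact integral_eq_zero_of_ae (by filter_upwards [h1] with x hx; rw [hx]; simp)

theorem isClosed_weakGraph (T : (ℝ → ℂ) → ℝ → ℂ) (hT : ∀ φ, IsTest φ → IsTest (T φ)) :
    IsClosed (weakGraph T hT : Set (L2 × L2)) := by
  have hc : ∀ φ, IsTest φ → Continuous fun f : L2 => ∫ x, f x * φ x ∂μ := by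
    intro φ hφ
    have hst : MemLp (fun x => star (φ x)) 2 μ := hφ.memLp.star
    have : (fun f : L2 => ∫ x, f x * φ x ∂μ) = fun f : L2 => inner ℂ (hst.toLp _) f := by
      ext f
      rw [L2.inner_def]
      apply integral_congr_ae
      filter_upwards [hst.coeFn_toLp] with x hx
      rw [hx]
      simp
    rw [this]
    fun_prop
  have : (weakGraph T hT : Set (L2 × L2)) = ⋂ φ, ⋂ _ : IsTest φ,
      {p | ∫ x, p.1 x * T φ x ∂μ = ∫ x, p.2 x * φ x ∂μ} := by
    ext p
    simp [weakGraph]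
  rw [this]
  exact isClosed_iInter fun φ => isClosed_iInter fun hφ =>
    isClosed_eq ((hc _ (hT φ hφ)).comp continuous_fst) ((hc _ hφ).comp continuous_snd)

/-! ### The operators `L_α^min`, `L_α^max` and `H_m` -/

/-- The differential expression `L_α = -∂ₓ² + (-1/4 + α) / x²`; it is its own formal transpose. -/
def schrodinger (α : ℂ) (φ : ℝ → ℂ) (x : ℝ) : ℂ :=
  -(deriv (deriv φ) x) + (-1 / 4 + α) / (x : ℂ) ^ 2 * φ x

theorem IsTest.schrodinger (α : ℂ) (φ : ℝ → ℂ) (hφ : IsTest φ) : IsTest (schrodinger α φ) := by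
  have h1 := hφ.deriv.deriv.smul (-1)
  have h2 : IsTest (fun x : ℝ => (-1 / 4 + α) / (x : ℂ) ^ 2 * φ x) := by
    apply hφ.mul_left
    intro x hx
    have hx' : (x : ℂ) ^ 2 ≠ 0 := by exact_mod_cast (pow_pos hx 2).ne'
    have hp : ContDiffAt ℝ ∞ (fun y : ℝ => (y : ℂ) ^ 2) x :=
      (Complex.ofRealCLM.contDiff.pow 2).contDiffAt
    simp only [div_eq_mul_inv]
    exact contDiffAt_const.mul (hp.inv hx')
  convert h1.add h2 using 1
  ext x
  simp [HalfLine.schrodinger]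

/-- The maximal operator `L_α^max`, with domain all `f ∈ L²` such that `L_α f ∈ L²`. -/
def schrodingerMax (α : ℂ) : L2 →ₗ.[ℂ] L2 :=
  (weakGraph (schrodinger α) (IsTest.schrodinger α)).toLinearPMap

/-- The graph of `L_α` on `C_c^∞(]0,∞[)`. -/
def coreGraph (α : ℂ) : Submodule ℂ (L2 × L2) where
  carrier := {p | ∃ φ, IsTest φ ∧ p.1 =ᵐ[μ] φ ∧ p.2 =ᵐ[μ] schrodinger α φ}
  zero_mem' := by
    have h0 : ((0 : L2) : ℝ → ℂ) =ᵐ[μ] 0 := Lp.coeFn_zero ..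
    refine ⟨0, IsTest.zero, h0, h0.trans (ae_of_all _ fun x => ?_)⟩
    have : deriv (0 : ℝ → ℂ) = 0 := by ext; simp
    simp [schrodinger, this]
  add_mem' := by
    rintro p q ⟨φ, hφ, h1, h2⟩ ⟨ψ, hψ, h3, h4⟩
    refine ⟨φ + ψ, hφ.add hψ, (Lp.coeFn_add p.1 q.1).trans (h1.add h3),
      (Lp.coeFn_add p.2 q.2).trans ((h2.add h4).trans (ae_of_all _ fun x => ?_))⟩
    have hd : deriv (φ + ψ) = deriv φ + deriv ψ := by
      ext y
      exact deriv_add (hφ.contDiff.differentiable (by simp) y)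
        (hψ.contDiff.differentiable (by simp) y)
    have hd2 : deriv (deriv φ + deriv ψ) x = deriv (deriv φ) x + deriv (deriv ψ) x :=
      deriv_add (hφ.deriv.contDiff.differentiable (by simp) x)
        (hψ.deriv.contDiff.differentiable (by simp) x)
    simp only [schrodinger, hd, hd2, Pi.add_apply]
    ring
  smul_mem' := by
    rintro c p ⟨φ, hφ, h1, h2⟩
    refine ⟨c • φ, hφ.smul c, (Lp.coeFn_smul c p.1).trans (h1.const_smul c),
      (Lp.coeFn_smul c p.2).trans ((h2.const_smul c).trans (ae_of_all _ fun x => ?_))⟩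
    have hd : deriv (c • φ) = c • deriv φ := by
      ext y
      exact deriv_const_smul c (hφ.contDiff.differentiable (by simp) y)
    have hd2 : deriv (c • deriv φ) x = c • deriv (deriv φ) x :=
      deriv_const_smul c (hφ.deriv.contDiff.differentiable (by simp) x)
    simp only [schrodinger, hd, hd2, Pi.smul_apply, smul_eq_mul]
    ring

/-- The minimal operator `L_α^min`: the closure of `L_α` on `C_c^∞(]0,∞[)`. -/
def schrodingerMin (α : ℂ) : L2 →ₗ.[ℂ] L2 :=
  (coreGraph α).topologicalClosure.toLinearPMap

theorem schrodingerMax_graph (α : ℂ) :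
    (schrodingerMax α).graph = weakGraph (schrodinger α) (IsTest.schrodinger α) :=
  Submodule.toLinearPMap_graph_eq _ (weakGraph_functional _ _)

theorem integral_mul_deriv_test {φ ψ : ℝ → ℂ} (hφ : IsTest φ) (hψ : IsTest ψ) :
    ∫ x, φ x * deriv ψ x ∂μ = -∫ x, deriv φ x * ψ x ∂μ := by
  have hfull : ∀ {u v : ℝ → ℂ}, IsTest u → ∫ x, u x * v x ∂μ = ∫ x, u x * v x := by
    intro u v hu
    apply setIntegral_eq_integral_of_forall_compl_eq_zero
    intro x hx
    rw [image_eq_zero_of_notMem_tsupport fun hx' => hx (hu.supp hx'), zero_mul]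
  have hint : ∀ {u v : ℝ → ℂ}, IsTest u → IsTest v → Integrable (u * v) := by
    intro u v hu hv
    exact (hu.contDiff.continuous.mul hv.contDiff.continuous).integrable_of_hasCompactSupport
      hu.compact.mul_right
  rw [hfull hφ, hfull hφ.deriv]
  exact integral_mul_deriv_eq_deriv_mul_of_integrable
    (fun x _ => (hφ.contDiff.differentiable (by simp) x).hasDerivAt)
    (fun x _ => (hψ.contDiff.differentiable (by simp) x).hasDerivAt)
    (hint hφ hψ.deriv) (hint hφ.deriv hψ) (hint hφ hψ)

theorem coreGraph_le (α : ℂ) :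
    coreGraph α ≤ weakGraph (schrodinger α) (IsTest.schrodinger α) := by
  rintro p ⟨φ, hφ, h1, h2⟩ ψ hψ
  rw [integral_congr_ae (g := fun x => φ x * schrodinger α ψ x) (by
      filter_upwards [h1] with x hx; rw [hx]),
    integral_congr_ae (f := fun x => p.2 x * ψ x) (g := fun x => schrodinger α φ x * ψ x) (by
      filter_upwards [h2] with x hx; rw [hx])]
  have hi : ∀ {u v : ℝ → ℂ}, IsTest u → IsTest v → Integrable (fun x => u x * v x) μ :=
    fun hu hv => hu.memLp.integrable_mul hv.memLp
  have hw : IsTest (fun x : ℝ => (-1 / 4 + α) / (x : ℂ) ^ 2 * φ x) := by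
    have := (IsTest.schrodinger α φ hφ).add hφ.deriv.deriv
    convert this using 1
    ext x
    simp [schrodinger]
  have e1 : (fun x : ℝ => φ x * schrodinger α ψ x) = fun x : ℝ =>
      (-1 / 4 + α) / (x : ℂ) ^ 2 * φ x * ψ x - φ x * deriv (deriv ψ) x := by
    ext x; simp only [schrodinger]; ring
  have e2 : (fun x : ℝ => schrodinger α φ x * ψ x) = fun x : ℝ =>
      (-1 / 4 + α) / (x : ℂ) ^ 2 * φ x * ψ x - deriv (deriv φ) x * ψ x := by
    ext x; simp only [schrodinger]; ring
  rw [e1, e2, integral_sub (hi hw hψ) (hi hφ hψ.deriv.deriv),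
    integral_sub (hi hw hψ) (hi hφ.deriv.deriv hψ), integral_mul_deriv_test hφ hψ.deriv,
    integral_mul_deriv_test hφ.deriv hψ, neg_neg]

theorem schrodingerMin_graph (α : ℂ) :
    (schrodingerMin α).graph = (coreGraph α).topologicalClosure :=
  Submodule.toLinearPMap_graph_eq _ fun p hp => weakGraph_functional _ _ p <|
    Submodule.topologicalClosure_minimal _ (coreGraph_le α) (isClosed_weakGraph _ _) hp

/-- A smooth compactly supported cutoff that is equal to `1` around `0`. -/
structure IsCutoff (ξ : ℝ → ℝ) : Prop where
  contDiff : ContDiff ℝ ∞ ξ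
  compact : HasCompactSupport ξ
  eq_one : ∀ᶠ x in 𝓝 0, ξ x = 1

/-- The subspace `Dom L_{m²}^min + ℂ x^{1/2+m} ξ` of `L²[0,∞[`. -/
def domH (m : ℂ) (ξ : ℝ → ℝ) : Submodule ℂ L2 where
  carrier := {f | ∃ f₀ ∈ (schrodingerMin (m ^ 2)).domain, ∃ c : ℂ,
    f =ᵐ[μ] fun x => f₀ x + c * ((x : ℂ) ^ (1 / 2 + m) * ξ x)}
  zero_mem' := ⟨0, Submodule.zero_mem _, 0, ae_of_all _ fun x => by simp⟩
  add_mem' := by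
    rintro f g ⟨f₀, hf, c, h1⟩ ⟨g₀, hg, d, h2⟩
    refine ⟨f₀ + g₀, Submodule.add_mem _ hf hg, c + d, ?_⟩
    filter_upwards [h1, h2, Lp.coeFn_add f g, Lp.coeFn_add f₀ g₀] with x h1 h2 h3 h4
    rw [h3, h4, Pi.add_apply, Pi.add_apply, h1, h2]
    ring
  smul_mem' := by
    rintro a f ⟨f₀, hf, c, h1⟩
    refine ⟨a • f₀, Submodule.smul_mem _ a hf, a * c, ?_⟩
    filter_upwards [h1, Lp.coeFn_smul a f, Lp.coeFn_smul a f₀] with x h1 h3 h4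
    rw [h3, h4, Pi.smul_apply, Pi.smul_apply, h1, smul_eq_mul, smul_eq_mul]
    ring

/-- The homogeneous Schrödinger operator `H_m`: the restriction of `L_{m²}^max` to
`Dom L_{m²}^min + ℂ x^{1/2+m} ξ`. -/
def H (m : ℂ) (ξ : ℝ → ℝ) : L2 →ₗ.[ℂ] L2 :=
  (schrodingerMax (m ^ 2)).domRestrict (domH m ξ)

/-! ### The operator `X²` -/

/-- The graph of the operator of multiplication by the function `w` on its maximal domain. -/
def mulGraph (w : ℝ → ℂ) : Submodule ℂ (L2 × L2) where
  carrier := {p | p.2 =ᵐ[μ] fun x => w x * p.1 x}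
  zero_mem' := by
    have h0 : ((0 : L2) : ℝ → ℂ) =ᵐ[μ] 0 := Lp.coeFn_zero ..
    change ((0 : L2) : ℝ → ℂ) =ᵐ[μ] fun x => w x * (0 : L2) x
    filter_upwards [h0] with x hx
    rw [hx]
    simp
  add_mem' := by
    intro p q hp hq
    change (↑(p.2 + q.2) : ℝ → ℂ) =ᵐ[μ] fun x => w x * (p.1 + q.1 : L2) x
    filter_upwards [hp, hq, Lp.coeFn_add p.1 q.1, Lp.coeFn_add p.2 q.2] with x h1 h2 h3 h4
    rw [h3, h4, Pi.add_apply, Pi.add_apply, h1, h2]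
    ring
  smul_mem' := by
    intro a p hp
    change (↑(a • p.2) : ℝ → ℂ) =ᵐ[μ] fun x => w x * (a • p.1 : L2) x
    filter_upwards [hp, Lp.coeFn_smul a p.1, Lp.coeFn_smul a p.2] with x h1 h3 h4
    rw [h3, h4, Pi.smul_apply, Pi.smul_apply, h1, smul_eq_mul, smul_eq_mul]
    ring

theorem mulGraph_functional (w : ℝ → ℂ) : ∀ p ∈ mulGraph w, p.1 = 0 → p.2 = 0 := by
  intro p hp h0
  have h1 : p.2 =ᵐ[μ] fun x => w x * p.1 x := hp
  have h2 : ((0 : L2) : ℝ → ℂ) =ᵐ[μ] 0 := Lp.coeFn_zero ..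
  rw [h0] at h1
  apply Lp.ext
  filter_upwards [h1, h2] with x h3 h4
  rw [h3, h4]
  simp

/-- The operator `X²` of multiplication by `x²`, with domain all `f ∈ L²` such that `x² f ∈ L²`. -/
def Xsq : L2 →ₗ.[ℂ] L2 := (mulGraph fun x => (x : ℂ) ^ 2).toLinearPMap

theorem Xsq_graph : Xsq.graph = mulGraph fun x => (x : ℂ) ^ 2 :=
  Submodule.toLinearPMap_graph_eq _ (mulGraph_functional _)

/-! ### Dilations and their generator -/

/-- The formal transpose of `(1/2i)(x∂ₓ + ∂ₓx)`, namely `-(1/2i)(x∂ₓ + ∂ₓx)`. -/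
def dilationTranspose (φ : ℝ → ℂ) (x : ℝ) : ℂ :=
  -(1 / (2 * Complex.I) * (x * deriv φ x + deriv (fun y : ℝ => (y : ℂ) * φ y) x))

theorem IsTest.dilationTranspose (φ : ℝ → ℂ) (hφ : IsTest φ) : IsTest (dilationTranspose φ) := by
  have hx : ∀ x : ℝ, 0 < x → ContDiffAt ℝ ∞ (fun y : ℝ => (y : ℂ)) x :=
    fun x _ => Complex.ofRealCLM.contDiff.contDiffAt
  have h1 := ((hφ.deriv.mul_left hx).add (hφ.mul_left hx).deriv).smul (-(1 / (2 * Complex.I)))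
  convert h1 using 1
  ext x
  simp [HalfLine.dilationTranspose]

/-- The operator `A = (1/2i)(x∂ₓ + ∂ₓx)` on `L²[0,∞[`, with derivatives in the sense of
distributions and with domain all `f ∈ L²` such that `A f ∈ L²`. -/
def A : L2 →ₗ.[ℂ] L2 :=
  (weakGraph dilationTranspose IsTest.dilationTranspose).toLinearPMap

theorem A_graph : A.graph = weakGraph dilationTranspose IsTest.dilationTranspose :=
  Submodule.toLinearPMap_graph_eq _ (weakGraph_functional _ _)

theorem memLp_dilation (τ : ℝ) (f : L2) :
    MemLp (fun x : ℝ => ((Real.exp (τ / 2) : ℝ) : ℂ) * f (Real.exp τ * x)) 2 μ := by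
  have hmap : Measure.map (fun x => Real.exp τ * x) μ = ENNReal.ofReal |(Real.exp τ)⁻¹| • μ := by
    have hpre : Set.Ioi (0 : ℝ) = (fun x => Real.exp τ * x) ⁻¹' Set.Ioi 0 := by
      ext x; simp [Real.exp_pos]
    have h1 : μ = volume.restrict ((fun x => Real.exp τ * x) ⁻¹' Set.Ioi 0) := by rw [← hpre]
    conv_lhs => rw [h1]
    rw [← Measure.restrict_map (by fun_prop) measurableSet_Ioi,
      Real.map_volume_mul_left (Real.exp_pos τ).ne', Measure.restrict_smul]
  have h2 : MemLp f 2 (Measure.map (fun x => Real.exp τ * x) μ) := by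
    rw [hmap]
    exact (Lp.memLp f).smul_measure ENNReal.ofReal_ne_top
  exact (h2.comp_of_map (by fun_prop)).const_mul _

/-- The dilation `(U_τ f)(x) = e^{τ/2} f(e^τ x)` on `L²[0,∞[`. -/
def U (τ : ℝ) (f : L2) : L2 := (memLp_dilation τ f).toLp _

/-! ### The Hankel transformation -/

/-- The Bessel function `J_m(z) = ∑ⱼ (-1)^j / (j! Γ(m+j+1)) (z/2)^{2j+m}` for `z > 0`. -/
def besselJ (m : ℂ) (z : ℝ) : ℂ :=
  ∑' j : ℕ, (-1) ^ j / (j.factorial * Complex.Gamma (m + j + 1)) * ((z : ℂ) / 2) ^ (2 * j + m)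

/-- The kernel `J_m(kx) √(kx)`. -/
def hankelKernel (m : ℂ) (k x : ℝ) : ℂ := besselJ m (k * x) * (Real.sqrt (k * x) : ℂ)

/-- The truncated integral `∫₀ᴿ J_m(kx) √(kx) f(x) dx`. -/
def hankelTrunc (m : ℂ) (f : ℝ → ℂ) (R k : ℝ) : ℂ := ∫ x in Set.Ioc 0 R, hankelKernel m k x * f x

/-- `F` is the operator `(F f)(k) = ∫₀^∞ J_m(kx) √(kx) f(x) dx` on `L²[0,∞[`: for each `f ∈ L²` the
truncated integrals `∫₀ᴿ` are absolutely convergent and tend to `F f` in `L²` as `R → ∞` (as usual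
for integral transformations on `L²`, the integral over `]0,∞[` need not converge absolutely). -/
structure IsHankelTransform (m : ℂ) (F : L2 → L2) : Prop where
  integrable : ∀ (f : L2) (R k : ℝ), 0 < R → 0 < k →
    IntegrableOn (fun x => hankelKernel m k x * f x) (Set.Ioc 0 R)
  memLp : ∀ (f : L2) (R : ℝ), 0 < R → MemLp (hankelTrunc m f R) 2 μ
  tendsto : ∀ f : L2, Tendsto (fun R => eLpNorm (fun k => hankelTrunc m f R k - F f k) 2 μ) atTop (𝓝 0)

/-! ### Products of bounded and unbounded operators -/

/-- The product `B F` of an unbounded operator `B` with a bounded one `F`, with its natural domain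
`{f | F f ∈ Dom B}`. -/
def compRight (B : L2 →ₗ.[ℂ] L2) (F : L2 →L[ℂ] L2) : L2 →ₗ.[ℂ] L2 where
  domain := B.domain.comap (F : L2 →ₗ[ℂ] L2)
  toFun := B.toFun.comp ((F : L2 →ₗ[ℂ] L2).restrict fun _ hx => hx)

/-- The product `F B` of a bounded operator `F` with an unbounded one `B`, with domain `Dom B`. -/
def compLeft (F : L2 →L[ℂ] L2) (B : L2 →ₗ.[ℂ] L2) : L2 →ₗ.[ℂ] L2 :=
  (F : L2 →ₗ[ℂ] L2).compPMap B

end HalfLine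

end

noncomputable section

/-!
The dilated Gaussians `e u = gauss m u = U (u / 2) (gauss m 0)`, `u : ℝ`, span a dense subspace of
`L²[0,∞[`, and
`⟪e u, e v⟫ = 2 ^ (Re m) Γ(Re m + 1) e^{(m+1)(v-u)/2} (1 + e^{v-u})^{-(Re m+1)}`,
which by the Mellin transform of `(1 + x)^{-a}` is a constant times
`∫ e^{-i(v-u)s} |Γ((Re m + 1)/2 + i(s + Im m/2))|² ds`.
Replacing every `e u` by `e (-u)` amounts to replacing `Im m` by `-Im m` in this weight. The two
weights are comparable, so `e u ↦ e (-u)` extends to a bounded involution of `L²[0,∞[`. It has the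
kernel `J_m(kx) √(kx)`, since integrating the Bessel series against a Gaussian term by term gives a
Gaussian.

The involution intertwines `U τ` with `U (-τ)`, hence the generator `A` with `-A`. Now `x² e u` is
a combination of `e u` and `A (e u)`, and `L_{m²} (e u)` is a combination of `e u` and `x² e u`; so
on Gaussians the involution exchanges `L_{m²}` with multiplication by `x²`. This carries over to
the operators because the Gaussians span a core of `X²` and each of them differs from a multiple of
`x^{1/2+m} ξ` by an element of the domain of `L_{m²}^min`.
-/

namespace HalfLine

/-! ### The Gamma function on vertical lines -/

theorem sq_norm_add_mul_I (x y : ℝ) : ‖(x + y * Complex.I : ℂ)‖ ^ 2 = x ^ 2 + y ^ 2 := by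
  rw [Complex.norm_add_mul_I, Real.sq_sqrt (by positivity)]

theorem norm_add_mul_I_le {x : ℝ} (hx : 0 < x) (s t : ℝ) :
    ‖(x + s * Complex.I : ℂ)‖ ≤ ‖(x + t * Complex.I : ℂ)‖ *
      Real.exp (|s - t| * (2 * |t| + |s - t|) / (x + |t|) ^ 2) := by
  set X := |s - t| * (2 * |t| + |s - t|) / (x + |t|) ^ 2 with hX
  have : 0 ≤ X := by positivity
  refine le_of_sq_le_sq ?_ (by positivity)
  rw [mul_pow, sq_norm_add_mul_I, sq_norm_add_mul_I, ← Real.exp_nat_mul]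
  have hexp : 1 + 2 * X ≤ Real.exp ((2 : ℕ) * X) := by
    simpa [add_comm] using Real.add_one_le_exp ((2 : ℕ) * X)
  have hdiff : s ^ 2 - t ^ 2 ≤ X * (x + |t|) ^ 2 := by
    rw [hX, div_mul_cancel₀ _ (by positivity)]
    have hst : (s - t) * t ≤ |s - t| * |t| := (le_abs_self _).trans_eq (abs_mul _ _)
    nlinarith [sq_abs (s - t)]
  have hsq : (x + |t|) ^ 2 ≤ 2 * (x ^ 2 + t ^ 2) := by
    nlinarith [sq_nonneg (x - |t|), sq_abs t]
  calc x ^ 2 + s ^ 2 ≤ x ^ 2 + t ^ 2 + X * (x + |t|) ^ 2 := by linarith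
    _ ≤ x ^ 2 + t ^ 2 + X * (2 * (x ^ 2 + t ^ 2)) := by gcongr
    _ = (x ^ 2 + t ^ 2) * (1 + 2 * X) := by ring
    _ ≤ (x ^ 2 + t ^ 2) * Real.exp ((2 : ℕ) * X) := by gcongr

theorem sum_range_one_div_add_sq_le {y : ℝ} (hy : 0 < y) (n : ℕ) :
    ∑ j ∈ Finset.range (n + 1), 1 / (y + j) ^ 2 ≤ 1 / y ^ 2 + 1 / y := by
  suffices h : ∑ j ∈ Finset.range (n + 1), 1 / (y + j) ^ 2 ≤ 1 / y ^ 2 + 1 / y - 1 / (y + n) by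
    have : (0 : ℝ) ≤ 1 / (y + n) := by positivity
    linarith
  induction n with
  | zero => simp
  | succ n ih =>
    have htelescope : 1 / (y + (n + 1 : ℕ)) ^ 2 ≤ 1 / (y + n) - 1 / (y + (n + 1 : ℕ)) := by
      push_cast
      rw [div_sub_div _ _ (by positivity) (by positivity), div_le_div_iff₀ (by positivity)
        (by positivity)]
      nlinarith
    rw [Finset.sum_range_succ]
    linarith

theorem sum_range_two_mul_add_div_sq_le {b t δ : ℝ} (hb : 0 < b) (ht : 0 ≤ t) (hδ : 0 ≤ δ)
    (n : ℕ) : ∑ j ∈ Finset.range (n + 1), (2 * t + δ) / (b + j + t) ^ 2 ≤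
      (2 + δ / b) * (1 / b + 1) := by
  have hy : 0 < b + t := by positivity
  have hδb : δ ≤ δ / b * (b + t) := by
    rw [div_mul_eq_mul_div, le_div_iff₀ hb]
    gcongr
    linarith
  calc ∑ j ∈ Finset.range (n + 1), (2 * t + δ) / (b + j + t) ^ 2
      = (2 * t + δ) * ∑ j ∈ Finset.range (n + 1), 1 / (b + t + j) ^ 2 := by
        rw [Finset.mul_sum]
        exact Finset.sum_congr rfl fun j _ => by ring
    _ ≤ (2 * t + δ) * (1 / (b + t) ^ 2 + 1 / (b + t)) := by
        gcongr
        exact sum_range_one_div_add_sq_le hy n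
    _ ≤ ((2 + δ / b) * (b + t)) * (1 / (b + t) ^ 2 + 1 / (b + t)) := by
        gcongr
        linarith
    _ = (2 + δ / b) * (1 / (b + t) + 1) := by field_simp
    _ ≤ (2 + δ / b) * (1 / b + 1) := by
        gcongr
        linarith

theorem prod_range_norm_add_mul_I_le {b : ℝ} (hb : 0 < b) (s t : ℝ) (n : ℕ) :
    ∏ j ∈ Finset.range (n + 1), ‖(b + s * Complex.I + j : ℂ)‖ ≤
      Real.exp (|s - t| * ((2 + |s - t| / b) * (1 / b + 1))) *
        ∏ j ∈ Finset.range (n + 1), ‖(b + t * Complex.I + j : ℂ)‖ := by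
  have hcast : ∀ (r : ℝ) (j : ℕ), (b + r * Complex.I + j : ℂ) =
      (b + j : ℝ) + r * Complex.I := fun r j => by push_cast; ring
  simp only [hcast]
  calc ∏ j ∈ Finset.range (n + 1), ‖((b + j : ℝ) + s * Complex.I : ℂ)‖
      ≤ ∏ j ∈ Finset.range (n + 1), ‖((b + j : ℝ) + t * Complex.I : ℂ)‖ *
          Real.exp (|s - t| * (2 * |t| + |s - t|) / (b + j + |t|) ^ 2) :=
        Finset.prod_le_prod (fun _ _ => norm_nonneg _) fun j _ =>
          norm_add_mul_I_le (by positivity) s t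
    _ = Real.exp (|s - t| * ∑ j ∈ Finset.range (n + 1),
          (2 * |t| + |s - t|) / (b + j + |t|) ^ 2) *
          ∏ j ∈ Finset.range (n + 1), ‖((b + j : ℝ) + t * Complex.I : ℂ)‖ := by
        rw [Finset.prod_mul_distrib, ← Real.exp_sum, mul_comm, Finset.mul_sum]
        simp only [mul_div_assoc]
    _ ≤ _ := by
        gcongr
        exact sum_range_two_mul_add_div_sq_le hb (abs_nonneg t) (abs_nonneg _) n

theorem norm_Gamma_add_mul_I_le {b : ℝ} (hb : 0 < b) (s t : ℝ) :
    ‖Complex.Gamma (b + t * Complex.I)‖ ≤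
      Real.exp (|s - t| * ((2 + |s - t| / b) * (1 / b + 1))) *
        ‖Complex.Gamma (b + s * Complex.I)‖ := by
  refine le_of_tendsto_of_tendsto (Complex.GammaSeq_tendsto_Gamma _).norm
    ((Complex.GammaSeq_tendsto_Gamma _).norm.const_mul _) ?_
  filter_upwards [eventually_gt_atTop 0] with n hn
  have hpow : ∀ r : ℝ, ‖(n : ℂ) ^ (b + r * Complex.I : ℂ)‖ = (n : ℝ) ^ b := fun r => by
    simp [Complex.norm_natCast_cpow_of_pos hn]
  have hprod : ∀ r : ℝ, 0 < ∏ j ∈ Finset.range (n + 1), ‖(b + r * Complex.I + j : ℂ)‖ :=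
    fun r => Finset.prod_pos fun j _ => norm_pos_iff.2 fun h => by
      have hre : b + j = 0 := by simpa using congrArg Complex.re h
      exact absurd hre (by positivity)
  simp only [Complex.GammaSeq, norm_div, norm_mul, norm_prod, hpow]
  rw [← mul_div_assoc, div_le_div_iff₀ (hprod t) (hprod s)]
  calc _ ≤ (n : ℝ) ^ b * ‖(n.factorial : ℂ)‖ * _ :=
        mul_le_mul_of_nonneg_left (prod_range_norm_add_mul_I_le hb s t n) (by positivity)
    _ = _ := by ring

theorem norm_Gamma_le_Gamma_re {s : ℂ} (hs : 0 < s.re) :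
    ‖Complex.Gamma s‖ ≤ Real.Gamma s.re := by
  rw [Complex.Gamma_eq_integral hs, Real.Gamma_eq_integral hs, Complex.GammaIntegral]
  refine (norm_integral_le_integral_norm _).trans_eq ?_
  refine setIntegral_congr_fun measurableSet_Ioi fun x hx => ?_
  simp only [norm_mul]
  rw [Complex.norm_cpow_eq_rpow_re_of_pos hx, Complex.norm_real, Real.norm_eq_abs, Real.abs_exp,
    Complex.sub_re, Complex.one_re]

/-- The weight `|Γ(b + iy)|²`, whose Fourier transform is a power of the hyperbolic cosine; it
turns the Gram matrix of the dilated Gaussians into an integral of characters. -/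
def gammaWeight (b y : ℝ) : ℝ := ‖Complex.Gamma (b + y * Complex.I)‖ ^ 2

theorem gammaWeight_nonneg (b y : ℝ) : 0 ≤ gammaWeight b y := sq_nonneg _

theorem gammaWeight_neg (b y : ℝ) : gammaWeight b (-y) = gammaWeight b y := by
  have hconj : (b + (-y : ℝ) * Complex.I : ℂ) = (starRingEnd ℂ) (b + y * Complex.I) := by simp
  rw [gammaWeight, hconj, Complex.Gamma_conj, Complex.norm_conj, gammaWeight]

theorem continuous_gammaWeight {b : ℝ} (hb : 0 < b) : Continuous (gammaWeight b) := by
  refine (continuous_iff_continuousAt.2 fun y => ?_).norm.pow 2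
  refine ContinuousAt.comp (g := Complex.Gamma) ?_ (by fun_prop)
  refine (Complex.differentiableAt_Gamma _ fun n h => ?_).continuousAt
  have hre : b = -n := by simpa using congrArg Complex.re h
  linarith [n.cast_nonneg (α := ℝ)]

theorem gammaWeight_le {b : ℝ} (hb : 0 < b) (y : ℝ) :
    gammaWeight b y ≤ Real.Gamma (b + 1) ^ 2 / (b ^ 2 + y ^ 2) := by
  set z : ℂ := b + y * Complex.I with hz
  have hre : z.re = b := by simp [hz]
  have hz0 : z ≠ 0 := fun h => hb.ne' (by rw [← hre, h, Complex.zero_re])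
  have hsucc : ‖Complex.Gamma (z + 1)‖ ≤ Real.Gamma (b + 1) := by
    simpa [hre] using norm_Gamma_le_Gamma_re (s := z + 1) (by simp [hre]; linarith)
  rw [le_div_iff₀ (by positivity), ← sq_norm_add_mul_I, gammaWeight, ← mul_pow,
    ← norm_mul, ← hz, mul_comm, ← Complex.Gamma_add_one z hz0]
  gcongr

theorem integrable_gammaWeight {b : ℝ} (hb : 0 < b) : Integrable (gammaWeight b) := by
  have hscaled := (integrable_inv_one_add_sq.comp_div hb.ne').const_mul
    (Real.Gamma (b + 1) ^ 2 / b ^ 2)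
  refine hscaled.mono' (continuous_gammaWeight hb).aestronglyMeasurable (ae_of_all _ fun y => ?_)
  rw [Real.norm_of_nonneg (gammaWeight_nonneg b y)]
  refine (gammaWeight_le hb y).trans_eq ?_
  field_simp

/-! ### The Mellin transform of `(1 + x)^{-a}` -/

theorem image_div_one_sub_Ioo : (fun y : ℝ => y / (1 - y)) '' Set.Ioo 0 1 = Set.Ioi 0 := by
  ext x
  constructor
  · rintro ⟨y, ⟨hy0, hy1⟩, rfl⟩
    exact div_pos hy0 (sub_pos.2 hy1)
  · intro (hx : 0 < x)
    refine ⟨x / (1 + x), ⟨by positivity, (div_lt_one (by positivity)).2 (by linarith)⟩, ?_⟩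
    field_simp
    ring

theorem injOn_div_one_sub_Ioo : Set.InjOn (fun y : ℝ => y / (1 - y)) (Set.Ioo 0 1) := by
  intro x hx y hy h
  rw [div_eq_div_iff (sub_pos.2 hx.2).ne' (sub_pos.2 hy.2).ne'] at h
  linarith

theorem hasDerivAt_div_one_sub {y : ℝ} (hy : y ≠ 1) :
    HasDerivAt (fun y : ℝ => y / (1 - y)) (1 / (1 - y) ^ 2) y := by
  have h := (hasDerivAt_id y).div ((hasDerivAt_id y).const_sub 1) (sub_ne_zero.2 hy.symm)
  exact h.congr_deriv (by simp)

theorem cpow_div_one_sub_mul_one_add_cpow (a z : ℂ) {y : ℝ} (hy : y ∈ Set.Ioo (0 : ℝ) 1) :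
    |1 / (1 - y) ^ 2| • (((y / (1 - y) : ℝ) : ℂ) ^ (z - 1) •
      (1 + (y / (1 - y) : ℝ) : ℂ) ^ (-a)) =
      (y : ℂ) ^ (z - 1) * (1 - (y : ℂ)) ^ (a - z - 1) := by
  have hpos : 0 < 1 - y := sub_pos.2 hy.2
  have hne : ((1 - y : ℝ) : ℂ) ≠ 0 := Complex.ofReal_ne_zero.2 hpos.ne'
  have harg : ((1 - y : ℝ) : ℂ).arg ≠ Real.pi := by
    rw [Complex.arg_ofReal_of_nonneg hpos.le]
    exact Real.pi_pos.ne
  have hsum : (1 + (y / (1 - y) : ℝ) : ℂ) = ((1 - y : ℝ) : ℂ)⁻¹ := by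
    norm_cast
    field_simp
    ring
  have hquot : ((y / (1 - y) : ℝ) : ℂ) ^ (z - 1) =
      (y : ℂ) ^ (z - 1) * ((1 - y : ℝ) : ℂ) ^ (-(z - 1)) := by
    rw [div_eq_mul_inv, Complex.ofReal_mul, Complex.mul_cpow_ofReal_nonneg hy.1.le
      (inv_nonneg.2 hpos.le), Complex.ofReal_inv, Complex.inv_cpow _ _ harg, Complex.cpow_neg]
  have hjac : ((|1 / (1 - y) ^ 2| : ℝ) : ℂ) = ((1 - y : ℝ) : ℂ) ^ (-2 : ℂ) := by
    rw [abs_of_pos (by positivity), Complex.cpow_neg, one_div, Complex.ofReal_inv]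
    norm_cast
  rw [Complex.real_smul, smul_eq_mul, hsum, Complex.inv_cpow _ _ harg, ← Complex.cpow_neg, neg_neg,
    hquot, hjac, show (1 - (y : ℂ)) = ((1 - y : ℝ) : ℂ) by push_cast; rfl,
    show a - z - 1 = -2 + -(z - 1) + a by ring, Complex.cpow_add _ _ hne, Complex.cpow_add _ _ hne]
  ring

theorem hasMellin_one_add_cpow_neg {a z : ℂ} (hz : 0 < z.re) (hza : z.re < a.re) :
    HasMellin (fun x : ℝ => (1 + x : ℂ) ^ (-a)) z
      (Complex.Gamma z * Complex.Gamma (a - z) / Complex.Gamma a) := by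
  have hre : 0 < (a - z).re := by simpa using hza
  have hderiv : ∀ y ∈ Set.Ioo (0 : ℝ) 1,
      HasDerivWithinAt (fun y : ℝ => y / (1 - y)) (1 / (1 - y) ^ 2) (Set.Ioo 0 1) y :=
    fun y hy => (hasDerivAt_div_one_sub hy.2.ne).hasDerivWithinAt
  have hcongr : Set.EqOn (fun y : ℝ => |1 / (1 - y) ^ 2| • (((y / (1 - y) : ℝ) : ℂ) ^ (z - 1) •
      (1 + (y / (1 - y) : ℝ) : ℂ) ^ (-a)))
      (fun y : ℝ => (y : ℂ) ^ (z - 1) * (1 - (y : ℂ)) ^ (a - z - 1)) (Set.Ioo 0 1) :=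
    fun y hy => cpow_div_one_sub_mul_one_add_cpow a z hy
  constructor
  · rw [MellinConvergent, ← image_div_one_sub_Ioo,
      integrableOn_image_iff_integrableOn_abs_deriv_smul measurableSet_Ioo hderiv
        injOn_div_one_sub_Ioo, integrableOn_congr_fun hcongr measurableSet_Ioo,
      ← intervalIntegrable_iff_integrableOn_Ioo_of_le zero_le_one]
    exact Complex.betaIntegral_convergent hz hre
  · rw [mellin, ← image_div_one_sub_Ioo, integral_image_eq_integral_abs_deriv_smul
      measurableSet_Ioo hderiv injOn_div_one_sub_Ioo,
      setIntegral_congr_fun measurableSet_Ioo hcongr,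
      ← integral_Ioc_eq_integral_Ioo, ← intervalIntegral.integral_of_le zero_le_one]
    simpa [Complex.betaIntegral] using Complex.betaIntegral_eq_Gamma_mul_div z (a - z) hz hre

theorem hasMellin_one_add_rpow_neg_half {a : ℝ} (ha : 0 < a) (y : ℝ) :
    HasMellin (fun x : ℝ => (1 + x : ℂ) ^ (-a : ℂ)) ((a / 2 : ℝ) + y * Complex.I)
      ((Complex.Gamma a)⁻¹ * gammaWeight (a / 2) y) := by
  set z : ℂ := (a / 2 : ℝ) + y * Complex.I with hz
  have hre : z.re = a / 2 := by simp [hz]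
  have hconj : (a : ℂ) - z = (starRingEnd ℂ) z := by
    simp only [hz, map_add, map_mul, Complex.conj_ofReal, Complex.conj_I]
    push_cast
    ring
  convert hasMellin_one_add_cpow_neg (a := a) (z := z) (by rw [hre]; linarith)
    (by rw [hre, Complex.ofReal_re]; linarith) using 1
  rw [hconj, Complex.Gamma_conj, Complex.mul_conj, Complex.normSq_eq_norm_sq, gammaWeight, ← hz]
  ring

theorem exp_mul_one_add_exp_cpow_neg {a : ℝ} (ha : 0 < a) (d : ℝ) :
    Complex.exp (a * d / 2) * (1 + Real.exp d : ℂ) ^ (-a : ℂ) =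
      (2 * Real.pi * Complex.Gamma a)⁻¹ *
        ∫ y : ℝ, Complex.exp (-(d * y * Complex.I)) * gammaWeight (a / 2) y := by
  have hmellin := hasMellin_one_add_rpow_neg_half ha
  have hvert : Complex.VerticalIntegrable
      (mellin fun x : ℝ => (1 + x : ℂ) ^ (-a : ℂ)) (a / 2) := by
    simp only [Complex.VerticalIntegrable, fun y => (hmellin y).2]
    exact (integrable_gammaWeight (half_pos ha)).ofReal.const_mul _
  have hcont : ContinuousAt (fun x : ℝ => (1 + x : ℂ) ^ (-a : ℂ)) (Real.exp d) := by
    refine ContinuousAt.cpow (by fun_prop) continuousAt_const (Or.inl ?_)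
    exact_mod_cast (by positivity : 0 < 1 + Real.exp d)
  have hinv := mellinInv_mellin_eq (a / 2) _ (Real.exp_pos d) (by simpa using (hmellin 0).1)
    hvert hcont
  have hexp : ∀ y : ℝ, ((Real.exp d : ℝ) : ℂ) ^ (-((a / 2 : ℝ) + y * Complex.I : ℂ)) =
      Complex.exp (-(a * d / 2)) * Complex.exp (-(d * y * Complex.I)) := fun y => by
    rw [Complex.cpow_def_of_ne_zero (by exact_mod_cast (Real.exp_pos d).ne'),
      ← Complex.ofReal_log (Real.exp_pos d).le, Real.log_exp, ← Complex.exp_add]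
    congr 1
    push_cast
    ring
  simp only [mellinInv, fun y => (hmellin y).2, hexp, smul_eq_mul, mul_mul_mul_comm] at hinv
  rw [integral_const_mul, Complex.real_smul] at hinv
  set J := ∫ y : ℝ, Complex.exp (-(d * y * Complex.I)) * gammaWeight (a / 2) y
  rw [← hinv, Complex.exp_neg]
  push_cast
  field_simp [Complex.exp_ne_zero]

/-! ### Dilated Gaussians -/

section Moments

variable {α : Type*} [MeasurableSpace α] {ν : Measure α} {v : α → ℂ} {g : α → ℝ} {a b : ℝ}

theorem integrable_mul_comp_of_mem_Icc (hv : Integrable v ν) (hg : AEStronglyMeasurable g ν)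
    (hgab : ∀ᵐ x ∂ν, g x ∈ Set.Icc a b) {c : ℝ → ℝ} (hc : Continuous c) :
    Integrable (fun x => v x * (c (g x) : ℂ)) ν := by
  obtain ⟨C, hC⟩ := isCompact_Icc.exists_bound_of_continuousOn (hc.continuousOn (s := Set.Icc a b))
  refine hv.mul_bdd (c := C)
    ((Complex.continuous_ofReal.comp hc).comp_aestronglyMeasurable hg) (hgab.mono fun x hx => ?_)
  rw [Complex.norm_real]
  exact hC _ hx

theorem integral_mul_polynomial_eq_zero (hv : Integrable v ν) (hg : AEStronglyMeasurable g ν)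
    (hgab : ∀ᵐ x ∂ν, g x ∈ Set.Icc a b) (h : ∀ n : ℕ, ∫ x, v x * (g x ^ n : ℝ) ∂ν = 0)
    (p : Polynomial ℝ) : ∫ x, v x * (p.eval (g x) : ℝ) ∂ν = 0 := by
  induction p using Polynomial.induction_on' with
  | add p q hp hq =>
    simp only [Polynomial.eval_add, Complex.ofReal_add, mul_add]
    rw [integral_add (integrable_mul_comp_of_mem_Icc hv hg hgab p.continuous)
      (integrable_mul_comp_of_mem_Icc hv hg hgab q.continuous), hp, hq, add_zero]
  | monomial n r =>
    simp only [Polynomial.eval_monomial, Complex.ofReal_mul, mul_left_comm _ (r : ℂ)]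
    rw [integral_const_mul, h n, mul_zero]

theorem integral_mul_comp_eq_zero_of_moments (hv : Integrable v ν)
    (hg : AEStronglyMeasurable g ν) (hgab : ∀ᵐ x ∂ν, g x ∈ Set.Icc a b)
    (h : ∀ n : ℕ, ∫ x, v x * (g x ^ n : ℝ) ∂ν = 0) {c : ℝ → ℝ} (hc : Continuous c) :
    ∫ x, v x * (c (g x) : ℂ) ∂ν = 0 := by
  refine norm_le_zero_iff.1 (le_of_forall_pos_le_add fun ε hε => ?_)
  set I := ∫ x, ‖v x‖ ∂ν
  have : 0 ≤ I := integral_nonneg fun _ => norm_nonneg _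
  obtain ⟨p, hp⟩ :=
    exists_polynomial_near_of_continuousOn a b c hc.continuousOn (ε / (I + 1)) (by positivity)
  have hint := (integrable_mul_comp_of_mem_Icc hv hg hgab hc).sub
    (integrable_mul_comp_of_mem_Icc hv hg hgab p.continuous)
  calc ‖∫ x, v x * (c (g x) : ℂ) ∂ν‖
      = ‖∫ x, (v x * (c (g x) : ℂ) - v x * (p.eval (g x) : ℝ)) ∂ν‖ := by
        rw [integral_sub (integrable_mul_comp_of_mem_Icc hv hg hgab hc)
          (integrable_mul_comp_of_mem_Icc hv hg hgab p.continuous),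
          integral_mul_polynomial_eq_zero hv hg hgab h, sub_zero]
    _ ≤ ∫ x, ‖v x * (c (g x) : ℂ) - v x * (p.eval (g x) : ℝ)‖ ∂ν :=
        norm_integral_le_integral_norm _
    _ ≤ ∫ x, ε / (I + 1) * ‖v x‖ ∂ν := by
        refine integral_mono_ae hint.norm (hv.norm.const_mul _) (hgab.mono fun x hx => ?_)
        beta_reduce
        rw [← mul_sub, norm_mul, ← Complex.ofReal_sub, Complex.norm_real, Real.norm_eq_abs,
          abs_sub_comm, mul_comm]
        gcongr
        exact (hp _ hx).le
    _ = ε / (I + 1) * I := integral_const_mul _ _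
    _ ≤ 0 + ε := by
        rw [div_mul_eq_mul_div, div_le_iff₀ (by positivity)]
        nlinarith

end Moments

theorem continuous_comp_sqrt_neg_log {φ : ℝ → ℝ} (hφ : Continuous φ) (hcomp : HasCompactSupport φ)
    (h0 : φ 0 = 0) : Continuous fun y : ℝ => φ (Real.sqrt (-Real.log y)) := by
  refine continuous_iff_continuousAt.2 fun y => ?_
  rcases eq_or_ne y 0 with rfl | hy
  · have hlim : Tendsto (fun y => Real.sqrt (-Real.log y)) (𝓝[≠] 0) atTop :=
      Real.tendsto_sqrt_atTop.comp (tendsto_neg_atBot_atTop.comp Real.tendsto_log_nhdsNE_zero)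
    rw [continuousAt_iff_punctured_nhds]
    simpa [h0, Function.comp_def] using
      (hcomp.is_zero_at_infty.mono_left atTop_le_cocompact).comp hlim
  · exact hφ.continuousAt.comp
      (Real.continuous_sqrt.continuousAt.comp (Real.continuousAt_log hy).neg)

/- The powers of `exp (-x²)` are the moments of `v` in the variable `y = exp (-x²) ∈ [0, 1]`, in
which they determine `v` by the Weierstrass approximation theorem. -/
theorem ae_eq_zero_of_integral_exp_neg_sq {v : ℝ → ℂ} (hv : Integrable v μ)
    (h : ∀ n : ℕ, ∫ x, v x * (Real.exp (-x ^ 2) ^ n : ℝ) ∂μ = 0) : v =ᵐ[μ] 0 := by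
  have hloc : LocallyIntegrableOn v (Set.Ioi 0) volume :=
    locallyIntegrableOn_of_locallyIntegrable_restrict hv.locallyIntegrable
  refine (ae_restrict_iff' measurableSet_Ioi).2
    (isOpen_Ioi.ae_eq_zero_of_integral_contDiff_smul_eq_zero hloc fun φ hφ hcomp hsupp => ?_)
  have hzero : ∀ x ∉ Set.Ioi (0 : ℝ), φ x = 0 := fun x hx =>
    image_eq_zero_of_notMem_tsupport fun hx' => hx (hsupp hx')
  have hmem : ∀ x : ℝ, Real.exp (-x ^ 2) ∈ Set.Icc (0 : ℝ) 1 := fun x =>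
    ⟨(Real.exp_pos _).le, Real.exp_le_one_iff.2 (neg_nonpos.2 (sq_nonneg x))⟩
  rw [← setIntegral_eq_integral_of_forall_compl_eq_zero fun x hx => by rw [hzero x hx, zero_smul],
    ← integral_mul_comp_eq_zero_of_moments hv (Continuous.aestronglyMeasurable (by fun_prop))
      (ae_of_all _ hmem) h (continuous_comp_sqrt_neg_log hφ.continuous hcomp (hzero 0 (by simp)))]
  refine setIntegral_congr_fun measurableSet_Ioi fun x hx => ?_
  have hx : 0 < x := hx
  simp only [Real.log_exp, neg_neg, Real.sqrt_sq hx.le, Complex.real_smul, mul_comm]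

/-- The function `x^b q(x)`. The Gaussians, the cutoff functions `x^{1/2+m} ξ` and their images
under `schrodinger` are all of this form. -/
def powMul (b : ℂ) (q : ℝ → ℝ) (x : ℝ) : ℂ := (x : ℂ) ^ b * (q x : ℂ)

/-- The Gaussian `exp (-e^u x²/2)`. -/
def gaussReal (u x : ℝ) : ℝ := Real.exp (-(Real.exp u * x ^ 2 / 2))

/-- The function `e^{(m+1)u/2} x^{m+1/2} exp (-e^u x²/2)`. The prefactor makes these functions the
dilations of the Gaussian `x^{m+1/2} exp (-x²/2)`. -/
def gauss (m : ℂ) (u x : ℝ) : ℂ :=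
  Complex.exp ((m + 1) * u / 2) * powMul (m + 1 / 2) (gaussReal u) x

theorem continuousOn_ofReal_cpow (b : ℂ) : ContinuousOn (fun x : ℝ => (x : ℂ) ^ b) (Set.Ioi 0) :=
  fun _ hx => ((continuousAt_cpow_const (Complex.ofReal_mem_slitPlane.2 hx)).comp
    Complex.continuous_ofReal.continuousAt).continuousWithinAt

theorem contDiff_gaussReal (u : ℝ) : ContDiff ℝ ∞ (gaussReal u) := by
  unfold gaussReal
  fun_prop

theorem gaussReal_pos (u x : ℝ) : 0 < gaussReal u x := Real.exp_pos _

theorem gaussReal_mul_gaussReal (u v x : ℝ) : gaussReal u x * gaussReal v x =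
    Real.exp (-((Real.exp u + Real.exp v) / 2) * x ^ 2) := by
  rw [gaussReal, gaussReal, ← Real.exp_add]
  congr 1
  ring

theorem gaussReal_mul_exp_neg_sq_pow (u x : ℝ) (n : ℕ) :
    gaussReal u x * Real.exp (-x ^ 2) ^ n = gaussReal (Real.log (Real.exp u + 2 * n)) x := by
  rw [gaussReal, gaussReal, Real.exp_log (by positivity), ← Real.exp_nat_mul, ← Real.exp_add]
  congr 1
  ring

theorem norm_gauss (m : ℂ) (u : ℝ) {x : ℝ} (hx : 0 < x) :
    ‖gauss m u x‖ = Real.exp ((m.re + 1) * u / 2) * (x ^ (m.re + 1 / 2) * gaussReal u x) := by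
  rw [gauss, powMul, norm_mul, norm_mul, Complex.norm_exp, Complex.norm_cpow_eq_rpow_re_of_pos hx,
    Complex.norm_of_nonneg (gaussReal_pos u x).le]
  congr 2 <;> simp

theorem gauss_ne_zero (m : ℂ) (u : ℝ) {x : ℝ} (hx : 0 < x) : gauss m u x ≠ 0 := by
  rw [← norm_pos_iff, norm_gauss m u hx]
  have := gaussReal_pos u x
  positivity

theorem continuousOn_gauss (m : ℂ) (u : ℝ) : ContinuousOn (gauss m u) (Set.Ioi 0) :=
  continuousOn_const.mul ((continuousOn_ofReal_cpow _).mul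
    (Complex.continuous_ofReal.comp (contDiff_gaussReal u).continuous).continuousOn)

theorem aestronglyMeasurable_gauss (m : ℂ) (u : ℝ) : AEStronglyMeasurable (gauss m u) μ :=
  (continuousOn_gauss m u).aestronglyMeasurable measurableSet_Ioi

theorem gauss_mul_exp_neg_sq_pow (m : ℂ) (u x : ℝ) (n : ℕ) :
    gauss m u x * (Real.exp (-x ^ 2) ^ n : ℝ) =
      Complex.exp ((m + 1) * (u - Real.log (Real.exp u + 2 * n)) / 2) *
        gauss m (Real.log (Real.exp u + 2 * n)) x := by
  simp only [gauss, powMul, ← gaussReal_mul_exp_neg_sq_pow, ← mul_assoc, ← Complex.exp_add]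
  push_cast
  ring_nf

theorem ae_eq_zero_of_integral_gauss {f : ℝ → ℂ} (m : ℂ) (u₀ : ℝ)
    (hf : Integrable (fun x => f x * gauss m u₀ x) μ)
    (h : ∀ u, u₀ ≤ u → ∫ x, f x * gauss m u x ∂μ = 0) : f =ᵐ[μ] 0 := by
  have hle : ∀ n : ℕ, u₀ ≤ Real.log (Real.exp u₀ + 2 * n) := fun n =>
    (Real.le_log_iff_exp_le (by positivity)).2 (le_add_of_nonneg_right (by positivity))
  have hzero := ae_eq_zero_of_integral_exp_neg_sq hf fun n => by
    simp only [mul_assoc, gauss_mul_exp_neg_sq_pow, mul_left_comm (f _)]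
    rw [integral_const_mul, h _ (hle n), mul_zero]
  filter_upwards [hzero, ae_restrict_mem measurableSet_Ioi] with x hx hx0
  exact (mul_eq_zero.1 hx).resolve_right (gauss_ne_zero m u₀ hx0)

theorem memLp_pow_mul_gauss {m : ℂ} (hm : -1 < m.re) (u : ℝ) (p : ℕ) :
    MemLp (fun x : ℝ => (x : ℂ) ^ p * gauss m u x) 2 μ := by
  have hmeas : AEStronglyMeasurable (fun x : ℝ => (x : ℂ) ^ p * gauss m u x) μ :=
    (Continuous.aestronglyMeasurable (by fun_prop)).mul (aestronglyMeasurable_gauss m u)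
  rw [memLp_two_iff_integrable_sq_norm hmeas]
  have hs : -1 < 2 * m.re + 1 + 2 * p := by
    have : (0 : ℝ) ≤ p := p.cast_nonneg
    linarith
  refine ((integrableOn_rpow_mul_exp_neg_mul_sq (Real.exp_pos u) hs).const_mul
    (Real.exp ((m.re + 1) * u / 2) ^ 2)).congr ?_
  filter_upwards [ae_restrict_mem measurableSet_Ioi] with x hx
  have hx : 0 < x := hx
  have hpow : x ^ (2 * m.re + 1 + 2 * p) = (x ^ p * x ^ (m.re + 1 / 2)) ^ 2 := by
    rw [← Real.rpow_natCast x p, ← Real.rpow_add hx, ← Real.rpow_natCast (x ^ _) 2,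
      ← Real.rpow_mul hx.le]
    congr 1
    push_cast
    ring
  have hexp : Real.exp (-Real.exp u * x ^ 2) = gaussReal u x ^ 2 := by
    rw [sq (gaussReal u x), gaussReal_mul_gaussReal, add_self_div_two]
  rw [norm_mul, norm_gauss m u hx, norm_pow, Complex.norm_of_nonneg hx.le, hpow, hexp]
  ring

theorem memLp_gauss {m : ℂ} (hm : -1 < m.re) (u : ℝ) : MemLp (gauss m u) 2 μ := by
  simpa using memLp_pow_mul_gauss hm u 0

/-- `gauss m u` as an element of `L²[0,∞[`. -/
def gaussVec {m : ℂ} (hm : -1 < m.re) (u : ℝ) : L2 := (memLp_gauss hm u).toLp _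

theorem coeFn_gaussVec {m : ℂ} (hm : -1 < m.re) (u : ℝ) : gaussVec hm u =ᵐ[μ] gauss m u :=
  MemLp.coeFn_toLp _

/-! ### The Gram matrix of the Gaussians -/

theorem conj_gauss_mul_gauss (m : ℂ) (u v : ℝ) {x : ℝ} (hx : 0 < x) :
    gauss m v x * (starRingEnd ℂ) (gauss m u x) =
      Complex.exp ((m + 1) * (v - u) / 2) * (Real.exp ((m.re + 1) * u) *
        (x ^ (2 * m.re + 1) * Real.exp (-((Real.exp u + Real.exp v) / 2) * x ^ 2)) : ℝ) := by
  have hpow : (x : ℂ) ^ (m + 1 / 2) * (starRingEnd ℂ) ((x : ℂ) ^ (m + 1 / 2)) =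
      ((x ^ (2 * m.re + 1) : ℝ) : ℂ) := by
    rw [Complex.mul_conj, Complex.normSq_eq_norm_sq, Complex.norm_cpow_eq_rpow_re_of_pos hx,
      ← Real.rpow_natCast (x ^ _) 2, ← Real.rpow_mul hx.le]
    congr 2
    simp
    ring
  have hexp : Complex.exp ((m + 1) * v / 2) * (starRingEnd ℂ) (Complex.exp ((m + 1) * u / 2)) =
      Complex.exp ((m + 1) * (v - u) / 2) * (Real.exp ((m.re + 1) * u) : ℝ) := by
    have hconj : (starRingEnd ℂ) m = 2 * m.re - m := by
      rw [eq_sub_iff_add_eq', Complex.add_conj]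
      push_cast
      ring
    rw [← Complex.exp_conj, Complex.ofReal_exp, ← Complex.exp_add, ← Complex.exp_add]
    congr 1
    simp only [map_div₀, map_mul, map_add, map_one, Complex.conj_ofReal, map_ofNat, hconj]
    push_cast
    ring
  rw [Complex.ofReal_mul, Complex.ofReal_mul, ← mul_assoc, ← hexp, ← hpow,
    ← gaussReal_mul_gaussReal]
  simp only [gauss, powMul, map_mul, Complex.conj_ofReal]
  push_cast
  ring

theorem integral_rpow_mul_exp_neg_add_exp_mul_sq {a : ℝ} (ha : 0 < a) (u v : ℝ) :
    ∫ x, x ^ (2 * a - 1) * Real.exp (-((Real.exp u + Real.exp v) / 2) * x ^ 2) ∂μ =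
      2 ^ (a - 1) * Real.Gamma a * Real.exp (-(a * u)) * (1 + Real.exp (v - u)) ^ (-a) := by
  have hsum : (Real.exp u + Real.exp v) / 2 = Real.exp u * (1 + Real.exp (v - u)) * 2⁻¹ := by
    rw [mul_add, ← Real.exp_add]
    ring_nf
  have h := integral_rpow_mul_exp_neg_mul_rpow (p := 2) (q := 2 * a - 1)
    (b := (Real.exp u + Real.exp v) / 2) (by norm_num) (by linarith) (by positivity)
  simp only [Real.rpow_two] at h
  rw [h, show (2 * a - 1 + 1) / 2 = a by ring, show -(2 * a - 1 + 1) / 2 = -a by ring, hsum,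
    Real.mul_rpow (by positivity) (by positivity), Real.mul_rpow (by positivity) (by positivity),
    Real.inv_rpow (by norm_num), Real.rpow_neg (by norm_num : (0 : ℝ) ≤ 2), inv_inv,
    Real.rpow_sub (by norm_num), Real.rpow_one, ← Real.exp_mul]
  ring_nf

theorem inner_gaussVec {m : ℂ} (hm : -1 < m.re) (u v : ℝ) :
    inner ℂ (gaussVec hm u) (gaussVec hm v) = (2 ^ m.re * Real.Gamma (m.re + 1) : ℝ) *
      (Complex.exp ((m + 1) * (v - u) / 2) *
        ((1 + Real.exp (v - u)) ^ (-(m.re + 1)) : ℝ)) := by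
  have hpt : ∀ᵐ x ∂μ, inner ℂ (gaussVec hm u x) (gaussVec hm v x) =
      Complex.exp ((m + 1) * (v - u) / 2) * (Real.exp ((m.re + 1) * u) * (x ^ (2 * (m.re + 1) - 1) *
        Real.exp (-((Real.exp u + Real.exp v) / 2) * x ^ 2)) : ℝ) := by
    filter_upwards [coeFn_gaussVec hm u, coeFn_gaussVec hm v, ae_restrict_mem measurableSet_Ioi]
      with x hu hv hx
    rw [hu, hv, RCLike.inner_apply, conj_gauss_mul_gauss m u v hx]
    ring_nf
  have hcancel : Real.exp ((m.re + 1) * u) * Real.exp (-((m.re + 1) * u)) = 1 := by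
    rw [← Real.exp_add, add_neg_cancel, Real.exp_zero]
  rw [L2.inner_def, integral_congr_ae hpt, integral_const_mul, integral_complex_ofReal,
    integral_const_mul, integral_rpow_mul_exp_neg_add_exp_mul_sq (by linarith),
    add_sub_cancel_right]
  rw [show ∀ a b c d e : ℝ, a * (b * c * d * e) = a * d * (b * c * e) by intros; ring, hcancel]
  push_cast
  ring

theorem exp_mul_one_add_exp_rpow_eq_integral_shift {a : ℝ} (ha : 0 < a) (y d : ℝ) :
    Complex.exp ((a + y * Complex.I) * d / 2) * ((1 + Real.exp d) ^ (-a) : ℝ) =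
      (2 * Real.pi * Real.Gamma a : ℝ)⁻¹ *
        ∫ s : ℝ, Complex.exp (-(d * s * Complex.I)) * gammaWeight (a / 2) (s + y / 2) := by
  have hshift : ∫ s : ℝ, Complex.exp (-(d * s * Complex.I)) * gammaWeight (a / 2) (s + y / 2) =
      Complex.exp (y * Complex.I * d / 2) *
        ∫ s : ℝ, Complex.exp (-(d * s * Complex.I)) * gammaWeight (a / 2) s := by
    rw [← integral_sub_right_eq_self _ (y / 2), ← integral_const_mul]
    refine integral_congr_ae (ae_of_all _ fun s => ?_)
    beta_reduce
    rw [sub_add_cancel, ← mul_assoc, ← Complex.exp_add]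
    congr 2
    push_cast
    ring
  rw [hshift, Complex.ofReal_cpow (by positivity), add_mul, add_div, Complex.exp_add]
  have hfourier := exp_mul_one_add_exp_cpow_neg ha d
  rw [Complex.Gamma_ofReal] at hfourier
  push_cast at hfourier ⊢
  rw [mul_right_comm, hfourier]
  ring

theorem inner_gaussVec_eq_integral {m : ℂ} (hm : -1 < m.re) (u v : ℝ) :
    inner ℂ (gaussVec hm u) (gaussVec hm v) =
      (2 ^ m.re / (2 * Real.pi) : ℝ) * ∫ s : ℝ, Complex.exp (-((v - u) * s * Complex.I)) *
        gammaWeight ((m.re + 1) / 2) (s + m.im / 2) := by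
  have ha : 0 < m.re + 1 := by linarith
  have hm1 : m + 1 = (m.re + 1 : ℝ) + m.im * Complex.I := by
    conv_lhs => rw [← Complex.re_add_im m]
    push_cast
    ring
  have hΓ := (Real.Gamma_pos_of_pos ha).ne'
  rw [inner_gaussVec, hm1, ← Complex.ofReal_sub, exp_mul_one_add_exp_rpow_eq_integral_shift ha,
    ← mul_assoc, ← Complex.ofReal_mul]
  congr 2
  field_simp

theorem inner_gaussVec_neg_eq_integral {m : ℂ} (hm : -1 < m.re) (u v : ℝ) :
    inner ℂ (gaussVec hm (-u)) (gaussVec hm (-v)) =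
      (2 ^ m.re / (2 * Real.pi) : ℝ) * ∫ s : ℝ, Complex.exp (-((v - u) * s * Complex.I)) *
        gammaWeight ((m.re + 1) / 2) (s - m.im / 2) := by
  rw [inner_gaussVec_eq_integral, ← integral_neg_eq_self]
  congr 2
  ext s
  rw [← gammaWeight_neg]
  push_cast
  ring_nf

/-! ### Vectors whose Gram matrix is a Fourier transform -/

/-- The trigonometric sum `∑ v, c v e^{-ivs}`, which represents `∑ v, c v • e v` in the spectral
representation of the group of translations `e v ↦ e (v + τ)`. -/
def trigSum (c : ℝ →₀ ℂ) (s : ℝ) : ℂ := ∑ v ∈ c.support, c v * Complex.exp (-(v * s * Complex.I))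

theorem norm_exp_neg_mul_I (d s : ℝ) : ‖Complex.exp (-(d * s * Complex.I))‖ = 1 := by
  simp [Complex.norm_exp]

theorem continuous_trigSum (c : ℝ →₀ ℂ) : Continuous (trigSum c) := by
  unfold trigSum
  fun_prop

theorem norm_trigSum_le (c : ℝ →₀ ℂ) (s : ℝ) : ‖trigSum c s‖ ≤ ∑ v ∈ c.support, ‖c v‖ :=
  (norm_sum_le _ _).trans_eq (by simp only [norm_mul, norm_exp_neg_mul_I, mul_one])

theorem ofReal_norm_sq_trigSum (c : ℝ →₀ ℂ) (s : ℝ) :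
    ((‖trigSum c s‖ ^ 2 : ℝ) : ℂ) = ∑ u ∈ c.support, ∑ v ∈ c.support,
      (starRingEnd ℂ) (c u) * (c v * Complex.exp (-((v - u) * s * Complex.I))) := by
  rw [← Complex.normSq_eq_norm_sq, Complex.normSq_eq_conj_mul_self, trigSum, map_sum,
    Finset.sum_mul_sum]
  refine Finset.sum_congr rfl fun u _ => Finset.sum_congr rfl fun v _ => ?_
  have hexp : Complex.exp (-((v - u) * s * Complex.I)) =
      (starRingEnd ℂ) (Complex.exp (-(u * s * Complex.I))) *
        Complex.exp (-(v * s * Complex.I)) := by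
    rw [← Complex.exp_conj, ← Complex.exp_add]
    simp only [map_neg, map_mul, Complex.conj_ofReal, Complex.conj_I]
    ring_nf
  rw [hexp, map_mul]
  ring

theorem integrable_norm_sq_trigSum_mul {w : ℝ → ℝ} (hw : Integrable w) (c : ℝ →₀ ℂ) :
    Integrable fun s => ‖trigSum c s‖ ^ 2 * w s := by
  refine hw.bdd_mul (c := (∑ v ∈ c.support, ‖c v‖) ^ 2)
    ((continuous_trigSum c).norm.pow 2).aestronglyMeasurable (ae_of_all _ fun s => ?_)
  rw [Real.norm_of_nonneg (by positivity)]
  gcongr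
  exact norm_trigSum_le c s

section Gram

variable {E F : Type*} [NormedAddCommGroup E] [InnerProductSpace ℂ E]
  [NormedAddCommGroup F] [InnerProductSpace ℂ F] {e : ℝ → E} {f : ℝ → F} {κ : ℝ} {w w' : ℝ → ℝ}

theorem norm_sq_linearCombination (hw : Integrable w)
    (h : ∀ u v, inner ℂ (e u) (e v) =
      (κ : ℂ) * ∫ s : ℝ, Complex.exp (-((v - u) * s * Complex.I)) * w s) (c : ℝ →₀ ℂ) :
    ‖Finsupp.linearCombination ℂ e c‖ ^ 2 = κ * ∫ s : ℝ, ‖trigSum c s‖ ^ 2 * w s := by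
  have hint : ∀ u v : ℝ, Integrable fun s : ℝ =>
      (starRingEnd ℂ) (c u) * (c v * (Complex.exp (-((v - u) * s * Complex.I)) * w s)) := by
    intro u v
    refine ((hw.ofReal.bdd_mul (c := 1) (Continuous.aestronglyMeasurable (by fun_prop))
      (ae_of_all _ fun s => ?_)).const_mul _).const_mul _
    rw [← Complex.ofReal_sub, norm_exp_neg_mul_I]
  have hself : ((‖Finsupp.linearCombination ℂ e c‖ ^ 2 : ℝ) : ℂ) =
      inner ℂ (Finsupp.linearCombination ℂ e c) (Finsupp.linearCombination ℂ e c) := by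
    rw [inner_self_eq_norm_sq_to_K]
    norm_cast
  rw [← Complex.ofReal_inj, hself, Finsupp.linearCombination_apply, Finsupp.sum, sum_inner]
  simp only [inner_sum, inner_smul_left, inner_smul_right, h]
  rw [Complex.ofReal_mul, ← integral_complex_ofReal]
  simp only [Complex.ofReal_mul _ (w _), ofReal_norm_sq_trigSum, Finset.sum_mul, mul_assoc]
  rw [integral_finsetSum _ fun u _ => integrable_finsetSum _ fun v _ => by
    simpa only [mul_assoc] using hint u v, Finset.mul_sum]
  refine Finset.sum_congr rfl fun u _ => ?_
  rw [integral_finsetSum _ fun v _ => by simpa only [mul_assoc] using hint u v, Finset.mul_sum]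
  refine Finset.sum_congr rfl fun v _ => ?_
  simp only [integral_const_mul]
  ring

theorem norm_linearCombination_le_of_gram_le (hκ : 0 ≤ κ) (hw : Integrable w)
    (hw' : Integrable w')
    (he : ∀ u v, inner ℂ (e u) (e v) =
      (κ : ℂ) * ∫ s : ℝ, Complex.exp (-((v - u) * s * Complex.I)) * w s)
    (hf : ∀ u v, inner ℂ (f u) (f v) =
      (κ : ℂ) * ∫ s : ℝ, Complex.exp (-((v - u) * s * Complex.I)) * w' s)
    {C : ℝ} (hC : 0 ≤ C) (hle : ∀ s, w' s ≤ C ^ 2 * w s) (c : ℝ →₀ ℂ) :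
    ‖Finsupp.linearCombination ℂ f c‖ ≤ C * ‖Finsupp.linearCombination ℂ e c‖ := by
  refine le_of_sq_le_sq ?_ (by positivity)
  rw [mul_pow, norm_sq_linearCombination hw he, norm_sq_linearCombination hw' hf, mul_left_comm,
    ← integral_const_mul (C ^ 2)]
  refine mul_le_mul_of_nonneg_left (integral_mono (integrable_norm_sq_trigSum_mul hw' c)
    ((integrable_norm_sq_trigSum_mul hw c).const_mul _) fun s => ?_) hκ
  calc ‖trigSum c s‖ ^ 2 * w' s ≤ ‖trigSum c s‖ ^ 2 * (C ^ 2 * w s) := by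
        gcongr
        exact hle s
    _ = C ^ 2 * (‖trigSum c s‖ ^ 2 * w s) := by ring

end Gram

theorem exists_gammaWeight_sub_le {b : ℝ} (hb : 0 < b) (δ : ℝ) :
    ∃ C : ℝ, 0 ≤ C ∧ ∀ s, gammaWeight b (s - δ) ≤ C ^ 2 * gammaWeight b (s + δ) := by
  refine ⟨_, (Real.exp_pos (|2 * δ| * ((2 + |2 * δ| / b) * (1 / b + 1)))).le, fun s => ?_⟩
  have h := norm_Gamma_add_mul_I_le hb (s + δ) (s - δ)
  rw [show s + δ - (s - δ) = 2 * δ by ring] at h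
  rw [gammaWeight, gammaWeight, ← mul_pow]
  exact_mod_cast pow_le_pow_left₀ (norm_nonneg _) h 2

theorem exists_norm_linearCombination_gaussVec_neg_le {m : ℂ} (hm : -1 < m.re) :
    ∃ C : ℝ, ∀ c : ℝ →₀ ℂ, ‖Finsupp.linearCombination ℂ (fun u => gaussVec hm (-u)) c‖ ≤
      C * ‖Finsupp.linearCombination ℂ (gaussVec hm) c‖ := by
  have hb : 0 < (m.re + 1) / 2 := by linarith
  obtain ⟨C, hC0, hC⟩ := exists_gammaWeight_sub_le hb (m.im / 2)
  have hw := integrable_gammaWeight hb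
  exact ⟨C, norm_linearCombination_le_of_gram_le (by positivity) (hw.comp_add_right (m.im / 2))
    (hw.comp_sub_right (m.im / 2)) (inner_gaussVec_eq_integral hm)
    (inner_gaussVec_neg_eq_integral hm) hC0 hC⟩

/-! ### Density -/

theorem topologicalClosure_span_eq_top {m : ℂ} {e : ℝ → L2} {w : ℝ → ℂ}
    (he : ∀ u, e u =ᵐ[μ] fun x => w x * gauss m u x) (hw : ∀ x, 0 < x → w x ≠ 0) :
    (Submodule.span ℂ (Set.range e)).topologicalClosure = ⊤ := by
  rw [Submodule.topologicalClosure_eq_top_iff, Submodule.eq_bot_iff]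
  intro f hf
  rw [Submodule.mem_orthogonal] at hf
  have hcongr : ∀ u, ∀ᵐ x ∂μ, (starRingEnd ℂ) (f x) * w x * gauss m u x =
      inner ℂ (f x) (e u x) := by
    intro u
    filter_upwards [he u] with x hx
    rw [hx, RCLike.inner_apply]
    ring
  have hfw := ae_eq_zero_of_integral_gauss (f := fun x => (starRingEnd ℂ) (f x) * w x) m 0
    ((L2.integrable_inner f (e 0)).congr ((hcongr 0).mono fun x hx => hx.symm)) (by
      intro u _
      rw [integral_congr_ae (hcongr u), ← L2.inner_def, ← inner_conj_symm,
        hf _ (Submodule.subset_span ⟨u, rfl⟩), map_zero])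
  apply Lp.ext
  filter_upwards [hfw, Lp.coeFn_zero ℂ 2 μ, ae_restrict_mem measurableSet_Ioi] with x hfwx hzero hx
  rw [hzero]
  simpa using (mul_eq_zero.1 hfwx).resolve_right (hw x hx)

theorem dense_span_gaussVec {m : ℂ} (hm : -1 < m.re) :
    Dense (Submodule.span ℂ (Set.range (gaussVec hm)) : Set L2) := by
  rw [Submodule.dense_iff_topologicalClosure_eq_top]
  exact topologicalClosure_span_eq_top (m := m) (w := fun _ => 1)
    (fun u => by simpa using coeFn_gaussVec hm u) (by simp)

theorem ext_gaussVec {m : ℂ} (hm : -1 < m.re) {E : Type*} [NormedAddCommGroup E] [NormedSpace ℂ E]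
    {S T : L2 →L[ℂ] E} (h : ∀ u, S (gaussVec hm u) = T (gaussVec hm u)) : S = T := by
  refine ContinuousLinearMap.ext_on (dense_span_gaussVec hm) ?_
  rintro _ ⟨u, rfl⟩
  exact h u

/-! ### The bilinear pairing -/

/-- The bilinear pairing `∫ f g` on `L²[0,∞[`. -/
def pair : L2 →L[ℂ] L2 →L[ℂ] ℂ := (ContinuousLinearMap.mul ℂ ℂ).lpPairing μ 2 2

theorem pair_apply (f g : L2) : pair f g = ∫ x, f x * g x ∂μ := by
  simp [pair, ContinuousLinearMap.lpPairing_eq_integral]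

theorem pair_comm (f g : L2) : pair f g = pair g f := by
  simp only [pair_apply, mul_comm]

theorem pair_toLp (f : L2) {φ : ℝ → ℂ} (hφ : MemLp φ 2 μ) :
    pair f (hφ.toLp φ) = ∫ x, f x * φ x ∂μ := by
  rw [pair_apply]
  exact integral_congr_ae (by filter_upwards [hφ.coeFn_toLp] with x hx; rw [hx])

/-! ### Dilations -/

theorem quasiMeasurePreserving_mul_exp (τ : ℝ) :
    Measure.QuasiMeasurePreserving (fun x : ℝ => Real.exp τ * x) μ μ := by
  refine Measure.QuasiMeasurePreserving.restrict ⟨by fun_prop, ?_⟩ fun x hx =>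
    mul_pos (Real.exp_pos τ) hx
  rw [Real.map_volume_mul_left (Real.exp_pos τ).ne']
  exact Measure.smul_absolutelyContinuous

theorem coeFn_U (τ : ℝ) (f : L2) :
    U τ f =ᵐ[μ] fun x => ((Real.exp (τ / 2) : ℝ) : ℂ) * f (Real.exp τ * x) :=
  MemLp.coeFn_toLp _

theorem integral_exp_mul_comp (τ : ℝ) (h : ℝ → ℂ) :
    ∫ x, (Real.exp τ : ℂ) * h (Real.exp τ * x) ∂μ = ∫ x, h x ∂μ := by
  rw [integral_const_mul, integral_comp_mul_left_Ioi h 0 (Real.exp_pos τ), mul_zero,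
    Complex.real_smul, ← mul_assoc, ← Complex.ofReal_mul, mul_inv_cancel₀ (Real.exp_pos τ).ne']
  simp

theorem ofReal_exp_half_mul_self (τ : ℝ) :
    ((Real.exp (τ / 2) : ℝ) : ℂ) * (Real.exp (τ / 2) : ℝ) = (Real.exp τ : ℝ) := by
  rw [← Complex.ofReal_mul, ← Real.exp_add]
  congr 2
  ring

theorem inner_U (τ : ℝ) (f g : L2) : inner ℂ (U τ f) (U τ g) = inner ℂ f g := by
  rw [L2.inner_def, L2.inner_def, ← integral_exp_mul_comp τ (fun x => inner ℂ (f x) (g x))]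
  refine integral_congr_ae ?_
  filter_upwards [coeFn_U τ f, coeFn_U τ g] with x hf hg
  simp only [hf, hg, RCLike.inner_apply, map_mul, Complex.conj_ofReal]
  rw [← ofReal_exp_half_mul_self τ]
  ring

theorem pair_U_U (τ : ℝ) (f g : L2) : pair (U τ f) (U τ g) = pair f g := by
  rw [pair_apply, pair_apply, ← integral_exp_mul_comp τ (fun x => f x * g x)]
  refine integral_congr_ae ?_
  filter_upwards [coeFn_U τ f, coeFn_U τ g] with x hf hg
  simp only [hf, hg]
  rw [← ofReal_exp_half_mul_self τ]
  ring

theorem U_map_add (τ : ℝ) (f g : L2) : U τ (f + g) = U τ f + U τ g := by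
  apply Lp.ext
  filter_upwards [coeFn_U τ f, coeFn_U τ g, coeFn_U τ (f + g), Lp.coeFn_add (U τ f) (U τ g),
    (quasiMeasurePreserving_mul_exp τ).ae (Lp.coeFn_add f g)] with x hUf hUg hU hUadd hadd
  rw [hU, hUadd, Pi.add_apply, hUf, hUg, hadd, Pi.add_apply]
  ring

theorem U_map_smul (τ : ℝ) (c : ℂ) (f : L2) : U τ (c • f) = c • U τ f := by
  apply Lp.ext
  filter_upwards [coeFn_U τ f, coeFn_U τ (c • f), Lp.coeFn_smul c (U τ f),
    (quasiMeasurePreserving_mul_exp τ).ae (Lp.coeFn_smul c f)] with x hUf hU hUsmul hsmul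
  rw [hU, hUsmul, Pi.smul_apply, hUf, hsmul, Pi.smul_apply, smul_eq_mul, smul_eq_mul]
  ring

theorem norm_U (τ : ℝ) (f : L2) : ‖U τ f‖ = ‖f‖ := by
  have h := inner_U τ f f
  rw [inner_self_eq_norm_sq_to_K, inner_self_eq_norm_sq_to_K] at h
  exact (sq_eq_sq₀ (norm_nonneg _) (norm_nonneg _)).1 (by exact_mod_cast h)

/-- The dilation `U τ` as a bounded operator. -/
def dilation (τ : ℝ) : L2 →L[ℂ] L2 :=
  LinearMap.mkContinuous
    { toFun := U τ, map_add' := U_map_add τ, map_smul' := U_map_smul τ } 1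
    fun f => by simp [norm_U]

@[simp] theorem dilation_apply (τ : ℝ) (f : L2) : dilation τ f = U τ f := rfl

theorem gauss_dilate (m : ℂ) (τ u : ℝ) {x : ℝ} (hx : 0 < x) :
    ((Real.exp (τ / 2) : ℝ) : ℂ) * gauss m u (Real.exp τ * x) = gauss m (u + 2 * τ) x := by
  have hpow : ((Real.exp τ * x : ℝ) : ℂ) ^ (m + 1 / 2) =
      Complex.exp (τ * (m + 1 / 2)) * (x : ℂ) ^ (m + 1 / 2) := by
    rw [Complex.ofReal_mul, Complex.mul_cpow_ofReal_nonneg (Real.exp_pos τ).le hx.le,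
      Complex.cpow_def_of_ne_zero (by exact_mod_cast (Real.exp_pos τ).ne'),
      ← Complex.ofReal_log (Real.exp_pos τ).le, Real.log_exp]
  have hreal : gaussReal u (Real.exp τ * x) = gaussReal (u + 2 * τ) x := by
    rw [gaussReal, gaussReal, Real.exp_add, two_mul, Real.exp_add]
    ring_nf
  have hexp : Complex.exp ((m + 1) * ((u + 2 * τ : ℝ) : ℂ) / 2) =
      ((Real.exp (τ / 2) : ℝ) : ℂ) * Complex.exp ((m + 1) * u / 2) *
        Complex.exp (τ * (m + 1 / 2)) := by
    rw [Complex.ofReal_exp, ← Complex.exp_add, ← Complex.exp_add]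
    congr 1
    push_cast
    ring
  rw [gauss, gauss, powMul, powMul, hpow, hreal, hexp]
  ring

theorem U_gaussVec {m : ℂ} (hm : -1 < m.re) (τ u : ℝ) :
    U τ (gaussVec hm u) = gaussVec hm (u + 2 * τ) := by
  apply Lp.ext
  filter_upwards [coeFn_U τ (gaussVec hm u), coeFn_gaussVec hm (u + 2 * τ),
    (quasiMeasurePreserving_mul_exp τ).ae (coeFn_gaussVec hm u),
    ae_restrict_mem measurableSet_Ioi] with x hU hgauss hgauss' hx
  rw [hU, hgauss, hgauss', gauss_dilate m τ u hx]

theorem U_U (τ σ : ℝ) (f : L2) : U τ (U σ f) = U (τ + σ) f := by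
  have hm : (-1 : ℝ) < (0 : ℂ).re := by simp
  have h : (dilation τ).comp (dilation σ) = dilation (τ + σ) := ext_gaussVec hm fun u => by
    simp only [ContinuousLinearMap.comp_apply, dilation_apply, U_gaussVec]
    congr 1
    ring
  exact congrArg (fun T : L2 →L[ℂ] L2 => T f) h

theorem U_zero (f : L2) : U 0 f = f := by
  have hm : (-1 : ℝ) < (0 : ℂ).re := by simp
  have h : dilation 0 = ContinuousLinearMap.id ℂ L2 := ext_gaussVec hm fun u => by
    simp [U_gaussVec]
  exact congrArg (fun T : L2 →L[ℂ] L2 => T f) h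

theorem pair_U_left (τ : ℝ) (f g : L2) : pair (U τ f) g = pair f (U (-τ) g) := by
  rw [← pair_U_U (-τ), U_U, neg_add_cancel, U_zero]

theorem continuous_of_continuous_inner {X E : Type*} [TopologicalSpace X] [NormedAddCommGroup E]
    [InnerProductSpace ℂ E] {e : X → E}
    (h : Continuous fun p : X × X => inner ℂ (e p.1) (e p.2)) : Continuous e := by
  refine continuous_iff_continuousAt.2 fun x₀ => tendsto_iff_norm_sub_tendsto_zero.2 ?_
  have hsq : ∀ x, ‖e x - e x₀‖ ^ 2 = (inner ℂ (e x) (e x) - inner ℂ (e x) (e x₀) -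
      inner ℂ (e x₀) (e x) + inner ℂ (e x₀) (e x₀)).re := by
    intro x
    rw [← inner_sub_sub_self, inner_self_eq_norm_sq_to_K]
    norm_cast
  have hcont : Continuous fun x => ‖e x - e x₀‖ ^ 2 := by
    have hdiag := h.comp (continuous_id.prodMk continuous_id)
    have hleft := h.comp (continuous_id.prodMk (continuous_const (y := x₀)))
    have hright := h.comp ((continuous_const (y := x₀)).prodMk continuous_id)
    simp only [hsq]
    exact Complex.continuous_re.comp (((hdiag.sub hleft).sub hright).add continuous_const)
  have hlim := (Real.continuous_sqrt.comp hcont).tendsto x₀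
  simpa [Function.comp_def, Real.sqrt_sq (norm_nonneg _)] using hlim

theorem continuous_gaussVec {m : ℂ} (hm : -1 < m.re) : Continuous (gaussVec hm) := by
  refine continuous_of_continuous_inner ?_
  simp only [inner_gaussVec]
  have : Continuous fun p : ℝ × ℝ => (1 + Real.exp (p.2 - p.1)) ^ (-(m.re + 1)) :=
    (by fun_prop : Continuous fun p : ℝ × ℝ => 1 + Real.exp (p.2 - p.1)).rpow_const fun p =>
      Or.inl (by positivity)
  fun_prop

theorem continuous_U (f : L2) : Continuous fun τ => U τ f := by
  have hm : (-1 : ℝ) < (0 : ℂ).re := by simp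
  have hspan : ∀ g ∈ Submodule.span ℂ (Set.range (gaussVec hm)), Continuous fun τ => U τ g := by
    intro g hg
    induction hg using Submodule.span_induction with
    | mem x hx =>
      obtain ⟨u, rfl⟩ := hx
      simp only [U_gaussVec]
      exact (continuous_gaussVec hm).comp (by fun_prop)
    | zero => simpa [← dilation_apply] using continuous_const
    | add x y _ _ hx hy => simpa only [U_map_add] using hx.fun_add hy
    | smul a x _ hx => simpa only [U_map_smul] using hx.fun_const_smul a
  refine continuous_of_uniform_approx_of_continuous fun s hs => ?_
  obtain ⟨ε, hε, hεs⟩ := Metric.mem_uniformity_dist.1 hs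
  obtain ⟨g, hg, hfg⟩ := (dense_span_gaussVec hm).exists_dist_lt f hε
  refine ⟨fun τ => U τ g, hspan g hg, fun τ => hεs ?_⟩
  rw [dist_eq_norm] at hfg ⊢
  beta_reduce
  rw [← dilation_apply, ← dilation_apply, ← map_sub, dilation_apply, norm_U]
  exact hfg

/-! ### The Hankel transformation as a bounded operator -/

/-- The Hankel transformation, determined by its action `gauss m u ↦ gauss m (-u)`. -/
def hankel {m : ℂ} (hm : -1 < m.re) : L2 →L[ℂ] L2 :=
  (Finsupp.linearCombination ℂ fun u => gaussVec hm (-u)).extendOfNorm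
    (Finsupp.linearCombination ℂ (gaussVec hm))

theorem hankel_gaussVec {m : ℂ} (hm : -1 < m.re) (u : ℝ) :
    hankel hm (gaussVec hm u) = gaussVec hm (-u) := by
  have hd : DenseRange (Finsupp.linearCombination ℂ (gaussVec hm)) := by
    have := dense_span_gaussVec hm
    rwa [← Finsupp.range_linearCombination] at this
  have := LinearMap.extendOfNorm_eq hd (exists_norm_linearCombination_gaussVec_neg_le hm)
    (Finsupp.single u 1)
  simpa [hankel] using this

theorem hankel_hankel {m : ℂ} (hm : -1 < m.re) (f : L2) : hankel hm (hankel hm f) = f := by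
  have h : (hankel hm).comp (hankel hm) = ContinuousLinearMap.id ℂ L2 := ext_gaussVec hm fun u => by
    simp [hankel_gaussVec]
  exact congrArg (fun T : L2 →L[ℂ] L2 => T f) h

theorem hankel_U {m : ℂ} (hm : -1 < m.re) (τ : ℝ) (f : L2) :
    hankel hm (U τ f) = U (-τ) (hankel hm f) := by
  have h : (hankel hm).comp (dilation τ) = (dilation (-τ)).comp (hankel hm) :=
    ext_gaussVec hm fun u => by
      simp only [ContinuousLinearMap.comp_apply, dilation_apply, U_gaussVec, hankel_gaussVec]
      congr 1
      ring
  exact congrArg (fun T : L2 →L[ℂ] L2 => T f) h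

theorem pair_hankel {m : ℂ} (hm : -1 < m.re) (f g : L2) :
    pair (hankel hm f) g = pair f (hankel hm g) := by
  have h : pair.comp (hankel hm) = (pair.flip.comp (hankel hm)).flip :=
    ext_gaussVec hm fun u => ext_gaussVec hm fun v => by
      simp only [ContinuousLinearMap.comp_apply, ContinuousLinearMap.flip_apply, hankel_gaussVec]
      rw [← pair_U_U ((u - v) / 2), U_gaussVec, U_gaussVec, pair_comm]
      congr 2 <;> congr 1 <;> ring
  exact congrArg (fun T : L2 →L[ℂ] L2 →L[ℂ] ℂ => T f g) h

/-! ### The generator of dilations -/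

theorem IsTest.differentiable {φ : ℝ → ℂ} (hφ : IsTest φ) : Differentiable ℝ φ :=
  hφ.contDiff.differentiable (by simp)

theorem IsTest.integrable {φ : ℝ → ℂ} (hφ : IsTest φ) : Integrable φ μ :=
  (hφ.contDiff.continuous.integrable_of_hasCompactSupport hφ.compact).restrict

theorem IsTest.conj {φ : ℝ → ℂ} (hφ : IsTest φ) : IsTest fun x => (starRingEnd ℂ) (φ x) :=
  ⟨Complex.conjCLE.contDiff.comp hφ.contDiff,
    hφ.compact.comp_left (g := (starRingEnd ℂ)) (map_zero _),
    (closure_mono fun x hx => by simpa using hx).trans hφ.supp⟩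

theorem IsTest.dilate {φ : ℝ → ℂ} (hφ : IsTest φ) (τ : ℝ) :
    IsTest fun x => ((Real.exp (τ / 2) : ℝ) : ℂ) * φ (Real.exp τ * x) := by
  have hcomp : IsTest fun x => φ (Real.exp τ * x) := by
    refine ⟨hφ.contDiff.comp (by fun_prop), ?_, ?_⟩
    · simpa only [smul_eq_mul] using hφ.compact.comp_smul (c := Real.exp τ) (Real.exp_pos τ).ne'
    · refine (tsupport_comp_subset_preimage φ (f := fun x => Real.exp τ * x) (by fun_prop)).trans
        fun x hx => ?_
      exact (mul_pos_iff_of_pos_left (Real.exp_pos τ)).1 (hφ.supp hx)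
  exact hcomp.smul _

theorem dilationTranspose_eq {φ : ℝ → ℂ} (hφ : Differentiable ℝ φ) (x : ℝ) :
    dilationTranspose φ x = Complex.I * (x * deriv φ x + φ x / 2) := by
  have hmul : deriv (fun y : ℝ => (y : ℂ) * φ y) x = φ x + x * deriv φ x := by
    simpa using (Complex.ofRealCLM.hasDerivAt.fun_mul (hφ x).hasDerivAt).deriv
  have hI : (1 : ℂ) / (2 * Complex.I) = -Complex.I / 2 := by
    rw [div_eq_div_iff (by simp) (by norm_num)]
    linear_combination 2 * Complex.I_mul_I
  rw [dilationTranspose, hmul, hI]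
  ring

theorem dilationTranspose_conj {φ : ℝ → ℂ} (hφ : IsTest φ) (x : ℝ) :
    dilationTranspose (fun x => (starRingEnd ℂ) (φ x)) x =
      -(starRingEnd ℂ) (dilationTranspose φ x) := by
  rw [dilationTranspose_eq hφ.differentiable, dilationTranspose_eq hφ.conj.differentiable]
  have hderiv : deriv (fun x => (starRingEnd ℂ) (φ x)) x = (starRingEnd ℂ) (deriv φ x) :=
    (hφ.differentiable x).hasDerivAt.star.deriv
  simp only [hderiv, map_mul, map_add, map_div₀, Complex.conj_I, Complex.conj_ofReal,
    Complex.conj_ofNat]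
  ring

theorem dilationTranspose_dilate {φ : ℝ → ℂ} (hφ : IsTest φ) (τ x : ℝ) :
    dilationTranspose (fun x => ((Real.exp (τ / 2) : ℝ) : ℂ) * φ (Real.exp τ * x)) x =
      ((Real.exp (τ / 2) : ℝ) : ℂ) * dilationTranspose φ (Real.exp τ * x) := by
  rw [dilationTranspose_eq (hφ.dilate τ).differentiable, dilationTranspose_eq hφ.differentiable]
  have hscale : HasDerivAt (fun x => Real.exp τ * x) (Real.exp τ) x := by
    simpa using (hasDerivAt_id x).const_mul (Real.exp τ)
  have hcomp : HasDerivAt (fun x => φ (Real.exp τ * x))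
      (Real.exp τ • deriv φ (Real.exp τ * x)) x :=
    (hφ.differentiable _).hasDerivAt.scomp x hscale
  rw [(hcomp.const_mul _).deriv, Complex.real_smul]
  push_cast
  ring

theorem hasDerivAt_dilate {φ : ℝ → ℂ} (hφ : Differentiable ℝ φ) (x τ : ℝ) :
    HasDerivAt (fun τ : ℝ => ((Real.exp (τ / 2) : ℝ) : ℂ) * φ (Real.exp τ * x))
      (-Complex.I * (((Real.exp (τ / 2) : ℝ) : ℂ) * dilationTranspose φ (Real.exp τ * x))) τ := by
  have hexp : HasDerivAt (fun τ : ℝ => ((Real.exp (τ / 2) : ℝ) : ℂ))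
      ((Real.exp (τ / 2) * (1 / 2) : ℝ) : ℂ) τ :=
    ((hasDerivAt_id τ).div_const 2).exp.ofReal_comp
  have hcomp : HasDerivAt (fun τ : ℝ => φ (Real.exp τ * x))
      ((Real.exp τ * x) • deriv φ (Real.exp τ * x)) τ :=
    (hφ _).hasDerivAt.scomp τ ((Real.hasDerivAt_exp τ).mul_const x)
  refine (hexp.mul hcomp).congr_deriv ?_
  rw [dilationTranspose_eq hφ, Complex.real_smul]
  rw [Complex.ofReal_mul, Complex.ofReal_mul]
  push_cast
  linear_combination (Complex.exp (τ / 2) *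
    (Complex.exp τ * x * deriv φ (Real.exp τ * x) + φ (Real.exp τ * x) / 2)) * Complex.I_mul_I

theorem exists_norm_dilate_le {χ : ℝ → ℂ} (hχ : Continuous χ) (hc : HasCompactSupport χ) :
    ∃ R K : ℝ, ∀ τ ∈ Metric.ball (0 : ℝ) 1, ∀ x, 0 < x →
      ‖((Real.exp (τ / 2) : ℝ) : ℂ) * χ (Real.exp τ * x)‖ ≤
        (Set.Iic R).indicator (fun _ => K) x := by
  obtain ⟨M, hM⟩ := hc.exists_bound_of_continuous hχ
  obtain ⟨B, hB⟩ := hc.isCompact.isBounded.subset_closedBall 0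
  refine ⟨Real.exp 1 * B, Real.exp 1 * M, fun τ hτ x hx => ?_⟩
  rw [mem_ball_zero_iff, Real.norm_eq_abs, abs_lt] at hτ
  by_cases hxR : x ≤ Real.exp 1 * B
  · rw [Set.indicator_of_mem (Set.mem_Iic.2 hxR), norm_mul, Complex.norm_real, Real.norm_eq_abs,
      Real.abs_exp]
    gcongr
    · linarith
    · exact hM _
  · have hlt : B < Real.exp τ * x := by
      calc B = Real.exp (-1) * (Real.exp 1 * B) := by rw [← mul_assoc, ← Real.exp_add]; simp
        _ < Real.exp (-1) * x := by gcongr; exact not_le.1 hxR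
        _ ≤ Real.exp τ * x := by gcongr; exact hτ.1.le
    have hzero : χ (Real.exp τ * x) = 0 := image_eq_zero_of_notMem_tsupport fun hmem =>
      hlt.not_ge ((le_abs_self _).trans (mem_closedBall_zero_iff.1 (hB hmem)))
    rw [Set.indicator_of_notMem (by simpa using hxR), hzero, mul_zero, norm_zero]

theorem hasDerivAt_integral_mul_dilate (f : L2) {φ : ℝ → ℂ} (hφ : IsTest φ) :
    HasDerivAt (fun τ : ℝ => ∫ x, f x * (((Real.exp (τ / 2) : ℝ) : ℂ) * φ (Real.exp τ * x)) ∂μ)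
      (-Complex.I * ∫ x, f x * dilationTranspose φ x ∂μ) 0 := by
  have hχ := IsTest.dilationTranspose φ hφ
  obtain ⟨R, K, hbound⟩ := exists_norm_dilate_le hχ.contDiff.continuous hχ.compact
  have hfin : μ (Set.Iic R) ≠ ⊤ := by
    rw [Measure.restrict_apply measurableSet_Iic, Set.Iic_inter_Ioi]
    exact measure_Ioc_lt_top.ne
  have hdom : Integrable (fun x => ‖f x‖ * (Set.Iic R).indicator (fun _ => K) x) μ :=
    (Lp.memLp f).norm.integrable_mul (memLp_indicator_const 2 measurableSet_Iic K (Or.inr hfin))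
  have hderiv := hasDerivAt_integral_of_dominated_loc_of_deriv_le (μ := μ) (𝕜 := ℝ)
    (F := fun τ x => f x * (((Real.exp (τ / 2) : ℝ) : ℂ) * φ (Real.exp τ * x)))
    (F' := fun τ x => f x * (-Complex.I *
      (((Real.exp (τ / 2) : ℝ) : ℂ) * dilationTranspose φ (Real.exp τ * x))))
    (Metric.ball_mem_nhds 0 one_pos)
    (Eventually.of_forall fun τ => (Lp.aestronglyMeasurable f).mul
      (hφ.dilate τ).contDiff.continuous.aestronglyMeasurable)
    ((hφ.dilate 0).integrable_mul f)
    ((Lp.aestronglyMeasurable f).mul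
      ((hχ.dilate 0).smul (-Complex.I)).contDiff.continuous.aestronglyMeasurable)
    ((ae_restrict_mem measurableSet_Ioi).mono fun x hx τ hτ => by
      rw [norm_mul, norm_mul (-Complex.I), norm_neg, Complex.norm_I, one_mul]
      exact mul_le_mul_of_nonneg_left (hbound τ hτ x hx) (norm_nonneg _))
    hdom (ae_of_all _ fun x τ _ => (hasDerivAt_dilate hφ.differentiable x τ).const_mul (f x))
  refine hderiv.2.congr_deriv ?_
  rw [← integral_const_mul]
  refine integral_congr_ae (ae_of_all _ fun x => ?_)
  simp only [zero_div, Real.exp_zero, Complex.ofReal_one, one_mul]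
  ring

theorem U_toLp (τ : ℝ) {g : ℝ → ℂ} (hg : MemLp g 2 μ) :
    U τ (hg.toLp g) =ᵐ[μ] fun x => ((Real.exp (τ / 2) : ℝ) : ℂ) * g (Real.exp τ * x) := by
  filter_upwards [coeFn_U τ (hg.toLp g), (quasiMeasurePreserving_mul_exp τ).ae hg.coeFn_toLp]
    with x hU hg
  rw [hU, hg]

theorem integral_U_mul (τ : ℝ) (f : L2) {g : ℝ → ℂ} (hg : MemLp g 2 μ) :
    ∫ x, U τ f x * g x ∂μ =
      ∫ x, f x * (((Real.exp (-τ / 2) : ℝ) : ℂ) * g (Real.exp (-τ) * x)) ∂μ := by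
  rw [← pair_toLp _ hg, pair_U_left, pair_apply]
  exact integral_congr_ae (by filter_upwards [U_toLp (-τ) hg] with x hx; rw [hx])

theorem hasDerivAt_integral_U_mul (f : L2) {φ : ℝ → ℂ} (hφ : IsTest φ) :
    HasDerivAt (fun τ => ∫ x, U τ f x * φ x ∂μ)
      (Complex.I * ∫ x, f x * dilationTranspose φ x ∂μ) 0 := by
  simp only [fun τ => integral_U_mul τ f hφ.memLp]
  have hderiv := hasDerivAt_integral_mul_dilate f hφ
  rw [← neg_zero] at hderiv
  simpa [Function.comp_def] using hderiv.scomp (0 : ℝ) (hasDerivAt_neg 0)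

theorem mem_weakGraph {T : (ℝ → ℂ) → ℝ → ℂ} {hT : ∀ φ, IsTest φ → IsTest (T φ)} {f g : L2} :
    (f, g) ∈ weakGraph T hT ↔
      ∀ φ, IsTest φ → ∫ x, f x * T φ x ∂μ = ∫ x, g x * φ x ∂μ := Iff.rfl

theorem hasDerivAt_integral_of_hasDerivAt {G : ℝ → L2} {g : L2} {t : ℝ} (h : HasDerivAt G g t)
    {φ : ℝ → ℂ} (hφ : MemLp φ 2 μ) :
    HasDerivAt (fun τ => ∫ x, G τ x * φ x ∂μ) (∫ x, g x * φ x ∂μ) t := by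
  simp only [← pair_toLp _ hφ]
  exact ((pair.flip (hφ.toLp φ)).restrictScalars ℝ).hasFDerivAt.comp_hasDerivAt t h

theorem integral_smul_mul (c : ℂ) (g : L2) {φ : ℝ → ℂ} (hφ : MemLp φ 2 μ) :
    ∫ x, (c • g) x * φ x ∂μ = c * ∫ x, g x * φ x ∂μ := by
  rw [← pair_toLp _ hφ, ← pair_toLp _ hφ, map_smul]
  rfl

theorem hasDerivAt_integral_U_mul_of_mem_weakGraph {f g : L2}
    (h : (f, g) ∈ weakGraph dilationTranspose IsTest.dilationTranspose) {φ : ℝ → ℂ}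
    (hφ : IsTest φ) (t : ℝ) :
    HasDerivAt (fun τ => ∫ x, U τ f x * φ x ∂μ) (∫ x, (Complex.I • U t g) x * φ x ∂μ) t := by
  have hzero := hasDerivAt_integral_U_mul (U t f) hφ
  rw [← sub_self t] at hzero
  have hshift := hzero.comp_sub_const t t
  simp only [U_U, sub_add_cancel] at hshift
  refine hshift.congr_deriv ?_
  rw [integral_smul_mul _ _ hφ.memLp, integral_U_mul t f (IsTest.dilationTranspose φ hφ).memLp,
    integral_U_mul t g hφ.memLp, ← mem_weakGraph.1 h _ (hφ.dilate (-t))]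
  simp only [dilationTranspose_dilate hφ]

theorem eq_of_hasDerivAt_integral {F G : ℝ → L2} (h0 : F 0 = G 0)
    (h : ∀ φ, IsTest φ → ∀ t, HasDerivAt (fun τ => ∫ x, F τ x * φ x ∂μ - ∫ x, G τ x * φ x ∂μ) 0 t) :
    F = G := by
  ext1 τ
  refine sub_eq_zero.1 (eq_zero_of_integral_test fun φ hφ => ?_)
  have hconst := is_const_of_deriv_eq_zero (fun t => (h φ hφ t).differentiableAt)
    (fun t => (h φ hφ t).deriv) τ 0
  simp only [h0, sub_self] at hconst
  rw [← hconst]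
  simp only [← pair_toLp _ hφ.memLp, map_sub, sub_apply]

theorem hasDerivAt_U_of_mem_weakGraph {f g : L2}
    (h : (f, g) ∈ weakGraph dilationTranspose IsTest.dilationTranspose) :
    HasDerivAt (fun τ : ℝ => U τ f) (Complex.I • g) 0 := by
  set G : ℝ → L2 := fun τ => f + ∫ s in (0 : ℝ)..τ, Complex.I • U s g with hG
  have hcont : Continuous fun s => Complex.I • U s g := (continuous_U g).fun_const_smul _
  have hderiv : ∀ t, HasDerivAt G (Complex.I • U t g) t := fun t =>
    (intervalIntegral.integral_hasDerivAt_right (hcont.intervalIntegrable _ _)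
      (hcont.stronglyMeasurableAtFilter _ _) hcont.continuousAt).const_add f
  have hUG : (fun τ : ℝ => U τ f) = G :=
    eq_of_hasDerivAt_integral (by simp [hG, U_zero]) fun φ hφ t => by
      simpa using (hasDerivAt_integral_U_mul_of_mem_weakGraph h hφ t).fun_sub
        (hasDerivAt_integral_of_hasDerivAt (hderiv t) hφ.memLp)
  rw [hUG]
  simpa [U_zero] using hderiv 0

theorem mem_A_graph_iff (f g : L2) :
    (f, g) ∈ A.graph ↔ HasDerivAt (fun τ : ℝ => U τ f) (Complex.I • g) 0 := by
  rw [A_graph]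
  refine ⟨hasDerivAt_U_of_mem_weakGraph, fun h φ hφ => ?_⟩
  have heq := (hasDerivAt_integral_of_hasDerivAt h hφ.memLp).unique (hasDerivAt_integral_U_mul f hφ)
  rw [integral_smul_mul _ _ hφ.memLp] at heq
  exact (mul_left_cancel₀ Complex.I_ne_zero heq).symm

theorem inner_eq_of_mem_A_graph {f₁ g₁ f₂ g₂ : L2} (h₁ : (f₁, g₁) ∈ A.graph)
    (h₂ : (f₂, g₂) ∈ A.graph) : inner ℂ g₁ f₂ = inner ℂ f₁ g₂ := by
  have hderiv := ((mem_A_graph_iff _ _).1 h₁).inner ℂ ((mem_A_graph_iff _ _).1 h₂)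
  simp only [inner_U, U_zero, inner_smul_left, inner_smul_right, Complex.conj_I] at hderiv
  have hzero := hderiv.unique (hasDerivAt_const _ _)
  refine mul_left_cancel₀ Complex.I_ne_zero ?_
  linear_combination -hzero

theorem contDiffAt_deriv {w : ℝ → ℂ} (hw : ∀ x, 0 < x → ContDiffAt ℝ ∞ w x) (x : ℝ) (hx : 0 < x) :
    ContDiffAt ℝ ∞ (deriv w) x :=
  (hw x hx).derivWithin (by simp)

theorem IsTest.integral_deriv {η : ℝ → ℂ} (hη : IsTest η) : ∫ x, _root_.deriv η x ∂μ = 0 := by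
  rw [setIntegral_eq_integral_of_forall_compl_eq_zero fun x hx =>
    image_eq_zero_of_notMem_tsupport fun hmem => hx (hη.deriv.supp hmem)]
  exact integral_eq_zero_of_hasDerivAt_of_integrable (fun x => (hη.differentiable x).hasDerivAt)
    (hη.deriv.contDiff.continuous.integrable_of_hasCompactSupport hη.deriv.compact)
    (hη.contDiff.continuous.integrable_of_hasCompactSupport hη.compact)

theorem integral_mul_deriv_of_contDiffAt {w φ : ℝ → ℂ} (hw : ∀ x, 0 < x → ContDiffAt ℝ ∞ w x)
    (hφ : IsTest φ) : ∫ x, w x * deriv φ x ∂μ = -∫ x, deriv w x * φ x ∂μ := by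
  have hprod : ∫ x, deriv (fun x => w x * φ x) x ∂μ =
      ∫ x, (deriv w x * φ x + w x * deriv φ x) ∂μ := by
    refine setIntegral_congr_fun measurableSet_Ioi fun x hx => ?_
    exact (((hw x hx).differentiableAt (by simp)).hasDerivAt.fun_mul
      (hφ.differentiable x).hasDerivAt).deriv
  rw [(hφ.mul_left hw).integral_deriv, integral_add (hφ.mul_left (contDiffAt_deriv hw)).integrable
    (hφ.deriv.mul_left hw).integrable] at hprod
  linear_combination -hprod

theorem mem_A_graph_of_contDiffAt {w v : ℝ → ℂ} (hw : ∀ x, 0 < x → ContDiffAt ℝ ∞ w x)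
    (hv : ∀ x, 0 < x → v x = -(Complex.I * (x * deriv w x + w x / 2))) {f g : L2}
    (hf : f =ᵐ[μ] w) (hg : g =ᵐ[μ] v) : (f, g) ∈ A.graph := by
  rw [A_graph, mem_weakGraph]
  intro φ hφ
  have hxw : ∀ x : ℝ, 0 < x → ContDiffAt ℝ ∞ (fun y : ℝ => (y : ℂ) * w y) x := fun x hx =>
    Complex.ofRealCLM.contDiff.contDiffAt.mul (hw x hx)
  have hderiv : ∀ x : ℝ, 0 < x → deriv (fun y : ℝ => (y : ℂ) * w y) x = w x + x * deriv w x := by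
    intro x hx
    simpa using (Complex.ofRealCLM.hasDerivAt.fun_mul
      ((hw x hx).differentiableAt (by simp)).hasDerivAt).deriv
  calc ∫ x, f x * dilationTranspose φ x ∂μ
      = ∫ x, (Complex.I * ((x * w x) * deriv φ x) + Complex.I / 2 * (w x * φ x)) ∂μ := by
        refine integral_congr_ae ?_
        filter_upwards [hf] with x hx
        rw [hx, dilationTranspose_eq hφ.differentiable]
        ring
    _ = Complex.I * ∫ x, (x * w x) * deriv φ x ∂μ + Complex.I / 2 * ∫ x, w x * φ x ∂μ := by
        rw [integral_add ((hφ.deriv.mul_left hxw).integrable.const_mul _)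
          ((hφ.mul_left hw).integrable.const_mul _), integral_const_mul, integral_const_mul]
    _ = ∫ x, (-Complex.I * (deriv (fun y : ℝ => (y : ℂ) * w y) x * φ x) +
          Complex.I / 2 * (w x * φ x)) ∂μ := by
        rw [integral_mul_deriv_of_contDiffAt hxw hφ,
          integral_add ((hφ.mul_left (contDiffAt_deriv hxw)).integrable.const_mul _)
          ((hφ.mul_left hw).integrable.const_mul _), integral_const_mul, integral_const_mul]
        ring
    _ = ∫ x, g x * φ x ∂μ := by
        refine integral_congr_ae ?_
        filter_upwards [hg, ae_restrict_mem measurableSet_Ioi] with x hgx hx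
        rw [hgx, hv x hx, hderiv x hx]
        ring

theorem IsTest.toLp_mem_A_graph {φ : ℝ → ℂ} (hφ : IsTest φ) :
    (hφ.memLp.toLp φ, ((IsTest.dilationTranspose φ hφ).smul (-1)).memLp.toLp _) ∈ A.graph :=
  mem_A_graph_of_contDiffAt (v := (-1 : ℂ) • HalfLine.dilationTranspose φ)
    (fun _ _ => hφ.contDiff.contDiffAt)
    (fun x _ => by simp [dilationTranspose_eq hφ.differentiable])
    (MemLp.coeFn_toLp _) (MemLp.coeFn_toLp _)

theorem inner_toLp_conj (f : L2) {φ : ℝ → ℂ}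
    (hφ : MemLp (fun x => (starRingEnd ℂ) (φ x)) 2 μ) :
    inner ℂ f (hφ.toLp _) = (starRingEnd ℂ) (∫ x, f x * φ x ∂μ) := by
  rw [L2.inner_def, ← integral_conj]
  refine integral_congr_ae ?_
  filter_upwards [hφ.coeFn_toLp] with x hx
  rw [hx, RCLike.inner_apply, map_mul, mul_comm]

theorem dense_A_domain : Dense (A.domain : Set L2) := by
  rw [Submodule.dense_iff_topologicalClosure_eq_top, Submodule.topologicalClosure_eq_top_iff,
    Submodule.eq_bot_iff]
  intro f hf
  refine eq_zero_of_integral_test fun φ hφ => ?_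
  have horth := (Submodule.mem_orthogonal' _ _).1 hf _
    (LinearPMap.mem_domain_of_mem_graph hφ.conj.toLp_mem_A_graph)
  rw [inner_toLp_conj] at horth
  exact (map_eq_zero _).1 horth

theorem adjoint_A_le : A.adjoint ≤ A := by
  refine LinearPMap.le_of_le_graph ?_
  rintro ⟨f, g⟩ h
  obtain ⟨f', rfl, rfl⟩ := (LinearPMap.mem_graph_iff _).1 h
  rw [A_graph]
  intro φ hφ
  obtain ⟨ψ, hψ, hAψ⟩ := (LinearPMap.mem_graph_iff _).1 hφ.conj.toLp_mem_A_graph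
  have hadj := LinearPMap.adjoint_isFormalAdjoint dense_A_domain f' ψ
  have hconj : MemLp (fun x => (starRingEnd ℂ) (dilationTranspose φ x)) 2 μ :=
    (IsTest.dilationTranspose φ hφ).conj.memLp
  have hA : A ψ = hconj.toLp _ := by
    rw [hAψ]
    exact MemLp.toLp_congr ((IsTest.dilationTranspose _ hφ.conj).smul (-1)).memLp hconj
      (ae_of_all _ fun x => by simp [dilationTranspose_conj hφ])
  rw [hA, hψ, inner_toLp_conj, inner_toLp_conj] at hadj
  exact ((starRingEnd ℂ).injective hadj).symm

theorem isSelfAdjoint_A : IsSelfAdjoint A := by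
  rw [LinearPMap.isSelfAdjoint_def]
  exact le_antisymm adjoint_A_le <| LinearPMap.IsFormalAdjoint.le_adjoint dense_A_domain
    fun f g => inner_eq_of_mem_A_graph (A.mem_graph f) (A.mem_graph g)

theorem hankel_mem_A_graph {m : ℂ} (hm : -1 < m.re) {f g : L2} (h : (f, g) ∈ A.graph) :
    (hankel hm f, -hankel hm g) ∈ A.graph := by
  rw [mem_A_graph_iff] at h ⊢
  have hderiv := ((hankel hm).restrictScalars ℝ).hasFDerivAt.comp_hasDerivAt (0 : ℝ) h
  have hU : ((hankel hm).restrictScalars ℝ : L2 → L2) ∘ (fun τ : ℝ => U τ f) =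
      fun τ => U (-τ) (hankel hm f) := funext fun τ => hankel_U hm τ f
  rw [hU, ← neg_zero] at hderiv
  simpa [Function.comp_def] using hderiv.scomp (0 : ℝ) (hasDerivAt_neg 0)

/-! ### The Hankel kernel -/

theorem integral_cpow_mul_exp_neg_mul_sq {s : ℂ} (hs : 0 < s.re) {B : ℝ} (hB : 0 < B) :
    ∫ x, (x : ℂ) ^ (2 * s - 1) * (Real.exp (-(B * x ^ 2)) : ℝ) ∂μ =
      1 / 2 * ((1 / B : ℂ) ^ s * Complex.Gamma s) := by
  rw [← Complex.integral_cpow_mul_exp_neg_mul_Ioi (a := s) hs hB,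
    ← integral_comp_rpow_Ioi_of_pos (g := fun t : ℝ => (t : ℂ) ^ (s - 1) * Complex.exp (-(B * t)))
      (p := 2) (by norm_num), ← integral_const_mul]
  refine setIntegral_congr_fun measurableSet_Ioi fun x (hx : 0 < x) => ?_
  have hxc : (x : ℂ) ≠ 0 := by exact_mod_cast hx.ne'
  have hsq : ((x ^ (2 : ℝ) : ℝ) : ℂ) ^ (s - 1) = (x : ℂ) ^ (2 * s - 2) := by
    rw [Real.rpow_two, sq, Complex.ofReal_mul, Complex.mul_cpow_ofReal_nonneg hx.le hx.le,
      ← Complex.cpow_add _ _ hxc]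
    ring_nf
  have hsucc : (x : ℂ) ^ (2 * s - 1) = (x : ℂ) ^ (2 * s - 2) * x := by
    rw [show 2 * s - 1 = (2 * s - 2) + 1 by ring, Complex.cpow_add _ _ hxc, Complex.cpow_one]
  rw [Complex.real_smul, hsq, hsucc, show (2 : ℝ) - 1 = 1 by norm_num, Real.rpow_one,
    Real.rpow_two]
  push_cast
  ring

theorem re_add_natCast_add_one_pos {m : ℂ} (hm : -1 < m.re) (j : ℕ) : 0 < (m + j + 1).re := by
  simp only [Complex.add_re, Complex.natCast_re, Complex.one_re]
  linarith [(j.cast_nonneg : (0 : ℝ) ≤ j)]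

theorem norm_Gamma_le_norm_Gamma_add_one {z : ℂ} (hz : 1 ≤ z.re) :
    ‖Complex.Gamma z‖ ≤ ‖Complex.Gamma (z + 1)‖ := by
  have hz0 : z ≠ 0 := fun h => by simp [h] at hz; linarith
  rw [Complex.Gamma_add_one _ hz0, norm_mul]
  exact le_mul_of_one_le_left (norm_nonneg _) (hz.trans (Complex.re_le_norm _))

theorem exists_norm_inv_Gamma_le {m : ℂ} (hm : -1 < m.re) :
    ∃ C : ℝ, 0 ≤ C ∧ ∀ j : ℕ, ‖(Complex.Gamma (m + j + 1))⁻¹‖ ≤ C := by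
  have hpos : ∀ j : ℕ, 0 < ‖Complex.Gamma (m + j + 1)‖ := fun j =>
    norm_pos_iff.2 (Complex.Gamma_ne_zero_of_re_pos (re_add_natCast_add_one_pos hm j))
  have hmono : Monotone fun j : ℕ => ‖Complex.Gamma (m + (j + 1 : ℕ) + 1)‖ := by
    refine monotone_nat_of_le_succ fun j => ?_
    have hre : 1 ≤ (m + (j + 1 : ℕ) + 1).re := by
      have := re_add_natCast_add_one_pos hm j
      simp only [Complex.add_re, Complex.natCast_re, Complex.one_re] at this ⊢
      push_cast
      linarith
    simpa only [Nat.cast_add, Nat.cast_one, ← add_assoc] using norm_Gamma_le_norm_Gamma_add_one hre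
  have hmin : ∀ j : ℕ, min ‖Complex.Gamma (m + (0 : ℕ) + 1)‖ ‖Complex.Gamma (m + (1 : ℕ) + 1)‖ ≤
      ‖Complex.Gamma (m + j + 1)‖
    | 0 => min_le_left _ _
    | j + 1 => (min_le_right _ _).trans (hmono j.zero_le)
  have hmin_pos := lt_min (hpos 0) (hpos 1)
  refine ⟨_, (inv_pos.2 hmin_pos).le, fun j => ?_⟩
  rw [norm_inv]
  exact inv_anti₀ hmin_pos (hmin j)

theorem hasSum_pow_div_factorial (y : ℝ) :
    HasSum (fun j : ℕ => y ^ j / (j.factorial : ℝ)) (Real.exp y) := by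
  rw [Real.exp_eq_exp_ℝ]
  exact NormedSpace.expSeries_div_hasSum_exp y

/-- The coefficients of the power series of `(z/2)^{-m} J_m(z)` in the variable `(z/2)²`. -/
def besselCoeff (m : ℂ) (j : ℕ) : ℂ :=
  (-1) ^ j / (j.factorial * Complex.Gamma (m + j + 1))

/-- The `j`-th term of the series for `J_m(z) √z`. The complex power is split off in such a way
that the term is measurable and the series converges for all real `z`. -/
def kernelTerm (m : ℂ) (j : ℕ) (z : ℝ) : ℂ :=
  besselCoeff m j * ((2 : ℂ) ^ (-m) * (z : ℂ) ^ (m + 1 / 2) * (((z / 2) ^ 2) ^ j : ℝ))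

/-- The function `J_m(z) √z`, so that the Hankel kernel is `kernelFun m (k * x)`. -/
def kernelFun (m : ℂ) (z : ℝ) : ℂ := ∑' j, kernelTerm m j z

theorem measurable_kernelTerm (m : ℂ) (j : ℕ) : Measurable (kernelTerm m j) :=
  (((Complex.measurable_ofReal.pow_const _).const_mul _).mul
    (Continuous.measurable (by fun_prop))).const_mul _

theorem exists_norm_kernelTerm_le {m : ℂ} (hm : -1 < m.re) : ∃ C : ℝ, 0 ≤ C ∧ ∀ j z,
    ‖kernelTerm m j z‖ ≤ C * ‖(z : ℂ) ^ (m + 1 / 2)‖ * (((z / 2) ^ 2) ^ j / j.factorial) := by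
  obtain ⟨C, hC0, hC⟩ := exists_norm_inv_Gamma_le hm
  refine ⟨C * ‖(2 : ℂ) ^ (-m)‖, by positivity, fun j z => ?_⟩
  have hcoeff : ‖besselCoeff m j‖ = ‖(Complex.Gamma (m + j + 1))⁻¹‖ / j.factorial := by
    simp [besselCoeff, div_eq_mul_inv]
  rw [kernelTerm, norm_mul, hcoeff, norm_mul, norm_mul, Complex.norm_real,
    Real.norm_of_nonneg (by positivity)]
  calc _ ≤ C / j.factorial * (‖(2 : ℂ) ^ (-m)‖ * ‖(z : ℂ) ^ (m + 1 / 2)‖ * ((z / 2) ^ 2) ^ j) := by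
        gcongr
        exact hC j
    _ = _ := by ring

theorem hasSum_kernelTerm {m : ℂ} (hm : -1 < m.re) (z : ℝ) :
    HasSum (fun j => kernelTerm m j z) (kernelFun m z) := by
  obtain ⟨C, -, hC⟩ := exists_norm_kernelTerm_le hm
  exact (Summable.of_norm_bounded ((hasSum_pow_div_factorial _).summable.mul_left _)
    fun j => hC j z).hasSum

theorem measurable_kernelFun {m : ℂ} (hm : -1 < m.re) : Measurable (kernelFun m) :=
  measurable_of_tendsto_metrizable
    (fun n => Finset.measurable_sum (Finset.range n) fun j _ => measurable_kernelTerm m j)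
    (tendsto_pi_nhds.2 fun z => by simpa using (hasSum_kernelTerm hm z).tendsto_sum_nat)

theorem norm_ofReal_cpow_add_half (m : ℂ) {z : ℝ} (hz : 0 < z) :
    ‖(z : ℂ) ^ (m + 1 / 2)‖ = z ^ (m.re + 1 / 2) := by
  simp [Complex.norm_cpow_eq_rpow_re_of_pos hz]

theorem exists_norm_kernelFun_le {m : ℂ} (hm : -1 < m.re) :
    ∃ C : ℝ, 0 ≤ C ∧ ∀ z : ℝ, 0 < z →
      ‖kernelFun m z‖ ≤ C * z ^ (m.re + 1 / 2) * Real.exp ((z / 2) ^ 2) := by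
  obtain ⟨C, hC0, hC⟩ := exists_norm_kernelTerm_le hm
  refine ⟨C, hC0, fun z hz => ?_⟩
  rw [← norm_ofReal_cpow_add_half m hz]
  exact tsum_of_norm_bounded ((hasSum_pow_div_factorial _).mul_left _) fun j => hC j z

theorem ofReal_half_cpow {z : ℝ} (hz : 0 < z) (m : ℂ) (j : ℕ) :
    ((z : ℂ) / 2) ^ (2 * (j : ℂ) + m) =
      (((z / 2) ^ 2) ^ j : ℝ) * ((2 : ℂ) ^ (-m) * (z : ℂ) ^ m) := by
  have hne : (z : ℂ) / 2 ≠ 0 := by exact_mod_cast (half_pos hz).ne'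
  rw [Complex.cpow_add _ _ hne, show 2 * (j : ℂ) = ((2 * j : ℕ) : ℂ) by push_cast; rfl,
    Complex.cpow_natCast, pow_mul]
  have hhalf : ((z : ℂ) / 2) ^ m = (2 : ℂ) ^ (-m) * (z : ℂ) ^ m := by
    have := Complex.mul_cpow_ofReal_nonneg (a := 2⁻¹) (by norm_num) hz.le m
    rw [Complex.ofReal_inv, Complex.inv_cpow _ _ (by simp [Complex.arg, Real.pi_pos.ne])] at this
    rw [div_eq_inv_mul, Complex.cpow_neg]
    simpa using this
  rw [hhalf]
  push_cast
  rfl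

theorem hankelKernel_eq_kernelFun (m : ℂ) {k x : ℝ} (hk : 0 < k) (hx : 0 < x) :
    hankelKernel m k x = kernelFun m (k * x) := by
  have hz : 0 < k * x := mul_pos hk hx
  rw [hankelKernel]
  generalize k * x = z at hz
  have hsqrt : ((Real.sqrt z : ℝ) : ℂ) = (z : ℂ) ^ (1 / 2 : ℂ) := by
    rw [Real.sqrt_eq_rpow, Complex.ofReal_cpow hz.le]
    norm_num
  rw [besselJ, kernelFun, ← tsum_mul_right]
  refine tsum_congr fun j => ?_
  rw [hsqrt, ofReal_half_cpow hz, kernelTerm, besselCoeff,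
    Complex.cpow_add _ _ (by exact_mod_cast hz.ne')]
  ring

/-! ### The Hankel integral of a Gaussian -/

theorem integrable_norm_gauss_sq {m : ℂ} (hm : -1 < m.re) (u : ℝ) :
    Integrable (fun x => ‖gauss m u x‖ ^ 2) μ :=
  (memLp_two_iff_integrable_sq_norm (aestronglyMeasurable_gauss m u)).1 (memLp_gauss hm u)

theorem rpow_mul_exp_mul_norm_gauss_le (m : ℂ) {u R k : ℝ} (hu : R ^ 2 + 2 ≤ Real.exp u)
    (hk : 0 < k) :
    k ^ (m.re + 1 / 2) * Real.exp ((k * R / 2) ^ 2) * ‖gauss m u k‖ ≤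
      Real.exp ((m.re + 1) * u / 2) * ‖gauss m 0 k‖ ^ 2 := by
  have hexp : Real.exp ((k * R / 2) ^ 2) * gaussReal u k ≤ gaussReal 0 k ^ 2 := by
    rw [gaussReal, gaussReal, ← Real.exp_add, ← Real.exp_nat_mul]
    refine Real.exp_le_exp.2 ?_
    have : (R ^ 2 + 2) * k ^ 2 ≤ Real.exp u * k ^ 2 := by gcongr
    rw [Real.exp_zero]
    push_cast
    nlinarith [sq_nonneg (R * k)]
  rw [norm_gauss m u hk, norm_gauss m 0 hk]
  calc _ = Real.exp ((m.re + 1) * u / 2) * (k ^ (m.re + 1 / 2)) ^ 2 *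
        (Real.exp ((k * R / 2) ^ 2) * gaussReal u k) := by ring
    _ ≤ Real.exp ((m.re + 1) * u / 2) * (k ^ (m.re + 1 / 2)) ^ 2 * gaussReal 0 k ^ 2 := by gcongr
    _ = _ := by simp only [mul_zero, zero_div, Real.exp_zero]; ring

theorem kernelTerm_mul_gauss (m : ℂ) (j : ℕ) (u : ℝ) {k x : ℝ} (hk : 0 < k) (hx : 0 < x) :
    kernelTerm m j (k * x) * gauss m u k =
      besselCoeff m j * ((2 : ℂ) ^ (-m) * (x : ℂ) ^ (m + 1 / 2) * ((x / 2) ^ 2) ^ j *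
        Complex.exp ((m + 1) * u / 2)) *
      ((k : ℂ) ^ (2 * (m + j + 1) - 1) * (Real.exp (-(Real.exp u / 2 * k ^ 2)) : ℝ)) := by
  have hkc : (k : ℂ) ≠ 0 := by exact_mod_cast hk.ne'
  rw [kernelTerm, gauss, powMul, gaussReal, Complex.ofReal_mul,
    Complex.mul_cpow_ofReal_nonneg hk.le hx.le,
    show 2 * (m + j + 1) - 1 = (m + 1 / 2) + (m + 1 / 2) + ((2 * j : ℕ) : ℂ) by push_cast; ring,
    Complex.cpow_add (m + 1 / 2 + (m + 1 / 2)) _ hkc,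
    Complex.cpow_add (m + 1 / 2) (m + 1 / 2) hkc, Complex.cpow_natCast,
    show Real.exp u * k ^ 2 / 2 = Real.exp u / 2 * k ^ 2 by ring]
  push_cast
  rw [pow_mul]
  ring

theorem one_div_half_exp_cpow (u : ℝ) (s : ℂ) :
    (1 / ((Real.exp u / 2 : ℝ) : ℂ)) ^ s = 2 ^ s * Complex.exp (-u * s) := by
  have hinv : (1 / ((Real.exp u / 2 : ℝ) : ℂ)) = ((2 : ℝ) : ℂ) * ((Real.exp (-u) : ℝ) : ℂ) := by
    rw [Real.exp_neg]
    push_cast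
    field_simp
  rw [hinv, Complex.mul_cpow_ofReal_nonneg (by norm_num) (Real.exp_pos _).le,
    Complex.cpow_def_of_ne_zero (x := ((Real.exp (-u) : ℝ) : ℂ))
      (by exact_mod_cast (Real.exp_pos _).ne'),
    ← Complex.ofReal_log (Real.exp_pos _).le, Real.log_exp]
  push_cast
  rfl

theorem integral_kernelTerm_mul_gauss {m : ℂ} (hm : -1 < m.re) (j : ℕ) (u : ℝ) {x : ℝ}
    (hx : 0 < x) :
    ∫ k, kernelTerm m j (k * x) * gauss m u k ∂μ =
      Complex.exp ((m + 1) * (-u : ℝ) / 2) * (x : ℂ) ^ (m + 1 / 2) *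
        (((-(Real.exp (-u) * x ^ 2 / 2)) ^ j / j.factorial : ℝ) : ℂ) := by
  have hs := re_add_natCast_add_one_pos hm j
  rw [setIntegral_congr_fun measurableSet_Ioi fun k hk => kernelTerm_mul_gauss m j u hk hx,
    integral_const_mul, integral_cpow_mul_exp_neg_mul_sq hs (by positivity),
    one_div_half_exp_cpow, besselCoeff]
  have htwo : (2 : ℂ) ^ (-m) * 2 ^ (m + j + 1) = 2 * 2 ^ j := by
    rw [← Complex.cpow_add _ _ (by norm_num), show -m + (m + j + 1) = ((j + 1 : ℕ) : ℂ) by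
      push_cast; ring, Complex.cpow_natCast, pow_succ']
  have hexp : Complex.exp ((m + 1) * u / 2) * Complex.exp (-u * (m + j + 1)) =
      Complex.exp ((m + 1) * (-u : ℝ) / 2) * Complex.exp (-u) ^ j := by
    rw [← Complex.exp_nat_mul, ← Complex.exp_add, ← Complex.exp_add]
    congr 1
    push_cast
    ring
  have hGamma := Complex.Gamma_ne_zero_of_re_pos hs
  calc _ = ((2 : ℂ) ^ (-m) * 2 ^ (m + j + 1)) *
        (Complex.exp ((m + 1) * u / 2) * Complex.exp (-u * (m + j + 1))) *
        (x : ℂ) ^ (m + 1 / 2) * ((-1) ^ j * (((x : ℂ) / 2) ^ 2) ^ j / j.factorial) / 2 := by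
        field_simp
    _ = Complex.exp ((m + 1) * (-u : ℝ) / 2) * (x : ℂ) ^ (m + 1 / 2) *
        (((-1) * (x / 2) ^ 2 * 2 * Complex.exp (-u)) ^ j / j.factorial) := by
        rw [htwo, hexp, mul_pow, mul_pow, mul_pow]
        ring
    _ = _ := by
        push_cast
        ring_nf

theorem integrable_norm_cpow_mul_exp_mul_norm_gauss {m : ℂ} (hm : -1 < m.re) {u x : ℝ}
    (hx : 0 < x) (hu : x ^ 2 + 2 ≤ Real.exp u) :
    Integrable (fun k : ℝ => ‖((k * x : ℝ) : ℂ) ^ (m + 1 / 2)‖ * Real.exp ((k * x / 2) ^ 2) *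
      ‖gauss m u k‖) μ := by
  refine ((integrable_norm_gauss_sq hm 0).const_mul
    (x ^ (m.re + 1 / 2) * Real.exp ((m.re + 1) * u / 2))).mono' ?_ ?_
  · refine AEStronglyMeasurable.mul (Measurable.aestronglyMeasurable ?_)
      (aestronglyMeasurable_gauss m u).norm
    exact ((Complex.measurable_ofReal.comp (measurable_id.mul_const x)).pow_const _).norm.mul
      (Continuous.measurable (by fun_prop))
  · filter_upwards [ae_restrict_mem measurableSet_Ioi] with k hk
    have hk : 0 < k := hk
    rw [Real.norm_of_nonneg (by positivity), norm_ofReal_cpow_add_half m (mul_pos hk hx),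
      Real.mul_rpow hk.le hx.le]
    calc _ = x ^ (m.re + 1 / 2) *
          (k ^ (m.re + 1 / 2) * Real.exp ((k * x / 2) ^ 2) * ‖gauss m u k‖) := by ring
      _ ≤ x ^ (m.re + 1 / 2) * (Real.exp ((m.re + 1) * u / 2) * ‖gauss m 0 k‖ ^ 2) := by
        gcongr ?_ * ?_
        exact rpow_mul_exp_mul_norm_gauss_le m hu hk
      _ = _ := by ring

theorem integral_kernelFun_mul_gauss {m : ℂ} (hm : -1 < m.re) {u x : ℝ} (hx : 0 < x)
    (hu : x ^ 2 + 2 ≤ Real.exp u) :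
    ∫ k, kernelFun m (k * x) * gauss m u k ∂μ = gauss m (-u) x := by
  obtain ⟨C, -, hC⟩ := exists_norm_kernelTerm_le hm
  have hbound : ∀ k : ℝ, HasSum (fun j : ℕ => C * ‖((k * x : ℝ) : ℂ) ^ (m + 1 / 2)‖ *
      (((k * x / 2) ^ 2) ^ j / j.factorial) * ‖gauss m u k‖)
      (C * ‖((k * x : ℝ) : ℂ) ^ (m + 1 / 2)‖ * Real.exp ((k * x / 2) ^ 2) * ‖gauss m u k‖) :=
    fun k => ((hasSum_pow_div_factorial _).mul_left _).mul_right _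
  have hsum := hasSum_integral_of_dominated_convergence (μ := μ)
    (F := fun j k => kernelTerm m j (k * x) * gauss m u k) _
    (fun j => ((measurable_kernelTerm m j).comp
      (measurable_id.mul_const x)).aestronglyMeasurable.mul (aestronglyMeasurable_gauss m u))
    (fun j => ae_of_all _ fun k => by
      rw [norm_mul]
      exact mul_le_mul_of_nonneg_right (hC j (k * x)) (norm_nonneg _))
    (ae_of_all _ fun k => (hbound k).summable)
    (by
      simp only [(hbound _).tsum_eq]
      simpa only [mul_assoc] using
        (integrable_norm_cpow_mul_exp_mul_norm_gauss hm hx hu).const_mul C)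
    (ae_of_all _ fun k => (hasSum_kernelTerm hm (k * x)).mul_right (gauss m u k))
  simp only [integral_kernelTerm_mul_gauss hm _ u hx] at hsum
  refine hsum.unique ?_
  rw [gauss, powMul, gaussReal, ← mul_assoc]
  exact (Complex.hasSum_ofReal.2 (hasSum_pow_div_factorial _)).mul_left _

/-! ### The Hankel transformation as an integral operator -/

theorem tendsto_toLp_of_dominated {α ι E : Type*} [MeasurableSpace α] {ν : Measure α}
    [NormedAddCommGroup E] {p : ℝ≥0∞} [Fact (1 ≤ p)] (hp : p ≠ ⊤) {l : Filter ι}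
    [l.IsCountablyGenerated] {g : ι → α → E} {g₀ : α → E} {D : α → ℝ}
    (hg : ∀ n, MemLp (g n) p ν) (hg₀ : MemLp g₀ p ν) (hD : MemLp D p ν)
    (hbound : ∀ᶠ n in l, ∀ᵐ x ∂ν, ‖g n x - g₀ x‖ ≤ D x)
    (hlim : ∀ᵐ x ∂ν, Tendsto (fun n => g n x) l (𝓝 (g₀ x))) :
    Tendsto (fun n => (hg n).toLp (g n)) l (𝓝 (hg₀.toLp g₀)) := by
  have hp0 : p ≠ 0 := (zero_lt_one.trans_le Fact.out).ne'
  have hpos : 0 < p.toReal := ENNReal.toReal_pos hp0 hp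
  rw [Lp.tendsto_Lp_iff_tendsto_eLpNorm'']
  simp only [eLpNorm_eq_lintegral_rpow_enorm_toReal hp0 hp]
  have hint : Tendsto (fun n => ∫⁻ x, ‖(g n - g₀) x‖ₑ ^ p.toReal ∂ν) l (𝓝 (∫⁻ _, 0 ∂ν)) := by
    refine tendsto_lintegral_filter_of_dominated_convergence' (fun x => ‖D x‖ₑ ^ p.toReal)
      (Eventually.of_forall fun n =>
        (((hg n).sub hg₀).aestronglyMeasurable.enorm.pow_const _)) ?_
      (lintegral_rpow_enorm_lt_top_of_eLpNorm_lt_top hp0 hp hD.eLpNorm_lt_top).ne ?_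
    · filter_upwards [hbound] with n hn
      filter_upwards [hn] with x hx
      gcongr
      exact enorm_le_iff_norm_le.2 (hx.trans (le_abs_self _))
    · filter_upwards [hlim] with x hx
      have hsub : Tendsto (fun n => ‖(g n - g₀) x‖ₑ) l (𝓝 0) := by
        simpa using (hx.sub_const (g₀ x)).enorm
      simpa [Function.comp_def, ENNReal.zero_rpow_of_pos hpos] using
        ((ENNReal.continuous_rpow_const (y := p.toReal)).tendsto 0).comp hsub
  rw [lintegral_zero] at hint
  simpa [Function.comp_def, ENNReal.zero_rpow_of_pos (inv_pos.2 hpos)] using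
    ((ENNReal.continuous_rpow_const (y := 1 / p.toReal)).tendsto 0).comp hint

/-- The restriction of `f` to `]0,R]`. -/
def truncVec (R : ℝ) (f : L2) : L2 :=
  ((Lp.memLp f).indicator (measurableSet_Iic (a := R))).toLp _

theorem coeFn_truncVec (R : ℝ) (f : L2) : truncVec R f =ᵐ[μ] (Set.Iic R).indicator f :=
  MemLp.coeFn_toLp _

theorem tendsto_truncVec (f : L2) : Tendsto (fun R => truncVec R f) atTop (𝓝 f) := by
  have htoLp : Tendsto (fun R => truncVec R f) atTop (𝓝 ((Lp.memLp f).toLp f)) := by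
    refine tendsto_toLp_of_dominated (g := fun R => (Set.Iic R).indicator f) (D := fun x => ‖f x‖)
      ENNReal.ofNat_ne_top _ _ (Lp.memLp f).norm
      (Eventually.of_forall fun R => ae_of_all _ fun x => ?_) (ae_of_all _ fun x => ?_)
    · by_cases hx : x ∈ Set.Iic R <;> simp [hx]
    · refine tendsto_const_nhds.congr' ?_
      filter_upwards [eventually_ge_atTop x] with R hR
      rw [Set.indicator_of_mem (Set.mem_Iic.2 hR)]
  rwa [Lp.toLp_coeFn] at htoLp

theorem rpow_le_norm_gauss (m : ℂ) {x R : ℝ} (hx : 0 < x) (hxR : x ≤ R) :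
    x ^ (m.re + 1 / 2) ≤ Real.exp (R ^ 2 / 2) * ‖gauss m 0 x‖ := by
  have hexp : 1 ≤ Real.exp (R ^ 2 / 2) * gaussReal 0 x := by
    rw [gaussReal, ← Real.exp_add, Real.exp_zero]
    refine Real.one_le_exp ?_
    nlinarith
  rw [norm_gauss m 0 hx]
  calc x ^ (m.re + 1 / 2) ≤ x ^ (m.re + 1 / 2) * (Real.exp (R ^ 2 / 2) * gaussReal 0 x) :=
        le_mul_of_one_le_right (by positivity) hexp
    _ = _ := by simp only [mul_zero, zero_div, Real.exp_zero]; ring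

theorem exists_norm_kernelFun_mul_le {m : ℂ} (hm : -1 < m.re) (R : ℝ) :
    ∃ C : ℝ, 0 ≤ C ∧ ∀ k x : ℝ, 0 < k → 0 < x → x ≤ R → ‖kernelFun m (k * x)‖ ≤
      C * (k ^ (m.re + 1 / 2) * Real.exp ((k * R / 2) ^ 2)) * ‖gauss m 0 x‖ := by
  obtain ⟨C, hC0, hC⟩ := exists_norm_kernelFun_le hm
  refine ⟨C * Real.exp (R ^ 2 / 2), by positivity, fun k x hk hx hxR => ?_⟩
  refine (hC _ (mul_pos hk hx)).trans ?_
  rw [Real.mul_rpow hk.le hx.le]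
  calc _ ≤ C * (k ^ (m.re + 1 / 2) * (Real.exp (R ^ 2 / 2) * ‖gauss m 0 x‖)) *
        Real.exp ((k * R / 2) ^ 2) := by
        gcongr
        exact rpow_le_norm_gauss m hx hxR
    _ = _ := by ring

theorem exists_norm_kernelFun_mul_truncVec_le {m : ℂ} (hm : -1 < m.re) (f : L2) (R : ℝ) :
    ∃ C : ℝ, 0 ≤ C ∧ ∀ᵐ x ∂μ, ∀ k, 0 < k → ‖kernelFun m (k * x) * truncVec R f x‖ ≤
      C * (k ^ (m.re + 1 / 2) * Real.exp ((k * R / 2) ^ 2)) *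
        (‖gauss m 0 x‖ * ‖truncVec R f x‖) := by
  obtain ⟨C, hC0, hC⟩ := exists_norm_kernelFun_mul_le hm R
  refine ⟨C, hC0, ?_⟩
  filter_upwards [coeFn_truncVec R f, ae_restrict_mem measurableSet_Ioi] with x htrunc hx k hk
  rw [norm_mul, ← mul_assoc]
  by_cases hxR : x ≤ R
  · gcongr
    exact hC k x hk hx hxR
  · rw [htrunc, Set.indicator_of_notMem (by simpa using hxR)]
    simp

theorem integrable_norm_gauss_mul_norm {m : ℂ} (hm : -1 < m.re) (f : L2) :
    Integrable (fun x => ‖gauss m 0 x‖ * ‖f x‖) μ := by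
  simpa using ((memLp_gauss hm 0).integrable_mul (Lp.memLp f)).norm

theorem integrable_kernelFun_mul_truncVec {m : ℂ} (hm : -1 < m.re) (f : L2) (R : ℝ) {k : ℝ}
    (hk : 0 < k) : Integrable (fun x => kernelFun m (k * x) * truncVec R f x) μ := by
  obtain ⟨C, -, hC⟩ := exists_norm_kernelFun_mul_truncVec_le hm f R
  refine ((integrable_norm_gauss_mul_norm hm (truncVec R f)).const_mul _).mono' ?_
    (hC.mono fun x hx => hx k hk)
  exact (((measurable_kernelFun hm).comp (measurable_const_mul k)).aestronglyMeasurable).mul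
    (Lp.aestronglyMeasurable _)

theorem integrable_kernelFun_mul_gauss_prod {m : ℂ} (hm : -1 < m.re) (f : L2) {R u : ℝ}
    (hu : R ^ 2 + 2 ≤ Real.exp u) :
    Integrable (fun p : ℝ × ℝ => kernelFun m (p.1 * p.2) * truncVec R f p.2 * gauss m u p.1)
      (μ.prod μ) := by
  obtain ⟨C, hC0, hC⟩ := exists_norm_kernelFun_mul_truncVec_le hm f R
  refine (((integrable_norm_gauss_sq hm 0).const_mul (C * Real.exp ((m.re + 1) * u / 2))).mul_prod
    (integrable_norm_gauss_mul_norm hm (truncVec R f))).mono' ?_ ?_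
  · exact (((measurable_kernelFun hm).comp (by fun_prop)).aestronglyMeasurable.mul
      (Lp.aestronglyMeasurable (truncVec R f)).comp_snd).mul
      (aestronglyMeasurable_gauss m u).comp_fst
  · filter_upwards [Measure.quasiMeasurePreserving_snd.ae hC,
      Measure.quasiMeasurePreserving_fst.ae (ae_restrict_mem measurableSet_Ioi)]
      with p hp (hk : 0 < p.1)
    rw [norm_mul]
    calc _ ≤ C * (p.1 ^ (m.re + 1 / 2) * Real.exp ((p.1 * R / 2) ^ 2)) *
          (‖gauss m 0 p.2‖ * ‖truncVec R f p.2‖) * ‖gauss m u p.1‖ := by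
          gcongr
          exact hp p.1 hk
      _ = C * (p.1 ^ (m.re + 1 / 2) * Real.exp ((p.1 * R / 2) ^ 2) * ‖gauss m u p.1‖) *
          (‖gauss m 0 p.2‖ * ‖truncVec R f p.2‖) := by ring
      _ ≤ C * (Real.exp ((m.re + 1) * u / 2) * ‖gauss m 0 p.1‖ ^ 2) *
          (‖gauss m 0 p.2‖ * ‖truncVec R f p.2‖) := by
          gcongr C * ?_ * _
          exact rpow_mul_exp_mul_norm_gauss_le m hu hk
      _ = _ := by ring

theorem kernelFun_mul_truncVec_ae_eq (m : ℂ) (f : L2) (R : ℝ) {k : ℝ} (hk : 0 < k) :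
    (fun x => kernelFun m (k * x) * truncVec R f x) =ᵐ[μ]
      (Set.Iic R).indicator fun x => hankelKernel m k x * f x := by
  filter_upwards [coeFn_truncVec R f, ae_restrict_mem measurableSet_Ioi] with x htrunc hx
  by_cases hxR : x ∈ Set.Iic R <;> simp [htrunc, hxR, hankelKernel_eq_kernelFun m hk hx]

theorem restrict_Iic (R : ℝ) : μ.restrict (Set.Iic R) = volume.restrict (Set.Ioc 0 R) := by
  rw [Measure.restrict_restrict measurableSet_Iic, Set.inter_comm, Set.Ioi_inter_Iic]

theorem hankelTrunc_eq_integral_kernelFun (m : ℂ) (f : L2) (R : ℝ) {k : ℝ} (hk : 0 < k) :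
    hankelTrunc m f R k = ∫ x, kernelFun m (k * x) * truncVec R f x ∂μ := by
  rw [integral_congr_ae (kernelFun_mul_truncVec_ae_eq m f R hk),
    integral_indicator measurableSet_Iic, restrict_Iic, hankelTrunc]

theorem integral_kernelFun_truncVec_mul_gauss {m : ℂ} (hm : -1 < m.re) (f : L2) {R u : ℝ}
    (hu : R ^ 2 + 2 ≤ Real.exp u) :
    ∫ k, (∫ x, kernelFun m (k * x) * truncVec R f x ∂μ) * gauss m u k ∂μ =
      ∫ k, hankel hm (truncVec R f) k * gauss m u k ∂μ := by
  have hpair : ∫ k, hankel hm (truncVec R f) k * gauss m u k ∂μ =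
      ∫ x, truncVec R f x * gauss m (-u) x ∂μ := by
    rw [← pair_toLp _ (memLp_gauss hm u), ← pair_toLp _ (memLp_gauss hm (-u))]
    change pair _ (gaussVec hm u) = pair _ (gaussVec hm (-u))
    rw [pair_hankel, hankel_gaussVec]
  have hswap := integral_integral_swap
    (f := fun k x => kernelFun m (k * x) * truncVec R f x * gauss m u k)
    (integrable_kernelFun_mul_gauss_prod hm f hu)
  simp only [integral_mul_const] at hswap
  rw [hpair, hswap]
  refine integral_congr_ae ?_
  filter_upwards [coeFn_truncVec R f, ae_restrict_mem measurableSet_Ioi] with x htrunc hx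
  have hx : 0 < x := hx
  by_cases hxR : x ≤ R
  · rw [← integral_kernelFun_mul_gauss hm hx (u := u)
      ((by gcongr : x ^ 2 + 2 ≤ R ^ 2 + 2).trans hu), ← integral_const_mul]
    refine integral_congr_ae (ae_of_all _ fun k => ?_)
    ring
  · rw [htrunc, Set.indicator_of_notMem (by simpa using hxR)]
    simp

theorem hankelTrunc_ae_eq {m : ℂ} (hm : -1 < m.re) (f : L2) (R : ℝ) :
    hankelTrunc m f R =ᵐ[μ] hankel hm (truncVec R f) := by
  have hle : ∀ u, Real.log (R ^ 2 + 2) ≤ u → R ^ 2 + 2 ≤ Real.exp u := fun u hu =>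
    (Real.log_le_iff_le_exp (by positivity)).1 hu
  set G : ℝ → ℂ := fun k => ∫ x, kernelFun m (k * x) * truncVec R f x ∂μ
  have hGint : ∀ u, Real.log (R ^ 2 + 2) ≤ u → Integrable (fun k => G k * gauss m u k) μ := by
    intro u hu
    simpa only [integral_mul_const] using
      (integrable_kernelFun_mul_gauss_prod hm f (hle u hu)).integral_prod_left
  have hFint : ∀ u, Integrable (fun k => hankel hm (truncVec R f) k * gauss m u k) μ := fun u =>
    (Lp.memLp _).integrable_mul (memLp_gauss hm u)
  have hzero := ae_eq_zero_of_integral_gauss (f := fun k => G k - hankel hm (truncVec R f) k) m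
    (Real.log (R ^ 2 + 2))
    (by simpa only [sub_mul] using! (hGint _ le_rfl).sub (hFint _))
    (fun u hu => by
      simp only [sub_mul]
      rw [integral_sub (hGint u hu) (hFint u), sub_eq_zero]
      exact integral_kernelFun_truncVec_mul_gauss hm f (hle u hu))
  filter_upwards [hzero, ae_restrict_mem measurableSet_Ioi] with k hk hk0
  rw [hankelTrunc_eq_integral_kernelFun m f R hk0]
  exact sub_eq_zero.1 hk

theorem isHankelTransform_hankel {m : ℂ} (hm : -1 < m.re) : IsHankelTransform m (hankel hm) where
  integrable f R k _ hk := by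
    have := (integrable_kernelFun_mul_truncVec hm f R hk).congr
      (kernelFun_mul_truncVec_ae_eq m f R hk)
    rwa [integrable_indicator_iff measurableSet_Iic, IntegrableOn, restrict_Iic] at this
  memLp f R _ := (Lp.memLp _).ae_eq (hankelTrunc_ae_eq hm f R).symm
  tendsto f := by
    have hnorm : ∀ R, eLpNorm (fun k => hankelTrunc m f R k - hankel hm f k) 2 μ =
        ‖hankel hm (truncVec R f) - hankel hm f‖ₑ := by
      intro R
      rw [Lp.enorm_def]
      exact eLpNorm_congr_ae (((hankelTrunc_ae_eq hm f R).sub (ae_eq_refl _)).trans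
        (Lp.coeFn_sub _ _).symm)
    simp only [hnorm]
    have hlim := (((hankel hm).continuous.tendsto f).comp (tendsto_truncVec f)).sub_const
      (hankel hm f)
    simpa using hlim.enorm

/-! ### The Schrödinger expression on power functions -/

theorem hasDerivAt_ofReal_cpow (b : ℂ) {x : ℝ} (hx : 0 < x) :
    HasDerivAt (fun y : ℝ => (y : ℂ) ^ b) (b * (x : ℂ) ^ b / x) x := by
  have hxc : (x : ℂ) ≠ 0 := by exact_mod_cast hx.ne'
  have h := ((hasDerivAt_id (x : ℂ)).cpow_const (c := b)
    (Complex.ofReal_mem_slitPlane.2 hx)).comp_ofReal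
  refine h.congr_deriv ?_
  simp only [id]
  rw [Complex.cpow_sub _ _ hxc, Complex.cpow_one]
  ring

theorem contDiffAt_ofReal_cpow (b : ℂ) {x : ℝ} (hx : 0 < x) :
    ContDiffAt ℝ ∞ (fun y : ℝ => (y : ℂ) ^ b) x := by
  have hexp : ContDiffAt ℝ ∞ (fun y : ℝ => Complex.exp ((Real.log y : ℂ) * b)) x := by
    refine Complex.contDiff_exp.contDiffAt.comp x (ContDiffAt.mul ?_ contDiffAt_const)
    exact Complex.ofRealCLM.contDiff.contDiffAt.comp x (Real.contDiffAt_log.2 hx.ne')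
  refine hexp.congr_of_eventuallyEq ?_
  filter_upwards [Ioi_mem_nhds hx] with y hy
  have hy : 0 < y := hy
  rw [Complex.cpow_def_of_ne_zero (by exact_mod_cast hy.ne'), Complex.ofReal_log hy.le]

theorem contDiffAt_powMul (b : ℂ) {q : ℝ → ℝ} (hq : ContDiff ℝ ∞ q) {x : ℝ} (hx : 0 < x) :
    ContDiffAt ℝ ∞ (powMul b q) x :=
  (contDiffAt_ofReal_cpow b hx).mul (Complex.ofRealCLM.contDiff.comp hq).contDiffAt

theorem hasDerivAt_const_div_ofReal (c : ℂ) {x : ℝ} (hx : x ≠ 0) :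
    HasDerivAt (fun y : ℝ => c / (y : ℂ)) (-c / (x : ℂ) ^ 2) x := by
  refine ((hasDerivAt_const (x : ℂ) c).div (hasDerivAt_id _)
    (Complex.ofReal_ne_zero.2 hx)).comp_ofReal.congr_deriv ?_
  simp

theorem hasDerivAt_powMul (b : ℂ) {q : ℝ → ℝ} {q' x : ℝ} (hq : HasDerivAt q q' x) (hx : 0 < x) :
    HasDerivAt (powMul b q) ((x : ℂ) ^ b * (b / x * q x + q')) x := by
  refine ((hasDerivAt_ofReal_cpow b hx).mul hq.ofReal_comp).congr_deriv ?_
  ring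

theorem schrodinger_powMul (m : ℂ) {q : ℝ → ℝ} (hq : ContDiff ℝ ∞ q) {x : ℝ} (hx : 0 < x) :
    schrodinger (m ^ 2) (powMul (m + 1 / 2) q) x =
      (x : ℂ) ^ (m + 1 / 2) *
        (-(2 * (m + 1 / 2)) / x * (deriv q x : ℝ) - (deriv (deriv q) x : ℝ)) := by
  have hxc : (x : ℂ) ≠ 0 := Complex.ofReal_ne_zero.2 hx.ne'
  have hdq : ∀ y, HasDerivAt q (deriv q y) y := fun y =>
    (hq.differentiable (by simp) y).hasDerivAt
  have hddq : HasDerivAt (deriv q) (deriv (deriv q) x) x :=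
    ((hq.iterate_deriv 1).differentiable (by simp) x).hasDerivAt
  set b := m + 1 / 2 with hb
  have hfirst : deriv (powMul b q) =ᶠ[𝓝 x]
      fun y => (y : ℂ) ^ b * (b / y * q y + deriv q y) := by
    filter_upwards [Ioi_mem_nhds hx] with y hy
    exact (hasDerivAt_powMul b (hdq y) hy).deriv
  have hsecond : HasDerivAt (fun y : ℝ => (y : ℂ) ^ b * (b / y * q y + deriv q y))
      (b * (x : ℂ) ^ b / x * (b / x * q x + deriv q x) + (x : ℂ) ^ b *
        ((-b / x ^ 2 * q x + b / x * deriv q x) + deriv (deriv q) x)) x := by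
    exact (hasDerivAt_ofReal_cpow b hx).mul (((hasDerivAt_const_div_ofReal b hx.ne').mul
      (hdq x).ofReal_comp).add hddq.ofReal_comp)
  rw [schrodinger, hfirst.deriv_eq, hsecond.deriv, powMul]
  have hm : m = b - 1 / 2 := by rw [hb]; ring
  rw [hm]
  field_simp
  ring

theorem hasDerivAt_gaussReal (u x : ℝ) :
    HasDerivAt (gaussReal u) (-(Real.exp u * x) * gaussReal u x) x := by
  have h : HasDerivAt (fun x : ℝ => -(Real.exp u * x ^ 2 / 2)) (-(Real.exp u * x)) x := by
    refine ((((hasDerivAt_pow 2 x).const_mul (Real.exp u)).div_const 2).neg).congr_deriv ?_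
    simp
    ring
  refine h.exp.congr_deriv ?_
  rw [gaussReal]
  ring

theorem deriv_gaussReal (u : ℝ) :
    deriv (gaussReal u) = fun x => -(Real.exp u * x) * gaussReal u x :=
  funext fun x => (hasDerivAt_gaussReal u x).deriv

theorem deriv_deriv_gaussReal (u x : ℝ) : deriv (deriv (gaussReal u)) x =
    (Real.exp u ^ 2 * x ^ 2 - Real.exp u) * gaussReal u x := by
  rw [deriv_gaussReal]
  have hlin : HasDerivAt (fun x : ℝ => -(Real.exp u * x)) (-Real.exp u) x := by
    simpa using ((hasDerivAt_id x).const_mul (Real.exp u)).fun_neg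
  refine ((hlin.fun_mul (hasDerivAt_gaussReal u x)).deriv).trans ?_
  ring

/-! ### Approximation by test functions -/

theorem schrodinger_congr {α : ℂ} {f g : ℝ → ℂ} {x : ℝ} (h : f =ᶠ[𝓝 x] g) :
    schrodinger α f x = schrodinger α g x := by
  rw [schrodinger, schrodinger, h.deriv.deriv_eq, h.eq_of_nhds]

theorem exists_abs_deriv_bump_le (Θ : ContDiffBump (0 : ℝ)) :
    ∃ M, (∀ y, |deriv Θ y| ≤ M) ∧ ∀ y, |deriv (deriv Θ) y| ≤ M := by
  have hΘ : ContDiff ℝ ∞ Θ := Θ.contDiff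
  obtain ⟨M₁, hM₁⟩ := Θ.hasCompactSupport.deriv.exists_bound_of_continuous
    (hΘ.continuous_deriv (by simp))
  obtain ⟨M₂, hM₂⟩ := Θ.hasCompactSupport.deriv.deriv.exists_bound_of_continuous
    ((hΘ.iterate_deriv 1).continuous_deriv (by simp))
  exact ⟨max M₁ M₂, fun y => (hM₁ y).trans (le_max_left ..),
    fun y => (hM₂ y).trans (le_max_right ..)⟩

/-- The function `w` cut off near `0` and `∞` by `Θ (r log x)`, which is the localization adapted
to dilations: as `r → 0`, each derivative of the cutoff gains a factor `r / x`. -/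
def logCutoff (Θ : ContDiffBump (0 : ℝ)) (r : ℝ) (w : ℝ → ℂ) (x : ℝ) : ℂ :=
  if 0 < x then (Θ (r * Real.log x) : ℂ) * w x else 0

theorem hasDerivAt_comp_mul_log {χ : ℝ → ℝ} (hχ : Differentiable ℝ χ) (r : ℝ) {x : ℝ}
    (hx : 0 < x) : HasDerivAt (fun y => (χ (r * Real.log y) : ℂ))
      ((deriv χ (r * Real.log x) : ℝ) * (r / x)) x := by
  refine ((hχ _).hasDerivAt.comp x
    ((Real.hasDerivAt_log hx.ne').const_mul r)).ofReal_comp.congr_deriv ?_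
  push_cast
  ring

section LogCutoff

variable (Θ : ContDiffBump (0 : ℝ))

theorem logCutoff_eventuallyEq (r : ℝ) (w : ℝ → ℂ) {x : ℝ} (hx : 0 < x) :
    logCutoff Θ r w =ᶠ[𝓝 x] fun y => (Θ (r * Real.log y) : ℂ) * w y := by
  filter_upwards [Ioi_mem_nhds hx] with y hy
  exact if_pos hy

theorem support_logCutoff_subset {r : ℝ} (hr : 0 < r) (w : ℝ → ℂ) :
    Function.support (logCutoff Θ r w) ⊆
      Set.Icc (Real.exp (-(Θ.rOut / r))) (Real.exp (Θ.rOut / r)) := by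
  intro x hx
  have hx0 : 0 < x := by
    by_contra h
    exact hx (if_neg h)
  have hlog : |r * Real.log x| < Θ.rOut := by
    by_contra! h
    exact hx (by simp [logCutoff, Θ.zero_of_le_dist (x := r * Real.log x) (by simpa using! h)])
  rw [abs_mul, abs_of_pos hr, mul_comm, ← lt_div_iff₀ hr, abs_lt] at hlog
  exact ⟨((Real.lt_log_iff_exp_lt hx0).1 hlog.1).le, ((Real.log_lt_iff_lt_exp hx0).1 hlog.2).le⟩

theorem isTest_logCutoff {r : ℝ} (hr : 0 < r) {w : ℝ → ℂ}
    (hw : ∀ x, 0 < x → ContDiffAt ℝ ∞ w x) : IsTest (logCutoff Θ r w) := by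
  have hsupp := support_logCutoff_subset Θ hr w
  have hpos : tsupport (logCutoff Θ r w) ⊆ Set.Ioi 0 := fun x hx =>
    (Real.exp_pos _).trans_le (closure_minimal hsupp isClosed_Icc hx).1
  refine ⟨contDiff_iff_contDiffAt.2 fun x => ?_,
    HasCompactSupport.of_support_subset_isCompact isCompact_Icc hsupp, hpos⟩
  by_cases hx : 0 < x
  · refine ContDiffAt.congr_of_eventuallyEq ?_ (logCutoff_eventuallyEq Θ r w hx)
    refine ContDiffAt.mul (Complex.ofRealCLM.contDiff.contDiffAt.comp x ?_) (hw x hx)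
    exact Θ.contDiff.contDiffAt.comp x (contDiffAt_const.mul (Real.contDiffAt_log.2 hx.ne'))
  · exact contDiffAt_const.congr_of_eventuallyEq
      (notMem_tsupport_iff_eventuallyEq.1 fun h => hx (hpos h))

theorem schrodinger_logCutoff {α : ℂ} (r : ℝ) {w : ℝ → ℂ}
    (hw : ∀ x, 0 < x → ContDiffAt ℝ ∞ w x) {x : ℝ} (hx : 0 < x) :
    schrodinger α (logCutoff Θ r w) x = Θ (r * Real.log x) * schrodinger α w x -
      2 * r * (deriv Θ (r * Real.log x) : ℝ) * (deriv w x / x) -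
      (r ^ 2 * (deriv (deriv Θ) (r * Real.log x) : ℝ) - r * (deriv Θ (r * Real.log x) : ℝ)) *
        (w x / x ^ 2) := by
  have hxc : (x : ℂ) ≠ 0 := Complex.ofReal_ne_zero.2 hx.ne'
  have hΘ : ContDiff ℝ ∞ Θ := Θ.contDiff
  have hdΘ : Differentiable ℝ Θ := hΘ.differentiable (by simp)
  have hddΘ : Differentiable ℝ (deriv Θ) := (hΘ.iterate_deriv 1).differentiable (by simp)
  have hdw : ∀ y, 0 < y → HasDerivAt w (deriv w y) y := fun y hy =>
    ((hw y hy).differentiableAt (by simp)).hasDerivAt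
  have hddw : HasDerivAt (deriv w) (deriv (deriv w) x) x :=
    ((contDiffAt_deriv hw x hx).differentiableAt (by simp)).hasDerivAt
  have hfirst : deriv (fun y => (Θ (r * Real.log y) : ℂ) * w y) =ᶠ[𝓝 x] fun y =>
      ((deriv Θ (r * Real.log y) : ℝ) : ℂ) * (r / y) * w y + Θ (r * Real.log y) * deriv w y := by
    filter_upwards [Ioi_mem_nhds hx] with y hy
    exact ((hasDerivAt_comp_mul_log hdΘ r hy).fun_mul (hdw y hy)).deriv
  have hsecond := ((((hasDerivAt_comp_mul_log hddΘ r hx).fun_mul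
    (hasDerivAt_const_div_ofReal r hx.ne')).fun_mul (hdw x hx)).fun_add
    ((hasDerivAt_comp_mul_log hdΘ r hx).fun_mul hddw)).deriv
  rw [schrodinger_congr (logCutoff_eventuallyEq Θ r w hx), schrodinger, schrodinger,
    hfirst.deriv_eq, hsecond]
  field_simp
  ring

theorem norm_mul_sub_self_le (y : ℝ) (z : ℂ) : ‖(Θ y : ℂ) * z - z‖ ≤ ‖z‖ := by
  rw [← sub_one_mul, norm_mul, ← Complex.ofReal_one, ← Complex.ofReal_sub, Complex.norm_real]
  refine mul_le_of_le_one_left (norm_nonneg _) (abs_le.2 ⟨?_, ?_⟩)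
  · linarith [Θ.nonneg (x := y)]
  · linarith [Θ.le_one (x := y)]

theorem norm_logCutoff_sub_le (r : ℝ) (w : ℝ → ℂ) {x : ℝ} (hx : 0 < x) :
    ‖logCutoff Θ r w x - w x‖ ≤ ‖w x‖ := by
  rw [logCutoff, if_pos hx]
  exact norm_mul_sub_self_le Θ _ _

theorem norm_schrodinger_logCutoff_sub_le {α : ℂ} {M : ℝ} (hM : ∀ y, |deriv Θ y| ≤ M)
    (hM' : ∀ y, |deriv (deriv Θ) y| ≤ M) {r : ℝ} (hr : 0 < r) (hr1 : r ≤ 1) {w : ℝ → ℂ}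
    (hw : ∀ x, 0 < x → ContDiffAt ℝ ∞ w x) {x : ℝ} (hx : 0 < x) :
    ‖schrodinger α (logCutoff Θ r w) x - schrodinger α w x‖ ≤
      ‖schrodinger α w x‖ + 2 * M * ‖deriv w x / x‖ + 2 * M * ‖w x / (x : ℂ) ^ 2‖ := by
  have : 0 ≤ M := (abs_nonneg _).trans (hM 0)
  set y := r * Real.log x
  have hfirst : ‖(2 * r * (deriv Θ y : ℝ) : ℂ)‖ ≤ 2 * M := by
    rw [norm_mul, norm_mul, Complex.norm_real, Complex.norm_real, Real.norm_of_nonneg hr.le,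
      Complex.norm_ofNat, Real.norm_eq_abs]
    calc 2 * r * |deriv Θ y| ≤ 2 * 1 * M := by gcongr; exact hM y
      _ = 2 * M := by ring
  have hsecond : ‖(r ^ 2 * (deriv (deriv Θ) y : ℝ) - r * (deriv Θ y : ℝ) : ℂ)‖ ≤ 2 * M := by
    refine (norm_sub_le _ _).trans ?_
    rw [norm_mul, norm_mul, norm_pow, Complex.norm_real, Complex.norm_real, Complex.norm_real,
      Real.norm_of_nonneg hr.le, Real.norm_eq_abs, Real.norm_eq_abs]
    calc r ^ 2 * |deriv (deriv Θ) y| + r * |deriv Θ y| ≤ 1 * M + 1 * M := by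
          gcongr
          exacts [pow_le_one₀ hr.le hr1, hM' y, hM y]
      _ = 2 * M := by ring
  rw [schrodinger_logCutoff Θ r hw hx]
  calc _ = ‖(Θ y * schrodinger α w x - schrodinger α w x) -
          2 * r * (deriv Θ y : ℝ) * (deriv w x / x) -
          (r ^ 2 * (deriv (deriv Θ) y : ℝ) - r * (deriv Θ y : ℝ)) * (w x / x ^ 2)‖ := by
        congr 1
        ring
    _ ≤ _ := by
        refine (norm_sub_le _ _).trans (add_le_add ((norm_sub_le _ _).trans (add_le_add
          (norm_mul_sub_self_le Θ _ _) ?_)) ?_)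
        · rw [norm_mul]
          gcongr
        · rw [norm_mul]
          gcongr

theorem eventually_logCutoff_eventuallyEq_self {ι : Type*} {l : Filter ι} {r : ι → ℝ}
    (hr : Tendsto r l (𝓝 0)) (w : ℝ → ℂ) {x : ℝ} (hx : 0 < x) :
    ∀ᶠ n in l, logCutoff Θ (r n) w =ᶠ[𝓝 x] w := by
  have hlim : Tendsto (fun n => r n * Real.log x) l (𝓝 0) := by
    simpa using hr.mul_const (Real.log x)
  filter_upwards [hlim.eventually (Metric.ball_mem_nhds 0 Θ.rIn_pos)] with n hn
  have hcont : ContinuousAt (fun y => r n * Real.log y) x :=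
    continuousAt_const.mul (Real.continuousAt_log hx.ne')
  filter_upwards [logCutoff_eventuallyEq Θ (r n) w hx,
    hcont.eventually (Θ.eventuallyEq_one_of_mem_ball hn)] with y hcut hone
  rw [hcut, hone]
  simp

end LogCutoff

theorem mem_closure_coreGraph {α : ℂ} {w : ℝ → ℂ} (hw : ∀ x, 0 < x → ContDiffAt ℝ ∞ w x)
    (hw2 : MemLp w 2 μ) (hdw : MemLp (fun x => deriv w x / x) 2 μ)
    (hwx : MemLp (fun x => w x / (x : ℂ) ^ 2) 2 μ) (hLw : MemLp (schrodinger α w) 2 μ) :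
    (hw2.toLp w, hLw.toLp _) ∈ (coreGraph α).topologicalClosure := by
  let Θ : ContDiffBump (0 : ℝ) := default
  obtain ⟨M, hM, hM'⟩ := exists_abs_deriv_bump_le Θ
  set r : ℕ → ℝ := fun n => 1 / ((n : ℝ) + 1)
  have hr : ∀ n, 0 < r n := fun n => by positivity
  have hr1 : ∀ n, r n ≤ 1 := fun n =>
    (div_le_one (by positivity)).2 (by linarith [n.cast_nonneg (α := ℝ)])
  have htest : ∀ n, IsTest (logCutoff Θ (r n) w) := fun n => isTest_logCutoff Θ (hr n) hw
  have hLtest := fun n => IsTest.schrodinger α _ (htest n)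
  have hself : ∀ x, 0 < x → ∀ᶠ n in atTop, logCutoff Θ (r n) w =ᶠ[𝓝 x] w := fun x hx =>
    eventually_logCutoff_eventuallyEq_self Θ tendsto_one_div_add_atTop_nhds_zero_nat w hx
  have hfst : Tendsto (fun n => (htest n).memLp.toLp _) atTop (𝓝 (hw2.toLp w)) := by
    refine tendsto_toLp_of_dominated ENNReal.ofNat_ne_top (fun n => (htest n).memLp) hw2 hw2.norm
      (Eventually.of_forall fun n => ?_) ?_ <;>
    filter_upwards [ae_restrict_mem measurableSet_Ioi] with x hx
    · exact norm_logCutoff_sub_le Θ _ _ hx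
    · exact tendsto_const_nhds.congr' ((hself x hx).mono fun n hn => hn.eq_of_nhds.symm)
  have hsnd : Tendsto (fun n => (hLtest n).memLp.toLp _) atTop (𝓝 (hLw.toLp _)) := by
    refine tendsto_toLp_of_dominated ENNReal.ofNat_ne_top (fun n => (hLtest n).memLp) hLw
      ((hLw.norm.add (hdw.norm.const_mul (2 * M))).add (hwx.norm.const_mul (2 * M)))
      (Eventually.of_forall fun n => ?_) ?_ <;>
    filter_upwards [ae_restrict_mem measurableSet_Ioi] with x hx
    · exact norm_schrodinger_logCutoff_sub_le Θ hM hM' (hr n) (hr1 n) hw hx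
    · exact tendsto_const_nhds.congr' ((hself x hx).mono fun n hn => (schrodinger_congr hn).symm)
  exact mem_closure_of_tendsto (hfst.prodMk_nhds hsnd) (Eventually.of_forall fun n =>
    ⟨_, htest n, (htest n).memLp.coeFn_toLp, (hLtest n).memLp.coeFn_toLp⟩)

/-! ### Gaussians and cutoffs -/

theorem gaussReal_le_one (u x : ℝ) : gaussReal u x ≤ 1 := by
  rw [gaussReal, Real.exp_le_one_iff, neg_nonpos]
  positivity

theorem pow_mul_gaussReal_isBigO {u v : ℝ} (hvu : v < u) (p : ℕ) :
    (fun x => x ^ p * gaussReal u x) =O[⊤] gaussReal v := by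
  set c := (Real.exp u - Real.exp v) / 2 with hc
  have hc0 : 0 < c := half_pos (sub_pos.2 (Real.exp_lt_exp.2 hvu))
  refine Asymptotics.isBigO_top.2 ⟨1 + p.factorial / c ^ p, fun x => ?_⟩
  have hsplit : gaussReal v x = gaussReal u x * Real.exp (c * x ^ 2) := by
    rw [gaussReal, gaussReal, ← Real.exp_add, hc]
    congr 1
    ring
  have hexp : (x ^ p) ^ 2 ≤ p.factorial / c ^ p * Real.exp (c * x ^ 2) := by
    have := Real.pow_div_factorial_le_exp (c * x ^ 2) (by positivity) p
    rw [mul_pow, pow_right_comm, div_le_iff₀ (by positivity)] at this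
    rw [div_mul_eq_mul_div, le_div_iff₀ (by positivity)]
    linarith
  have hpow : |x ^ p| ≤ (1 + p.factorial / c ^ p) * Real.exp (c * x ^ 2) := by
    have : 1 ≤ Real.exp (c * x ^ 2) := Real.one_le_exp (by positivity)
    nlinarith [sq_abs (x ^ p), sq_nonneg (|x ^ p| - 1)]
  rw [norm_mul, Real.norm_of_nonneg (gaussReal_pos u x).le,
    Real.norm_of_nonneg (gaussReal_pos v x).le, hsplit, Real.norm_eq_abs]
  nlinarith [mul_le_mul_of_nonneg_right hpow (gaussReal_pos u x).le]

theorem isBigO_gaussReal_of_hasCompactSupport {χ : ℝ → ℝ} (hχ : Continuous χ)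
    (hs : HasCompactSupport χ) (u : ℝ) : χ =O[⊤] gaussReal u := by
  obtain ⟨C, hC⟩ := (hs.mul_right (f' := (gaussReal u)⁻¹)).exists_bound_of_continuous
    (hχ.mul ((contDiff_gaussReal u).continuous.inv₀ fun x => (gaussReal_pos u x).ne'))
  refine Asymptotics.isBigO_top.2 ⟨C, fun x => ?_⟩
  have h := hC x
  rwa [Pi.mul_apply, Pi.inv_apply, norm_mul, norm_inv, ← div_eq_mul_inv,
    div_le_iff₀ (norm_pos_iff.2 (gaussReal_pos u x).ne')] at h

theorem isBigO_pow_succ_mul_gaussReal {q : ℝ → ℝ} (hq : Differentiable ℝ q) (h0 : q 0 = 0)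
    {p : ℕ} {u : ℝ} (hdq : deriv q =O[⊤] fun x => x ^ p * gaussReal u x)
    (hqu : q =O[⊤] gaussReal u) : q =O[⊤] fun x => x ^ (p + 1) * gaussReal u x := by
  obtain ⟨C, hC, hdq⟩ := hdq.exists_nonneg
  obtain ⟨D, hD, hqu⟩ := hqu.exists_nonneg
  rw [Asymptotics.isBigOWith_top] at hdq hqu
  have hε : 0 < gaussReal u 1 := gaussReal_pos u 1
  refine Asymptotics.isBigO_top.2 ⟨C / gaussReal u 1 + D, fun x => ?_⟩
  rw [norm_mul, norm_pow, Real.norm_of_nonneg (gaussReal_pos u x).le]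
  rcases le_total |x| 1 with hx | hx
  · have hε_le : gaussReal u 1 ≤ gaussReal u x := by
      have : x ^ 2 ≤ 1 ^ 2 := sq_le_sq.2 (by simpa using hx)
      unfold gaussReal
      gcongr
    have hbound : ∀ y ∈ Metric.closedBall (0 : ℝ) |x|, ‖deriv q y‖ ≤ C * |x| ^ p := by
      intro y hy
      have hy : |y| ≤ |x| := by simpa using hy
      refine (hdq y).trans ?_
      rw [norm_mul, norm_pow, Real.norm_of_nonneg (gaussReal_pos u y).le]
      have := mul_le_mul (pow_le_pow_left₀ (abs_nonneg y) hy p) (gaussReal_le_one u y)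
        (gaussReal_pos u y).le (by positivity)
      rw [mul_one] at this
      exact mul_le_mul_of_nonneg_left this hC
    have hmean := (convex_closedBall (0 : ℝ) |x|).norm_image_sub_le_of_norm_deriv_le
      (fun y _ => hq y) hbound (x := 0) (y := x) (by simp) (by simp)
    rw [h0, sub_zero, sub_zero] at hmean
    calc ‖q x‖ ≤ C * |x| ^ p * |x| := hmean
      _ = C / gaussReal u 1 * (|x| ^ (p + 1) * gaussReal u 1) := by rw [pow_succ]; field_simp
      _ ≤ (C / gaussReal u 1 + D) * (|x| ^ (p + 1) * gaussReal u x) := by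
        gcongr
        linarith
  · calc ‖q x‖ ≤ D * ‖gaussReal u x‖ := hqu x
      _ = D * (1 * gaussReal u x) := by rw [Real.norm_of_nonneg (gaussReal_pos u x).le, one_mul]
      _ ≤ (C / gaussReal u 1 + D) * (|x| ^ (p + 1) * gaussReal u x) := by
        have := (gaussReal_pos u x).le
        gcongr
        · exact le_add_of_nonneg_left (by positivity)
        · exact one_le_pow₀ hx

theorem memLp_cpow_mul_div_of_isBigO {m : ℂ} (hm : -1 < m.re) {q : ℝ → ℝ} (hq : Continuous q)
    {p : ℕ} {u : ℝ} (h : q =O[⊤] fun x => x ^ p * gaussReal u x) :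
    MemLp (fun x : ℝ => (x : ℂ) ^ (m + 1 / 2) * ((q x : ℂ) / (x : ℂ) ^ p)) 2 μ := by
  obtain ⟨C, hC⟩ := Asymptotics.isBigO_top.1 h
  set d := Complex.exp ((m + 1) * u / 2) with hd_def
  refine MemLp.of_le_mul (c := C / ‖d‖) (memLp_gauss hm u) ?_ ?_
  · refine ContinuousOn.aestronglyMeasurable (fun x hx => ?_) measurableSet_Ioi
    have hx : x ≠ 0 := ne_of_gt hx
    refine ((contDiffAt_ofReal_cpow _ ‹_›).continuousAt.mul (.div ?_ ?_ ?_)).continuousWithinAt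
    · exact (Complex.continuous_ofReal.comp hq).continuousAt
    · exact (Complex.continuous_ofReal.pow p).continuousAt
    · exact pow_ne_zero p (Complex.ofReal_ne_zero.2 hx)
  · filter_upwards [ae_restrict_mem measurableSet_Ioi] with x hx
    have hx : 0 < x := hx
    have hqx : ‖(q x : ℂ) / (x : ℂ) ^ p‖ ≤ C * gaussReal u x := by
      have := hC x
      rw [norm_mul, Real.norm_of_nonneg (gaussReal_pos u x).le, norm_pow,
        Real.norm_of_nonneg hx.le] at this
      rw [norm_div, norm_pow, Complex.norm_real, Complex.norm_real, Real.norm_of_nonneg hx.le,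
        div_le_iff₀ (by positivity)]
      linarith
    have hd : 0 < ‖d‖ := norm_pos_iff.2 (Complex.exp_ne_zero _)
    rw [gauss, powMul, ← hd_def, norm_mul, norm_mul, norm_mul, Complex.norm_real (gaussReal u x),
      Real.norm_of_nonneg (gaussReal_pos u x).le]
    calc _ ≤ ‖(x : ℂ) ^ (m + 1 / 2)‖ * (C * gaussReal u x) := by gcongr
      _ = _ := by field_simp

theorem memLp_powMul_of_isBigO {m : ℂ} (hm : -1 < m.re) {q : ℝ → ℝ} (hq : Continuous q) {u : ℝ}
    (h : q =O[⊤] gaussReal u) : MemLp (powMul (m + 1 / 2) q) 2 μ := by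
  have := memLp_cpow_mul_div_of_isBigO hm hq (p := 0) (u := u)
    (by simpa only [pow_zero, one_mul] using h)
  simp only [pow_zero, div_one] at this
  exact this

theorem IsCutoff.memLp {m : ℂ} (hm : -1 < m.re) {ξ : ℝ → ℝ} (hξ : IsCutoff ξ) :
    MemLp (powMul (m + 1 / 2) ξ) 2 μ :=
  memLp_powMul_of_isBigO hm hξ.contDiff.continuous
    (isBigO_gaussReal_of_hasCompactSupport hξ.contDiff.continuous hξ.compact 0)

theorem exists_powMul_mem_closure_coreGraph {m : ℂ} (hm : -1 < m.re) {q : ℝ → ℝ}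
    (hq : ContDiff ℝ ∞ q) (h0 : q 0 = 0) (h0' : deriv q 0 = 0) {u : ℝ}
    (hqu : q =O[⊤] gaussReal u) (hdqu : deriv q =O[⊤] gaussReal u)
    (hddqu : deriv (deriv q) =O[⊤] gaussReal u) :
    ∃ h : MemLp (powMul (m + 1 / 2) q) 2 μ, ∃ g : L2,
      (h.toLp _, g) ∈ (coreGraph (m ^ 2)).topologicalClosure := by
  have hdq : ContDiff ℝ ∞ (deriv q) := hq.iterate_deriv 1
  have hddq : ContDiff ℝ ∞ (deriv (deriv q)) := hdq.iterate_deriv 1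
  have hpow : ∀ f : ℝ → ℝ, f =O[⊤] gaussReal u → f =O[⊤] fun x => x ^ 0 * gaussReal u x :=
    fun f hf => by simpa only [pow_zero, one_mul] using hf
  have hdq_flat : deriv q =O[⊤] fun x => x ^ 1 * gaussReal u x :=
    isBigO_pow_succ_mul_gaussReal (hdq.differentiable (by simp)) h0' (hpow _ hddqu) hdqu
  have hq_flat : q =O[⊤] fun x => x ^ 2 * gaussReal u x :=
    isBigO_pow_succ_mul_gaussReal (hq.differentiable (by simp)) h0 hdq_flat hqu
  have hmem_q := memLp_cpow_mul_div_of_isBigO hm hq.continuous hq_flat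
  have hmem_dq := memLp_cpow_mul_div_of_isBigO hm hdq.continuous hdq_flat
  have hmem_ddq := memLp_cpow_mul_div_of_isBigO hm hddq.continuous (hpow _ hddqu)
  have hw := memLp_powMul_of_isBigO hm hq.continuous hqu
  have hdw : MemLp (fun x => deriv (powMul (m + 1 / 2) q) x / x) 2 μ := by
    refine ((hmem_q.const_mul (m + 1 / 2)).add hmem_dq).ae_eq ?_
    filter_upwards [ae_restrict_mem measurableSet_Ioi] with x hx
    have hxc : (x : ℂ) ≠ 0 := Complex.ofReal_ne_zero.2 (ne_of_gt hx)
    rw [(hasDerivAt_powMul _ (hq.differentiable (by simp) x).hasDerivAt hx).deriv, Pi.add_apply]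
    field_simp
  have hwx : MemLp (fun x => powMul (m + 1 / 2) q x / (x : ℂ) ^ 2) 2 μ := by
    simpa only [powMul, mul_div_assoc] using hmem_q
  have hLw : MemLp (schrodinger (m ^ 2) (powMul (m + 1 / 2) q)) 2 μ := by
    refine ((hmem_dq.const_mul (-(2 * (m + 1 / 2)))).sub hmem_ddq).ae_eq ?_
    filter_upwards [ae_restrict_mem measurableSet_Ioi] with x hx
    rw [schrodinger_powMul m hq hx, Pi.sub_apply]
    ring
  exact ⟨hw, hLw.toLp _,
    mem_closure_coreGraph (fun x hx => contDiffAt_powMul _ hq hx) hw hdw hwx hLw⟩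

theorem IsCutoff.exists_mem_closure_coreGraph {m : ℂ} (hm : -1 < m.re) {ξ : ℝ → ℝ}
    (hξ : IsCutoff ξ) (u : ℝ) :
    ∃ h : MemLp (powMul (m + 1 / 2) (gaussReal u - ξ)) 2 μ, ∃ g : L2,
      (h.toLp _, g) ∈ (coreGraph (m ^ 2)).topologicalClosure := by
  have hdξ : ContDiff ℝ ∞ (deriv ξ) := hξ.contDiff.iterate_deriv 1
  have hddξ : ContDiff ℝ ∞ (deriv (deriv ξ)) := hdξ.iterate_deriv 1
  have hdG : ContDiff ℝ ∞ (deriv (gaussReal u)) := (contDiff_gaussReal u).iterate_deriv 1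
  have hderiv : deriv (gaussReal u - ξ) = deriv (gaussReal u) - deriv ξ :=
    funext fun x => deriv_sub ((contDiff_gaussReal u).differentiable (by simp) x)
      (hξ.contDiff.differentiable (by simp) x)
  have hderiv₂ : deriv (deriv (gaussReal u - ξ)) =
      deriv (deriv (gaussReal u)) - deriv (deriv ξ) := by
    rw [hderiv]
    exact funext fun x => deriv_sub (hdG.differentiable (by simp) x)
      (hdξ.differentiable (by simp) x)
  have hG := pow_mul_gaussReal_isBigO (sub_one_lt u)
  have hG₀ : gaussReal u =O[⊤] gaussReal (u - 1) := by simpa only [pow_zero, one_mul] using hG 0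
  have hG₁ : deriv (gaussReal u) =O[⊤] gaussReal (u - 1) := by
    refine ((hG 1).const_mul_left (-Real.exp u)).congr_left fun x => ?_
    rw [deriv_gaussReal]
    ring
  have hG₂ : deriv (deriv (gaussReal u)) =O[⊤] gaussReal (u - 1) := by
    refine (((hG 2).const_mul_left (Real.exp u ^ 2)).sub
      (hG₀.const_mul_left (Real.exp u))).congr_left fun x => ?_
    rw [deriv_deriv_gaussReal]
    ring
  refine exists_powMul_mem_closure_coreGraph hm ((contDiff_gaussReal u).sub hξ.contDiff)
    (by simp [gaussReal, hξ.eq_one.self_of_nhds]) ?_ (u := u - 1)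
    (hG₀.sub (isBigO_gaussReal_of_hasCompactSupport hξ.contDiff.continuous hξ.compact _))
    (hderiv ▸ hG₁.sub (isBigO_gaussReal_of_hasCompactSupport hdξ.continuous hξ.compact.deriv _))
    (hderiv₂ ▸ hG₂.sub
      (isBigO_gaussReal_of_hasCompactSupport hddξ.continuous hξ.compact.deriv.deriv _))
  have : deriv ξ 0 = 0 := by
    rw [EventuallyEq.deriv_eq (f := fun _ => (1 : ℝ)) hξ.eq_one, deriv_const]
  rw [hderiv, Pi.sub_apply, this, deriv_gaussReal]
  simp

theorem mem_weakGraph_schrodinger {α : ℂ} {w : ℝ → ℂ} (hw : ∀ x, 0 < x → ContDiffAt ℝ ∞ w x)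
    {f g : L2} (hf : f =ᵐ[μ] w) (hg : g =ᵐ[μ] schrodinger α w) :
    (f, g) ∈ weakGraph (schrodinger α) (IsTest.schrodinger α) := by
  rw [mem_weakGraph]
  intro φ hφ
  have hw' := contDiffAt_deriv hw
  have hint : ∀ {v φ : ℝ → ℂ}, (∀ x, 0 < x → ContDiffAt ℝ ∞ v x) → IsTest φ →
      Integrable (fun x => v x * φ x) μ := fun hv hφ => (hφ.mul_left hv).integrable
  have hpot : ∀ x : ℝ, 0 < x → ContDiffAt ℝ ∞ (fun y : ℝ => (-1 / 4 + α) / (y : ℂ) ^ 2 * w y) x :=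
    fun x hx => (contDiffAt_const.mul ((Complex.ofRealCLM.contDiff.pow 2).contDiffAt.inv
      (pow_ne_zero 2 (Complex.ofReal_ne_zero.2 hx.ne')))).mul (hw x hx)
  calc ∫ x, f x * schrodinger α φ x ∂μ
      = ∫ x : ℝ, (-1 / 4 + α) / (x : ℂ) ^ 2 * w x * φ x - w x * deriv (deriv φ) x ∂μ := by
        refine integral_congr_ae ?_
        filter_upwards [hf] with x hx
        rw [hx, schrodinger]
        ring
    _ = ∫ x : ℝ, (-1 / 4 + α) / (x : ℂ) ^ 2 * w x * φ x - deriv (deriv w) x * φ x ∂μ := by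
        rw [integral_sub (hint hpot hφ) (hint hw hφ.deriv.deriv),
          integral_sub (hint hpot hφ) (hint (contDiffAt_deriv hw') hφ),
          integral_mul_deriv_of_contDiffAt hw hφ.deriv, integral_mul_deriv_of_contDiffAt hw' hφ,
          neg_neg]
    _ = ∫ x, g x * φ x ∂μ := by
        refine integral_congr_ae ?_
        filter_upwards [hg] with x hx
        rw [hx, schrodinger]
        ring

/-! ### The action of the operators on Gaussians -/

/-- The function `x² gauss m u` as an element of `L²[0,∞[`. -/
def sqVec {m : ℂ} (hm : -1 < m.re) (u : ℝ) : L2 := (memLp_pow_mul_gauss hm u 2).toLp _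

theorem coeFn_sqVec {m : ℂ} (hm : -1 < m.re) (u : ℝ) :
    sqVec hm u =ᵐ[μ] fun x => (x : ℂ) ^ 2 * gauss m u x :=
  MemLp.coeFn_toLp _

/-- The function `L_{m²} (gauss m u)` as an element of `L²[0,∞[`. -/
def schVec {m : ℂ} (hm : -1 < m.re) (u : ℝ) : L2 :=
  (2 * (m + 1) * Real.exp u) • gaussVec hm u - ((Real.exp u : ℂ) ^ 2) • sqVec hm u

theorem coeFn_smul_sub_smul (a b : ℂ) (f g : L2) :
    (a • f - b • g : L2) =ᵐ[μ] fun x => a * f x - b * g x := by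
  filter_upwards [Lp.coeFn_sub (a • f) (b • g), Lp.coeFn_smul a f, Lp.coeFn_smul b g]
    with x hsub hf hg
  rw [hsub, Pi.sub_apply, hf, hg, Pi.smul_apply, Pi.smul_apply, smul_eq_mul, smul_eq_mul]

theorem contDiffAt_gauss (m : ℂ) (u : ℝ) {x : ℝ} (hx : 0 < x) : ContDiffAt ℝ ∞ (gauss m u) x :=
  contDiffAt_const.mul (contDiffAt_powMul _ (contDiff_gaussReal u) hx)

theorem deriv_gauss (m : ℂ) (u : ℝ) {x : ℝ} (hx : 0 < x) :
    deriv (gauss m u) x = ((m + 1 / 2) / x - Real.exp u * x) * gauss m u x := by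
  refine ((hasDerivAt_powMul _ (hasDerivAt_gaussReal u x) hx).const_mul _).deriv.trans ?_
  simp only [gauss, powMul]
  push_cast
  ring

theorem schrodinger_const_mul (α c : ℂ) (w : ℝ → ℂ) (x : ℝ) :
    schrodinger α (fun y => c * w y) x = c * schrodinger α w x := by
  rw [schrodinger, schrodinger, deriv_const_mul_field', deriv_const_mul_field']
  ring

theorem schrodinger_gauss (m : ℂ) (u : ℝ) {x : ℝ} (hx : 0 < x) :
    schrodinger (m ^ 2) (gauss m u) x =
      2 * (m + 1) * Real.exp u * gauss m u x - (Real.exp u : ℂ) ^ 2 * (x ^ 2 * gauss m u x) := by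
  have hxc : (x : ℂ) ≠ 0 := Complex.ofReal_ne_zero.2 hx.ne'
  unfold gauss
  rw [schrodinger_const_mul, schrodinger_powMul m (contDiff_gaussReal u) hx,
    deriv_deriv_gaussReal, deriv_gaussReal]
  simp only [powMul]
  push_cast
  field_simp
  ring

theorem coeFn_schVec {m : ℂ} (hm : -1 < m.re) (u : ℝ) :
    schVec hm u =ᵐ[μ] schrodinger (m ^ 2) (gauss m u) := by
  filter_upwards [coeFn_smul_sub_smul (2 * (m + 1) * Real.exp u) ((Real.exp u : ℂ) ^ 2)
    (gaussVec hm u) (sqVec hm u), coeFn_gaussVec hm u, coeFn_sqVec hm u,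
    ae_restrict_mem measurableSet_Ioi] with x hcomb hgauss hsq hx
  rw [schVec, hcomb, hgauss, hsq, schrodinger_gauss m u hx]

theorem gaussVec_mem_A_graph {m : ℂ} (hm : -1 < m.re) (u : ℝ) :
    (gaussVec hm u, (-Complex.I * (m + 1)) • gaussVec hm u -
      (-Complex.I * Real.exp u) • sqVec hm u) ∈ A.graph := by
  refine mem_A_graph_of_contDiffAt (fun x hx => contDiffAt_gauss m u hx)
    (v := fun x => -Complex.I * (m + 1) * gauss m u x -
      -Complex.I * Real.exp u * (x ^ 2 * gauss m u x)) (fun x hx => ?_) (coeFn_gaussVec hm u) ?_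
  · have hxc : (x : ℂ) ≠ 0 := Complex.ofReal_ne_zero.2 hx.ne'
    rw [deriv_gauss m u hx]
    field_simp
    ring
  · filter_upwards [coeFn_smul_sub_smul (-Complex.I * (m + 1)) (-Complex.I * Real.exp u)
      (gaussVec hm u) (sqVec hm u), coeFn_gaussVec hm u, coeFn_sqVec hm u] with x hcomb hgauss hsq
    rw [hcomb, hgauss, hsq]

/-- `x² gauss m u` is a combination of `gauss m u` and `A (gauss m u)`, and the Hankel
transformation intertwines `A` with `-A`. -/
theorem hankel_sqVec {m : ℂ} (hm : -1 < m.re) (u : ℝ) :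
    hankel hm (sqVec hm u) = schVec hm (-u) := by
  have hgraph := hankel_mem_A_graph hm (gaussVec_mem_A_graph hm u)
  rw [hankel_gaussVec] at hgraph
  have heq := A.mem_graph_snd_inj hgraph (gaussVec_mem_A_graph hm (-u)) rfl
  rw [map_sub, map_smul, map_smul, hankel_gaussVec] at heq
  have hexp : (Real.exp u : ℂ) * Real.exp (-u) = 1 := by
    rw [← Complex.ofReal_mul, ← Real.exp_add, add_neg_cancel, Real.exp_zero, Complex.ofReal_one]
  have hne : Complex.I * Real.exp u ≠ 0 :=
    mul_ne_zero Complex.I_ne_zero (left_ne_zero_of_mul_eq_one hexp)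
  refine smul_right_injective L2 hne ?_
  rw [schVec]
  generalize (Real.exp u : ℂ) = e, (Real.exp (-u) : ℂ) = e' at *
  linear_combination (norm := skip) -heq
  match_scalars
  · ring
  · linear_combination (-2 * Complex.I * (m + 1)) * hexp
  · linear_combination (Complex.I * e') * hexp

theorem hankel_schVec {m : ℂ} (hm : -1 < m.re) (u : ℝ) :
    hankel hm (schVec hm u) = sqVec hm (-u) := by
  rw [← neg_neg u, ← hankel_sqVec, hankel_hankel, neg_neg]

theorem gaussVec_schVec_mem_weakGraph {m : ℂ} (hm : -1 < m.re) (u : ℝ) :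
    (gaussVec hm u, schVec hm u) ∈ weakGraph (schrodinger (m ^ 2)) (IsTest.schrodinger (m ^ 2)) :=
  mem_weakGraph_schrodinger (fun _ hx => contDiffAt_gauss m u hx) (coeFn_gaussVec hm u)
    (coeFn_schVec hm u)

theorem gaussVec_sqVec_mem_mulGraph {m : ℂ} (hm : -1 < m.re) (u : ℝ) :
    (gaussVec hm u, sqVec hm u) ∈ mulGraph fun x => (x : ℂ) ^ 2 := by
  change sqVec hm u =ᵐ[μ] fun x => (x : ℂ) ^ 2 * gaussVec hm u x
  filter_upwards [coeFn_gaussVec hm u, coeFn_sqVec hm u] with x hgauss hsq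
  rw [hgauss, hsq]

theorem mem_mulGraph_sq_of_pair {m : ℂ} (hm : -1 < m.re) {f g : L2}
    (h : ∀ u, pair g (gaussVec hm u) = pair f (sqVec hm u)) :
    (f, g) ∈ mulGraph fun x => (x : ℂ) ^ 2 := by
  have hint_g : ∀ u, Integrable (fun x => g x * gauss m u x) μ := fun u =>
    (Lp.memLp _).integrable_mul (memLp_gauss hm u)
  have hint_f : ∀ u, Integrable (fun x => f x * ((x : ℂ) ^ 2 * gauss m u x)) μ := fun u =>
    (Lp.memLp _).integrable_mul (memLp_pow_mul_gauss hm u 2)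
  have hsplit : ∀ u, (fun x : ℝ => (g x - (x : ℂ) ^ 2 * f x) * gauss m u x) =
      fun x => g x * gauss m u x - f x * ((x : ℂ) ^ 2 * gauss m u x) :=
    fun u => funext fun x => by ring
  have hzero := ae_eq_zero_of_integral_gauss (f := fun x => g x - (x : ℂ) ^ 2 * f x) m 0
    (hsplit 0 ▸ (hint_g 0).sub (hint_f 0)) fun u _ => by
      rw [hsplit, integral_sub (hint_g u) (hint_f u), ← pair_toLp _ (memLp_gauss hm u),
        ← pair_toLp _ (memLp_pow_mul_gauss hm u 2)]
      exact sub_eq_zero.2 (h u)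
  change g =ᵐ[μ] fun x => (x : ℂ) ^ 2 * f x
  filter_upwards [hzero] with x hx
  exact sub_eq_zero.1 hx

theorem hankel_mem_mulGraph_of_mem_coreGraph {m : ℂ} (hm : -1 < m.re) {f g : L2}
    (h : (f, g) ∈ coreGraph (m ^ 2)) :
    (hankel hm f, hankel hm g) ∈ mulGraph fun x => (x : ℂ) ^ 2 := by
  obtain ⟨φ, hφ, hf, hg⟩ := h
  refine mem_mulGraph_sq_of_pair hm fun u => ?_
  rw [pair_hankel, pair_hankel, hankel_gaussVec, hankel_sqVec, pair_comm g, pair_comm f,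
    pair_apply, pair_apply]
  calc ∫ x, gaussVec hm (-u) x * g x ∂μ
      = ∫ x, gaussVec hm (-u) x * schrodinger (m ^ 2) φ x ∂μ := by
        refine integral_congr_ae ?_
        filter_upwards [hg] with x hx
        rw [← hx]
    _ = ∫ x, schVec hm (-u) x * φ x ∂μ :=
        mem_weakGraph.1 (gaussVec_schVec_mem_weakGraph hm (-u)) φ hφ
    _ = ∫ x, schVec hm (-u) x * f x ∂μ := by
        refine integral_congr_ae ?_
        filter_upwards [hf] with x hx
        rw [← hx]

/-! ### A core of `X²` -/

theorem one_add_ofReal_sq_ne_zero (x : ℝ) : 1 + (x : ℂ) ^ 2 ≠ 0 := by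
  have : (1 + x ^ 2 : ℝ) ≠ 0 := by positivity
  exact_mod_cast this

theorem norm_one_add_ofReal_sq_inv_le_one (x : ℝ) : ‖(1 + (x : ℂ) ^ 2)⁻¹‖ ≤ 1 := by
  have hcast : (1 : ℂ) + (x : ℂ) ^ 2 = ((1 + x ^ 2 : ℝ) : ℂ) := by push_cast; rfl
  rw [hcast, norm_inv, Complex.norm_of_nonneg (by positivity)]
  exact inv_le_one_of_one_le₀ (le_add_of_nonneg_right (sq_nonneg x))

theorem memLp_top_one_add_sq_inv : MemLp (fun x : ℝ => (1 + (x : ℂ) ^ 2)⁻¹) ⊤ μ :=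
  memLp_top_of_bound
    (Continuous.inv₀ (by fun_prop) one_add_ofReal_sq_ne_zero).aestronglyMeasurable 1
    (ae_of_all _ norm_one_add_ofReal_sq_inv_le_one)

/-- The bounded operator `(1 + X²)⁻¹` of multiplication by `(1 + x²)⁻¹`. -/
def resolventXsq : L2 →L[ℂ] L2 :=
  (ContinuousLinearMap.mul ℂ ℂ).holderL μ ⊤ 2 2 (memLp_top_one_add_sq_inv.toLp _)

theorem coeFn_resolventXsq (f : L2) :
    resolventXsq f =ᵐ[μ] fun x : ℝ => (1 + (x : ℂ) ^ 2)⁻¹ * f x := by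
  filter_upwards [(ContinuousLinearMap.mul ℂ ℂ).coeFn_holder (r := 2)
    (memLp_top_one_add_sq_inv.toLp _) f, memLp_top_one_add_sq_inv.coeFn_toLp] with x hmul hinv
  rw [← hinv]
  exact hmul

theorem mem_mulGraph_sq_iff (p : L2 × L2) :
    (p ∈ mulGraph fun x => (x : ℂ) ^ 2) ↔ resolventXsq (p.1 + p.2) = p.1 := by
  have hres : resolventXsq (p.1 + p.2) =ᵐ[μ] fun x : ℝ =>
      (1 + (x : ℂ) ^ 2)⁻¹ * (p.1 x + p.2 x) := by
    filter_upwards [coeFn_resolventXsq (p.1 + p.2), Lp.coeFn_add p.1 p.2] with x hx hadd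
    rw [hx, hadd, Pi.add_apply]
  have hpoint : ∀ x : ℝ, p.2 x = (x : ℂ) ^ 2 * p.1 x ↔
      (1 + (x : ℂ) ^ 2)⁻¹ * (p.1 x + p.2 x) = p.1 x := fun x => by
    rw [inv_mul_eq_iff_eq_mul₀ (one_add_ofReal_sq_ne_zero x), one_add_mul, add_right_inj]
  calc (p ∈ mulGraph fun x => (x : ℂ) ^ 2)
      ↔ (fun x : ℝ => (1 + (x : ℂ) ^ 2)⁻¹ * (p.1 x + p.2 x)) =ᵐ[μ] p.1 :=
        eventually_congr (ae_of_all _ hpoint)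
    _ ↔ resolventXsq (p.1 + p.2) = p.1 :=
        ⟨fun h => Lp.ext (hres.trans h), fun h => hres.symm.trans (Lp.ext_iff.1 h)⟩

theorem isClosed_mulGraph_sq : IsClosed (mulGraph fun x => (x : ℂ) ^ 2 : Set (L2 × L2)) := by
  have heq : (mulGraph fun x => (x : ℂ) ^ 2 : Set (L2 × L2)) =
      {p | resolventXsq (p.1 + p.2) = p.1} := Set.ext mem_mulGraph_sq_iff
  rw [heq]
  exact isClosed_eq (resolventXsq.continuous.comp (continuous_fst.add continuous_snd))
    continuous_fst

/-- The graph of `X²` is the image of `f ↦ ((1 + X²)⁻¹ f, f - (1 + X²)⁻¹ f)`, under which the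
total family `(1 + x²) gauss m u` goes to the given elements of `T`. -/
theorem mulGraph_sq_le {m : ℂ} (hm : -1 < m.re) {T : Submodule ℂ (L2 × L2)}
    (hT : IsClosed (T : Set (L2 × L2))) (h : ∀ u, (gaussVec hm u, sqVec hm u) ∈ T) :
    mulGraph (fun x => (x : ℂ) ^ 2) ≤ T := by
  set N : L2 →L[ℂ] L2 × L2 := resolventXsq.prod (ContinuousLinearMap.id ℂ L2 - resolventXsq)
  have hN : ∀ p ∈ mulGraph (fun x => (x : ℂ) ^ 2), N (p.1 + p.2) = p := by
    intro p hp
    have hres := (mem_mulGraph_sq_iff p).1 hp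
    refine Prod.ext hres ?_
    change p.1 + p.2 - resolventXsq (p.1 + p.2) = p.2
    rw [hres, add_sub_cancel_left]
  have hcoe : ∀ u, (gaussVec hm u + sqVec hm u : L2) =ᵐ[μ]
      fun x => (1 + (x : ℂ) ^ 2) * gauss m u x := by
    intro u
    filter_upwards [coeFn_gaussVec hm u, coeFn_sqVec hm u,
      Lp.coeFn_add (gaussVec hm u) (sqVec hm u)] with x hgauss hsq hadd
    rw [hadd, Pi.add_apply, hgauss, hsq, one_add_mul]
  have htop : (⊤ : Submodule ℂ L2) ≤ T.comap (N : L2 →ₗ[ℂ] L2 × L2) := by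
    rw [← topologicalClosure_span_eq_top hcoe fun x _ => one_add_ofReal_sq_ne_zero x]
    refine Submodule.topologicalClosure_minimal _ (Submodule.span_le.2 ?_)
      (hT.preimage N.continuous)
    rintro _ ⟨u, rfl⟩
    change N (gaussVec hm u + sqVec hm u) ∈ T
    rw [hN _ (gaussVec_sqVec_mem_mulGraph hm u)]
    exact h u
  intro p hp
  rw [← hN p hp]
  exact htop (Submodule.mem_top (x := p.1 + p.2))

/-! ### Diagonalization of `H_m` -/

theorem mem_H_graph_iff {m : ℂ} {ξ : ℝ → ℝ} {f g : L2} : (f, g) ∈ (H m ξ).graph ↔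
    f ∈ domH m ξ ∧ (f, g) ∈ weakGraph (schrodinger (m ^ 2)) (IsTest.schrodinger (m ^ 2)) := by
  rw [← schrodingerMax_graph]
  constructor
  · intro h
    obtain ⟨⟨y, hydom, hymax⟩, rfl, hyg⟩ := (LinearPMap.mem_graph_iff _).1 h
    refine ⟨hydom, (LinearPMap.mem_graph_iff _).2 ⟨⟨y, hymax⟩, rfl, ?_⟩⟩
    rw [← hyg]
    exact (LinearPMap.domRestrict_apply rfl).symm
  · rintro ⟨hdom, h⟩
    obtain ⟨⟨y, hymax⟩, rfl, hyg⟩ := (LinearPMap.mem_graph_iff _).1 h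
    refine (LinearPMap.mem_graph_iff _).2 ⟨⟨y, hdom, hymax⟩, rfl, ?_⟩
    rw [← hyg]
    exact LinearPMap.domRestrict_apply rfl

theorem closure_coreGraph_le_weakGraph (α : ℂ) :
    (coreGraph α).topologicalClosure ≤ weakGraph (schrodinger α) (IsTest.schrodinger α) :=
  Submodule.topologicalClosure_minimal _ (coreGraph_le α) (isClosed_weakGraph _ _)

theorem snd_unique_of_mem_weakGraph {α : ℂ} {f g h : L2}
    (hg : (f, g) ∈ weakGraph (schrodinger α) (IsTest.schrodinger α))
    (hh : (f, h) ∈ weakGraph (schrodinger α) (IsTest.schrodinger α)) : g = h := by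
  rw [← schrodingerMax_graph] at hg hh
  exact LinearPMap.mem_graph_snd_inj _ hg hh rfl

theorem IsCutoff.exists_gaussVec_eq {m : ℂ} (hm : -1 < m.re) {ξ : ℝ → ℝ} (hξ : IsCutoff ξ)
    (u : ℝ) : ∃ f g : L2, (f, g) ∈ (coreGraph (m ^ 2)).topologicalClosure ∧
      gaussVec hm u = Complex.exp ((m + 1) * u / 2) • (f + (hξ.memLp hm).toLp _) := by
  obtain ⟨hdiff, g, hg⟩ := hξ.exists_mem_closure_coreGraph hm u
  refine ⟨_, g, hg, Lp.ext ?_⟩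
  rw [← MemLp.toLp_add, ← MemLp.toLp_const_smul]
  filter_upwards [coeFn_gaussVec hm u, MemLp.coeFn_toLp
    ((hdiff.add (hξ.memLp hm)).const_smul (Complex.exp ((m + 1) * u / 2)))] with x hgauss hsum
  rw [hgauss, hsum, gauss]
  simp only [powMul, Pi.sub_apply, Pi.add_apply, Pi.smul_apply, smul_eq_mul]
  push_cast
  ring

theorem IsCutoff.mem_domH_iff {m : ℂ} (hm : -1 < m.re) {ξ : ℝ → ℝ} (hξ : IsCutoff ξ) {f : L2} :
    f ∈ domH m ξ ↔ ∃ f₀ g₀ : L2, (f₀, g₀) ∈ (coreGraph (m ^ 2)).topologicalClosure ∧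
      ∃ c : ℂ, f = f₀ + c • (hξ.memLp hm).toLp _ := by
  have hcoe : ∀ (f₀ : L2) (c : ℂ), (f₀ + c • (hξ.memLp hm).toLp _ : L2) =ᵐ[μ]
      fun x => f₀ x + c * ((x : ℂ) ^ (1 / 2 + m) * ξ x) := by
    intro f₀ c
    filter_upwards [(hξ.memLp hm).coeFn_toLp, Lp.coeFn_smul c ((hξ.memLp hm).toLp _),
      Lp.coeFn_add f₀ (c • (hξ.memLp hm).toLp _)] with x hcutoff hsmul hadd
    rw [hadd, Pi.add_apply, hsmul, Pi.smul_apply, hcutoff, powMul, add_comm (1 / 2 : ℂ),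
      smul_eq_mul]
  change (∃ f₀ ∈ (schrodingerMin (m ^ 2)).domain, ∃ c : ℂ, _) ↔ _
  simp only [LinearPMap.mem_domain_iff, schrodingerMin_graph]
  constructor
  · rintro ⟨f₀, ⟨g₀, hg₀⟩, c, hc⟩
    exact ⟨f₀, g₀, hg₀, c, Lp.ext (hc.trans (hcoe f₀ c).symm)⟩
  · rintro ⟨f₀, g₀, hg₀, c, rfl⟩
    exact ⟨f₀, ⟨g₀, hg₀⟩, c, hcoe f₀ c⟩

theorem gaussVec_schVec_mem_H_graph {m : ℂ} (hm : -1 < m.re) {ξ : ℝ → ℝ} (hξ : IsCutoff ξ)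
    (u : ℝ) : (gaussVec hm u, schVec hm u) ∈ (H m ξ).graph := by
  refine mem_H_graph_iff.2 ⟨(hξ.mem_domH_iff hm).2 ?_, gaussVec_schVec_mem_weakGraph hm u⟩
  obtain ⟨f, g, hfg, heq⟩ := hξ.exists_gaussVec_eq hm u
  set c := Complex.exp ((m + 1) * u / 2)
  exact ⟨c • f, c • g, Submodule.smul_mem _ c hfg, c, by rw [heq, smul_add]⟩

theorem H_graph_eq {m : ℂ} (hm : -1 < m.re) {ξ : ℝ → ℝ} (hξ : IsCutoff ξ) :
    (H m ξ).graph = (coreGraph (m ^ 2)).topologicalClosure ⊔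
      Submodule.span ℂ {(gaussVec hm 0, schVec hm 0)} := by
  refine le_antisymm ?_ (sup_le ?_ ((Submodule.span_singleton_le_iff_mem _ _).2
    (gaussVec_schVec_mem_H_graph hm hξ 0)))
  · rintro ⟨f, g⟩ h
    obtain ⟨hdom, hweak⟩ := mem_H_graph_iff.1 h
    obtain ⟨f₀, g₀, hcore, c, rfl⟩ := (hξ.mem_domH_iff hm).1 hdom
    obtain ⟨f₁, g₁, hcore₁, hgauss⟩ := hξ.exists_gaussVec_eq hm 0
    have hmin : (f₀, g₀) - c • (f₁, g₁) ∈ (coreGraph (m ^ 2)).topologicalClosure :=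
      sub_mem hcore (Submodule.smul_mem _ c hcore₁)
    have hsum : (f₀ + c • (hξ.memLp hm).toLp _, g₀ - c • g₁ + c • schVec hm 0) =
        ((f₀, g₀) - c • (f₁, g₁)) + c • (gaussVec hm 0, schVec hm 0) := by
      refine Prod.ext ?_ rfl
      simp only [hgauss, Complex.ofReal_zero, mul_zero, zero_div, Complex.exp_zero, one_smul,
        Prod.fst_add, Prod.fst_sub, Prod.smul_fst, smul_add]
      abel
    have hweak' := add_mem (closure_coreGraph_le_weakGraph _ hmin)
      (Submodule.smul_mem _ c (gaussVec_schVec_mem_weakGraph hm 0))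
    rw [← hsum] at hweak'
    rw [snd_unique_of_mem_weakGraph hweak hweak', hsum]
    exact Submodule.add_mem_sup hmin
      (Submodule.smul_mem _ c (Submodule.mem_span_singleton_self _))
  · rintro ⟨f, g⟩ h
    refine mem_H_graph_iff.2 ⟨(hξ.mem_domH_iff hm).2 ⟨f, g, h, 0, ?_⟩,
      closure_coreGraph_le_weakGraph _ h⟩
    rw [zero_smul, add_zero]

theorem isClosed_H_graph {m : ℂ} (hm : -1 < m.re) {ξ : ℝ → ℝ} (hξ : IsCutoff ξ) :
    IsClosed ((H m ξ).graph : Set (L2 × L2)) := by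
  rw [H_graph_eq hm hξ]
  exact Submodule.isClosed_sup_finiteDimensional _ _ (Submodule.isClosed_topologicalClosure _)

theorem hankel_mem_mulGraph_of_mem_H_graph {m : ℂ} (hm : -1 < m.re) {ξ : ℝ → ℝ}
    (hξ : IsCutoff ξ) {f g : L2} (h : (f, g) ∈ (H m ξ).graph) :
    (hankel hm f, hankel hm g) ∈ mulGraph fun x => (x : ℂ) ^ 2 := by
  rw [H_graph_eq hm hξ] at h
  have hle : (coreGraph (m ^ 2)).topologicalClosure ⊔
      Submodule.span ℂ {(gaussVec hm 0, schVec hm 0)} ≤ (mulGraph fun x => (x : ℂ) ^ 2).comap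
        ((hankel hm).prodMap (hankel hm) : L2 × L2 →ₗ[ℂ] L2 × L2) := by
    refine sup_le (Submodule.topologicalClosure_minimal _
      (fun _ hp => hankel_mem_mulGraph_of_mem_coreGraph hm hp)
      (isClosed_mulGraph_sq.preimage ((hankel hm).prodMap (hankel hm)).continuous))
      ((Submodule.span_singleton_le_iff_mem _ _).2 ?_)
    change (hankel hm (gaussVec hm 0), hankel hm (schVec hm 0)) ∈ mulGraph _
    rw [hankel_gaussVec, hankel_schVec]
    exact gaussVec_sqVec_mem_mulGraph hm _
  exact hle h

theorem hankel_mem_H_graph_of_mem_mulGraph {m : ℂ} (hm : -1 < m.re) {ξ : ℝ → ℝ}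
    (hξ : IsCutoff ξ) {f g : L2} (h : (f, g) ∈ mulGraph fun x => (x : ℂ) ^ 2) :
    (hankel hm f, hankel hm g) ∈ (H m ξ).graph := by
  have hle : mulGraph (fun x => (x : ℂ) ^ 2) ≤ (H m ξ).graph.comap
      ((hankel hm).prodMap (hankel hm) : L2 × L2 →ₗ[ℂ] L2 × L2) := by
    refine mulGraph_sq_le hm ((isClosed_H_graph hm hξ).preimage
      ((hankel hm).prodMap (hankel hm)).continuous) fun u => ?_
    change (hankel hm (gaussVec hm u), hankel hm (sqVec hm u)) ∈ (H m ξ).graph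
    rw [hankel_gaussVec, hankel_sqVec]
    exact gaussVec_schVec_mem_H_graph hm hξ _
  exact hle h

/-! ### Equality of unbounded operators -/

theorem mem_compRight_graph {B : L2 →ₗ.[ℂ] L2} {F : L2 →L[ℂ] L2} {f g : L2} :
    (f, g) ∈ (compRight B F).graph ↔ (F f, g) ∈ B.graph := by
  constructor
  · intro h
    obtain ⟨⟨y, hy⟩, rfl, hyg⟩ := (LinearPMap.mem_graph_iff _).1 h
    exact (LinearPMap.mem_graph_iff _).2 ⟨⟨F y, hy⟩, rfl, hyg⟩
  · intro h
    obtain ⟨⟨y, hy⟩, rfl, hyg⟩ := (LinearPMap.mem_graph_iff _).1 h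
    exact (LinearPMap.mem_graph_iff _).2 ⟨⟨f, hy⟩, rfl, hyg⟩

theorem mem_compLeft_graph {B : L2 →ₗ.[ℂ] L2} {F : L2 →L[ℂ] L2} {f g : L2} :
    (f, g) ∈ (compLeft F B).graph ↔ ∃ h, (f, h) ∈ B.graph ∧ F h = g := by
  constructor
  · intro h
    obtain ⟨y, hy, hyg⟩ := (LinearPMap.mem_graph_iff _).1 h
    exact ⟨B y, (LinearPMap.mem_graph_iff _).2 ⟨y, hy, rfl⟩, hyg⟩
  · rintro ⟨h, hh, rfl⟩
    obtain ⟨y, hy, hyg⟩ := (LinearPMap.mem_graph_iff _).1 hh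
    exact (LinearPMap.mem_graph_iff _).2 ⟨y, hy, congrArg F hyg⟩

theorem mem_neg_graph {B : L2 →ₗ.[ℂ] L2} {f g : L2} :
    (f, g) ∈ (-B).graph ↔ (f, -g) ∈ B.graph := by
  simp only [LinearPMap.mem_graph_iff, LinearPMap.neg_apply, neg_eq_iff_eq_neg]
  rfl

/-- The Hankel transformation as an invertible operator. -/
def hankelEquiv {m : ℂ} (hm : -1 < m.re) : L2 ≃L[ℂ] L2 :=
  ContinuousLinearEquiv.equivOfInverse (hankel hm) (hankel hm) (hankel_hankel hm) (hankel_hankel hm)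

theorem hankel_H_hankel {m : ℂ} (hm : -1 < m.re) {ξ : ℝ → ℝ} (hξ : IsCutoff ξ) :
    compRight (compLeft (hankelEquiv hm) (H m ξ)) (hankelEquiv hm).symm = Xsq := by
  refine LinearPMap.eq_of_eq_graph (Submodule.ext ?_)
  rintro ⟨f, g⟩
  rw [mem_compRight_graph, mem_compLeft_graph, Xsq_graph]
  constructor
  · rintro ⟨h, hh, rfl⟩
    have hmul := hankel_mem_mulGraph_of_mem_H_graph hm hξ hh
    change (hankel hm (hankel hm f), hankel hm h) ∈ _ at hmul
    rwa [hankel_hankel] at hmul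
  · intro h
    exact ⟨hankel hm g, hankel_mem_H_graph_of_mem_mulGraph hm hξ h, hankel_hankel hm g⟩

theorem hankel_A {m : ℂ} (hm : -1 < m.re) :
    compLeft (hankelEquiv hm) A = -compRight A (hankelEquiv hm) := by
  refine LinearPMap.eq_of_eq_graph (Submodule.ext ?_)
  rintro ⟨f, g⟩
  rw [mem_neg_graph, mem_compRight_graph, mem_compLeft_graph]
  constructor
  · rintro ⟨h, hh, rfl⟩
    exact hankel_mem_A_graph hm hh
  · intro h
    have hneg := hankel_mem_A_graph hm (f := hankel hm f) h
    rw [hankel_hankel, map_neg, neg_neg] at hneg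
    exact ⟨hankel hm g, hneg, hankel_hankel hm g⟩

end HalfLine

end

theorem mainTheorem7 (m : ℂ) (hm : -1 < m.re) :
    IsSelfAdjoint HalfLine.A ∧
    (∀ f g : HalfLine.L2, (f, g) ∈ HalfLine.A.graph ↔
      HasDerivAt (fun τ : ℝ => HalfLine.U τ f) (Complex.I • g) 0) ∧
    ∃ F : HalfLine.L2 ≃L[ℂ] HalfLine.L2,
      HalfLine.IsHankelTransform m F ∧
      (∀ f : HalfLine.L2, F (F f) = f) ∧
      (∀ ξ : ℝ → ℝ, HalfLine.IsCutoff ξ →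
        HalfLine.compRight (HalfLine.compLeft F (HalfLine.H m ξ)) F.symm = HalfLine.Xsq) ∧
      HalfLine.compLeft F HalfLine.A = -HalfLine.compRight HalfLine.A F :=
  ⟨HalfLine.isSelfAdjoint_A, HalfLine.mem_A_graph_iff, HalfLine.hankelEquiv hm,
    HalfLine.isHankelTransform_hankel hm, HalfLine.hankel_hankel hm,
    fun _ hξ => HalfLine.hankel_H_hankel hm hξ, HalfLine.hankel_A hm⟩
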